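/- Let $R_0$ be a commutative ring, $V$ a free $R_0$-module with basis $v_1,\dots,v_n$, dual basis $v_i^\vee$ and coordinates $x_1,\dots,x_n$; put $E=\Lambda V$ with filtration $F^pE=E^{\le p}$, $R=R_0[[V]]=R_0[[x_1,\dots,x_n]]$, $\mathfrak m=\{r\in R: r(0)=0\}$ and $\mathbf v=\sum_i x_iv_i$. A *superfiltered $A_\infty$-deformation* of $E$ is a strictly unital $\mathbb Z/2$-graded $A_\infty$-structure $\mathcal A=(E,(\mu^k)_{k\ge2})$ (Seidel's sign conventions, $\mu^0=\mu^1=0$, unit $1\in E$) such that each $\mu^k:E[1]^{\otimes k}\to E[1]$ has odd degree and raises the filtration by at most $1$, and the induced structure on the associated graded is $\mu^2(a_2,a_1)=(-1)^{|a_1|}a_2\wedge a_1$, $\mu^k=0$ for $k\ge3$. Its *disc potential* is $\mathfrak P=\sum_{k\ge2}\mu^k(\mathbf v,\dots,\mathbf v)$, the $\mu^k$ being extended $R$-multilinearly. It has coefficients in $R_0=E^0$ and lies in $\mathfrak m^2$. Let $w\in\mathfrak m^2$. There are $w_1,\dots,w_n\in\mathfrak m$ with $\sum_ix_iw_i=w$;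 these, moreover, can be chosen together with $\lambda_{ij}\in R$ such that $w_i=-\sum_j\lambda_{ij}x_j$ for all $i$ and $\lambda_{ij}\in\mathfrak m$ for $i<j$. For any such $w_i\in\mathfrak m$ with $\sum_i x_iw_i=w$, the stabilisation $\mathscr E_0$ of $R_0=R/\mathfrak m$, i.e. $R\otimes E$ with the endomorphism $\mathrm d_{\mathscr E_0}(a)=-\sum_i(x_i\,v_i\wedge a+w_i\,v_i^\vee\lrcorner a)$, is a filtered matrix factorisation of $w$ over $R$. Let $\mathcal B_0=\mathrm{End}_R(R\otimes E)$ be its endomorphism dg-algebra, with differential $f\mapsto\mathrm d_{\mathscr E_0}f-(-1)^{|f|}f\,\mathrm d_{\mathscr E_0}$, regarded as a superfiltered $A_\infty$-algebra over $R_0$ via $\mu^1(a)=(-1)^{|a|}\mathrm da$, $\mu^2(a_2,a_1)=(-1)^{|a_1|}a_2a_1$. Let $\pi:\mathcal B_0\to E$ be $f\mapsto f(1)\bmod\mathfrak m$. Call a pair $(\iota,\eta)$ *transfer data* if $\iota:E\to\mathcal B_0$ is $R_0$-linear, superfiltered of degree $0$, with values in cocycles, with $\iota(1)=1$, with leading term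 $a\mapsto(a\wedge\bullet)$ and with $\pi\iota=\mathrm{id}_E$, and $\eta:\mathcal B_0\to\mathcal B_0$ is $R_0$-linear and superfiltered of degree $-1$ with $\mu^1\eta+\eta\mu^1=\iota\pi-\mathrm{id}$, $\eta\iota=0$, $\pi\eta=0$, $\eta^2=0$. Then: 1. Transfer data exist. If moreover $w_i=-\sum_j\lambda_{ij}x_j$ with $\lambda_{ij}\in R$ and $\lambda_{ij}\in\mathfrak m$ for $i<j$, then there are transfer data with $\iota(v_{i_1}\wedge\dots\wedge v_{i_r})=f_{i_1}\circ\dots\circ f_{i_r}$ for $i_1<\dots<i_r$, where $f_i(a)=v_i\wedge a+\sum_j\lambda_{ij}\,v_j^\vee\lrcorner a$. 2. For all transfer data, define $\mathbf p_k(a_k,\dots,a_1)=\sum_{j=1}^{k-1}\mu^2(\eta\mathbf p_{k-j}(a_k,\dots,a_{j+1}),\eta\mathbf p_j(a_j,\dots,a_1))$ for $k\ge2$, with $\eta\mathbf p_1$ read as the identity. Then the operations $\mu^k_{\min}=\pi\circ\mathbf p_k\circ\iota^{\otimes k}$, $k\ge2$, form a superfiltered $A_\infty$-deformation $\mathcal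 B_0^{\min}$ of $E$. It is a minimal model of $\mathcal B_0$: the maps $I^1=\iota$, $I^k=\eta\circ\mathbf p_k\circ\iota^{\otimes k}$ ($k\ge2$) form a strictly unital $A_\infty$-homomorphism $\mathcal B_0^{\min}\to\mathcal B_0$, superfiltered of degree $0$, extending the quasi-isomorphism $\iota$. 3. The disc potential of $\mathcal B_0^{\min}$ is $w$. Consequently, for every $d\in\{0,1,2,\dots,\infty\}$ the map $$\{\text{superfiltered }A_\infty\text{-deformations of }E\}/\!\sim_d\ \longrightarrow\ \mathfrak m^2/\!\sim_d,\qquad \mathcal A\mapsto\mathfrak P,$$ is well defined and surjective. Here $\mathcal A_1\sim_d\mathcal A_2$ if there is a strictly unital $A_\infty$-homomorphism $\Phi:\mathcal A_1\to\mathcal A_2$, superfiltered of degree $0$, such that $\Phi^1$ is bijective and, on the associated graded, $\Phi^1$ is the identity if $d\ge1$ and $\Phi^k=0$ for $2\le k\le d$; and $\mathfrak P_1\sim_d\mathfrak P_2$ if $\mathfrak P_1=\mathfrak P_2\circ f$ for an invertible formal change of variables $f:V\to V$ with $f=\mathrm{id}_V$ modulo $\mathfrak m^{d+1}$ (for $d=\infty$: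 $f=\mathrm{id}_V$). In both cases the quotient is by the equivalence relation generated by $\sim_d$. -/

import Mathlib

open scoped TensorProduct

universe u v

noncomputable section

namespace MFPot

/-! ### Superfiltered modules -/

/-- A superfiltered structure on a module `X`: a `ℤ/2`-grading `X = X⁰ ⊕ X¹` and an increasing
`ℤ`-filtration which is compatible with the grading. -/
structure Superfiltration (K : Type*) (X : Type*) [CommRing K] [AddCommGroup X] [Module K X] where
  /-- the even part `par 0` and the odd part `par 1` -/
  par : ZMod 2 → Submodule K X
  /-- the filtration levels -/
  fil : ℤ → Submodule K X
  isCompl : IsCompl (par 0) (par 1)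
  mono : Monotone fil
  split : ∀ p, fil p = (fil p ⊓ par 0) ⊔ (fil p ⊓ par 1)
  step : ∀ p : ℤ, fil (p + 1) ⊓ par (p : ZMod 2) = fil p ⊓ par (p : ZMod 2)

namespace Superfiltration

section Grading

variable {K X : Type*} [CommRing K] [AddCommGroup X] [Module K X]
variable (𝒜 : ℕ → Submodule K X) [DirectSum.Decomposition 𝒜]

/-- The sum of the graded pieces `𝒜 n` with `n ∈ s`. -/
def supported (s : Set ℕ) : Submodule K X where
  carrier := {x | ∀ n, n ∉ s → (DirectSum.decompose 𝒜 x n : X) = 0}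
  zero_mem' := by intro n _; simp
  add_mem' := by
    intro x y hx hy n hn
    simp [DirectSum.decompose_add, hx n hn, hy n hn]
  smul_mem' := by
    intro c x hx n hn
    simp only [DirectSum.decompose_smul, DirectSum.smul_apply, Submodule.coe_smul, hx n hn, smul_zero]

theorem mem_supported_of_mem {s : Set ℕ} {n : ℕ} (hn : n ∈ s) {x : X} (hx : x ∈ 𝒜 n) :
    x ∈ supported 𝒜 s := by
  intro m hm
  exact DirectSum.decompose_of_mem_ne 𝒜 hx (fun h => hm (h ▸ hn))

theorem exists_split (s : Set ℕ) (x : X) : ∃ y z : X, x = y + z ∧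
    (∀ n, n ∉ s → (DirectSum.decompose 𝒜 y n : X) = 0) ∧
    (∀ n, n ∈ s → (DirectSum.decompose 𝒜 z n : X) = 0) ∧
    (∀ n, (DirectSum.decompose 𝒜 x n : X) = 0 → (DirectSum.decompose 𝒜 y n : X) = 0) ∧
    (∀ n, (DirectSum.decompose 𝒜 x n : X) = 0 → (DirectSum.decompose 𝒜 z n : X) = 0) := by
  classical
  have key : ∀ t : Set ℕ, ∃ y : X, ∀ n, (DirectSum.decompose 𝒜 y n : X) =
      if n ∈ t then (DirectSum.decompose 𝒜 x n : X) else 0 := by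
    intro t
    refine ⟨(DirectSum.decompose 𝒜).symm
      (DFinsupp.filter (fun n => n ∈ t) (DirectSum.decompose 𝒜 x)), fun n => ?_⟩
    rw [Equiv.apply_symm_apply]
    have : (DFinsupp.filter (fun n => n ∈ t) (DirectSum.decompose 𝒜 x)) n =
      if n ∈ t then DirectSum.decompose 𝒜 x n else 0 := DFinsupp.filter_apply _ _ _
    erw [this]
    split_ifs <;> rfl
  obtain ⟨y, hy⟩ := key s
  obtain ⟨z, hz⟩ := key sᶜ
  refine ⟨y, z, ?_, ?_, ?_, ?_, ?_⟩
  · apply (DirectSum.decompose 𝒜).injective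
    apply DFinsupp.ext
    intro n
    apply Subtype.ext
    rw [DirectSum.decompose_add]
    change _ = ((DirectSum.decompose 𝒜 y n : X) + (DirectSum.decompose 𝒜 z n : X))
    rw [hy, hz]
    by_cases h : n ∈ s <;> simp [h]
  · intro n hn; rw [hy]; simp [hn]
  · intro n hn; rw [hz]; simp [hn]
  · intro n hn; rw [hy]; simp [hn]
  · intro n hn; rw [hz]; simp [hn]

/-- The superfiltration induced by a grading: the parity `i` part is the sum of the pieces of degree
congruent to `i` modulo `2`, and level `p` is the sum of the pieces of degree at most `p`. -/
def ofGrading : Superfiltration K X where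
  par i := supported 𝒜 {n | (n : ZMod 2) = i}
  fil p := supported 𝒜 {n | (n : ℤ) ≤ p}
  isCompl := by
    constructor
    · rw [Submodule.disjoint_def]
      intro x h0 h1
      apply (DirectSum.decompose 𝒜).injective
      apply DFinsupp.ext
      intro n
      apply Subtype.ext
      rw [DirectSum.decompose_zero]
      by_cases h : (n : ZMod 2) = 0
      · exact h1 n (by simp [h])
      · exact h0 n (by simpa using h)
    · rw [codisjoint_iff, eq_top_iff]
      intro x _
      obtain ⟨y, z, rfl, hy, hz, -, -⟩ := exists_split 𝒜 {n | (n : ZMod 2) = 0} x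
      refine Submodule.add_mem_sup (fun n hn => hy n hn) (fun n hn => hz n ?_)
      have : ∀ a : ZMod 2, a ≠ 1 → a = 0 := by decide
      exact this _ hn
  mono := by
    intro p q hpq x hx n hn
    exact hx n (fun h => hn (le_trans h hpq))
  split := by
    intro p
    apply le_antisymm
    · intro x hx
      obtain ⟨y, z, hxyz, hy, hz, hy2, hz2⟩ := exists_split 𝒜 {n | (n : ZMod 2) = 0} x
      rw [hxyz]
      refine Submodule.add_mem_sup ⟨fun n hn => hy2 n (hx n hn), fun n hn => hy n hn⟩
        ⟨fun n hn => hz2 n (hx n hn), fun n hn => hz n ?_⟩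
      have : ∀ a : ZMod 2, a ≠ 1 → a = 0 := by decide
      exact this _ hn
    · exact sup_le inf_le_left inf_le_left
  step := by
    intro p
    apply le_antisymm
    · rintro x ⟨h1, h2⟩
      refine ⟨fun n hn => ?_, h2⟩
      by_cases hp : (n : ZMod 2) = (p : ZMod 2)
      · refine h1 n (fun hn2 => ?_)
        simp only [Set.mem_ofPred_eq] at hn hn2
        have hnp : (n : ℤ) = p + 1 := by omega
        have : ((n : ℤ) : ZMod 2) = (p : ZMod 2) + 1 := by rw [hnp]; push_cast; rfl
        rw [Int.cast_natCast, hp] at this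
        simp at this
      · exact h2 n hp
    · rintro x ⟨h1, h2⟩
      exact ⟨fun n hn => h1 n (fun h => hn (by simp only [Set.mem_ofPred_eq] at h ⊢; omega)), h2⟩

theorem map_supported {s t : Set ℕ} (f : Module.End K X)
    (hf : ∀ m ∈ s, ∀ x ∈ 𝒜 m, f x ∈ supported 𝒜 t) {x : X} (hx : x ∈ supported 𝒜 s) :
    f x ∈ supported 𝒜 t := by
  classical
  rw [← DirectSum.sum_support_decompose 𝒜 x, map_sum]
  refine Submodule.sum_mem _ fun m _ => ?_
  by_cases hm : m ∈ s
  · exact hf m hm _ (SetLike.coe_mem _)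
  · rw [hx m hm, map_zero]
    exact Submodule.zero_mem _

end Grading

section General

variable {K X : Type*} [CommRing K] [AddCommGroup X] [Module K X] (S : Superfiltration K X)

theorem isCompl_add (i : ZMod 2) : IsCompl (S.par i) (S.par (1 + i)) := by
  fin_cases i
  · exact S.isCompl
  · exact S.isCompl.symm

/-- The projection of `X` onto its parity `i` part. -/
def proj (i : ZMod 2) : X →ₗ[K] X := (S.par i).projection (S.par (1 + i)) (S.isCompl_add i)

/-- The grading involution `x ↦ (-1)^|x| x`. -/
def sgn : X →ₗ[K] X := S.proj 0 - S.proj 1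

theorem proj_mem (i : ZMod 2) (x : X) : S.proj i x ∈ S.par i := Submodule.projection_apply_mem _ _

theorem proj_of_mem {i : ZMod 2} {x : X} (hx : x ∈ S.par i) : S.proj i x = x :=
  Submodule.projection_apply_of_mem_left _ hx

theorem proj_of_mem_add {i : ZMod 2} {x : X} (hx : x ∈ S.par (1 + i)) : S.proj i x = 0 :=
  (Submodule.projection_apply_eq_zero_iff _).2 hx

theorem proj_add_proj (x : X) : S.proj 0 x + S.proj 1 x = x := by
  obtain ⟨a, ha, b, hb, rfl⟩ := Submodule.mem_sup.1
    (show x ∈ S.par 0 ⊔ S.par 1 by rw [S.isCompl.sup_eq_top]; trivial)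
  rw [map_add, map_add, S.proj_of_mem ha, S.proj_of_mem hb,
    S.proj_of_mem_add (i := 0) (by simpa using hb),
    S.proj_of_mem_add (i := 1) (by simpa [show (1 + 1 : ZMod 2) = 0 by decide] using ha)]
  simp

theorem proj_fil {p : ℤ} {x : X} (hx : x ∈ S.fil p) (i : ZMod 2) : S.proj i x ∈ S.fil p := by
  rw [S.split p] at hx
  obtain ⟨a, ha, b, hb, rfl⟩ := Submodule.mem_sup.1 hx
  have h1 : (1 + 1 : ZMod 2) = 0 := by decide
  fin_cases i
  · change S.proj 0 (a + b) ∈ _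
    rw [map_add, S.proj_of_mem ha.2, S.proj_of_mem_add (i := 0) (by simpa using hb.2), add_zero]
    exact ha.1
  · change S.proj 1 (a + b) ∈ _
    rw [map_add, S.proj_of_mem hb.2, S.proj_of_mem_add (i := 1) (by simpa [h1] using ha.2),
      zero_add]
    exact hb.1

theorem eq_even_add_odd (f : Module.End K X) :
    f = (S.proj 0 * f * S.proj 0 + S.proj 1 * f * S.proj 1) +
      (S.proj 0 * f * S.proj 1 + S.proj 1 * f * S.proj 0) := by
  ext x
  conv_lhs => rw [← S.proj_add_proj x, map_add, ← S.proj_add_proj (f (S.proj 0 x)),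
    ← S.proj_add_proj (f (S.proj 1 x))]
  simp only [LinearMap.add_apply, Module.End.mul_apply]
  abel

theorem even_part_mem (f : Module.End K X) (j : ZMod 2) (x : X) (hx : x ∈ S.par j) :
    (S.proj 0 * f * S.proj 0 + S.proj 1 * f * S.proj 1) x ∈ S.par (0 + j) := by
  have h1 : (1 + 1 : ZMod 2) = 0 := by decide
  have hd : ∀ a : ZMod 2, a = 0 ∨ a = 1 := by decide
  rw [LinearMap.add_apply]
  simp only [Module.End.mul_apply, zero_add]
  rcases hd j with rfl | rfl
  · rw [S.proj_of_mem_add (i := 1) (x := x) (by rwa [h1]), map_zero, map_zero, add_zero]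
    exact S.proj_mem 0 _
  · rw [S.proj_of_mem_add (i := 0) (x := x) (by rwa [add_zero]), map_zero, map_zero, zero_add]
    exact S.proj_mem 1 _

theorem odd_part_mem (f : Module.End K X) (j : ZMod 2) (x : X) (hx : x ∈ S.par j) :
    (S.proj 0 * f * S.proj 1 + S.proj 1 * f * S.proj 0) x ∈ S.par (1 + j) := by
  have h1 : (1 + 1 : ZMod 2) = 0 := by decide
  have hd : ∀ a : ZMod 2, a = 0 ∨ a = 1 := by decide
  rw [LinearMap.add_apply]
  simp only [Module.End.mul_apply]
  rcases hd j with rfl | rfl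
  · rw [S.proj_of_mem_add (i := 1) (x := x) (by rwa [h1]), map_zero, map_zero, zero_add, add_zero]
    exact S.proj_mem 1 _
  · rw [S.proj_of_mem_add (i := 0) (x := x) (by rwa [add_zero]), map_zero, map_zero, add_zero, h1]
    exact S.proj_mem 0 _

/-- The superfiltration of the endomorphism module: an endomorphism has parity `i` if it shifts
parities by `i`, and lies in level `p` if it raises the filtration by at most `p`. -/
def endo : Superfiltration K (Module.End K X) where
  par i := 
    { carrier := {f | ∀ j, ∀ x ∈ S.par j, f x ∈ S.par (i + j)}
      zero_mem' := fun j x _ => Submodule.zero_mem _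
      add_mem' := fun hf hg j x hx => Submodule.add_mem _ (hf j x hx) (hg j x hx)
      smul_mem' := fun c f hf j x hx => Submodule.smul_mem _ c (hf j x hx) }
  fil p :=
    { carrier := {f | ∀ q, ∀ x ∈ S.fil q, f x ∈ S.fil (q + p)}
      zero_mem' := fun j x _ => Submodule.zero_mem _
      add_mem' := fun hf hg j x hx => Submodule.add_mem _ (hf j x hx) (hg j x hx)
      smul_mem' := fun c f hf j x hx => Submodule.smul_mem _ c (hf j x hx) }
  isCompl := by
    constructor
    · rw [Submodule.disjoint_def]
      intro f h0 h1
      have hz : ∀ j, ∀ x ∈ S.par j, f x = 0 := by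
        intro j x hx
        have a0 := h0 j x hx
        rw [zero_add] at a0
        exact (Submodule.disjoint_def.1 (S.isCompl_add j).disjoint) _ a0 (h1 j x hx)
      ext x
      rw [← S.proj_add_proj x, map_add, hz 0 _ (S.proj_mem 0 x), hz 1 _ (S.proj_mem 1 x)]
      simp
    · rw [codisjoint_iff, eq_top_iff]
      intro f _
      rw [S.eq_even_add_odd f]
      exact Submodule.add_mem_sup (S.even_part_mem f) (S.odd_part_mem f)
  mono := by
    intro p p' hp f hf q x hx
    exact S.mono (by omega) (hf q x hx)
  split := by
    intro p
    apply le_antisymm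
    · intro f hfp
      have hfil : ∀ i j : ZMod 2, ∀ q, ∀ x ∈ S.fil q, S.proj i (f (S.proj j x)) ∈ S.fil (q + p) :=
        fun i j q x hx => S.proj_fil (hfp q _ (S.proj_fil hx j)) i
      rw [S.eq_even_add_odd f]
      exact Submodule.add_mem_sup
        ⟨fun q x hx => Submodule.add_mem _ (hfil 0 0 q x hx) (hfil 1 1 q x hx), S.even_part_mem f⟩
        ⟨fun q x hx => Submodule.add_mem _ (hfil 0 1 q x hx) (hfil 1 0 q x hx), S.odd_part_mem f⟩
    · exact sup_le inf_le_left inf_le_left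
  step := by
    intro p
    apply le_antisymm
    · rintro f ⟨h1, h2⟩
      refine ⟨fun q x hx => ?_, h2⟩
      have e2 : ∀ a : ZMod 2, 1 + a + 1 = a := by decide
      have key : ∀ y r, y ∈ S.fil (r + 1) → y ∈ S.par (r : ZMod 2) → y ∈ S.fil r := by
        intro y r hy hy2
        have : y ∈ S.fil (r + 1) ⊓ S.par (r : ZMod 2) := ⟨hy, hy2⟩
        rw [S.step] at this
        exact this.1
      have hA : ∀ y ∈ S.fil q, y ∈ S.par (q : ZMod 2) → f y ∈ S.fil (q + p) := by
        intro y hy hy2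
        refine key _ _ (by simpa [add_assoc] using h1 q y hy) ?_
        have := h2 _ y hy2
        push_cast
        rwa [add_comm]
      have hB : ∀ y ∈ S.fil q, y ∈ S.par (1 + (q : ZMod 2)) → f y ∈ S.fil (q + p) := by
        intro y hy hy2
        have hq : 1 + (q : ZMod 2) = ((q - 1 : ℤ) : ZMod 2) := by
          push_cast
          have : ∀ a : ZMod 2, 1 + a = a - 1 := by decide
          exact this _
        have hy3 : y ∈ S.fil (q - 1) := key y (q - 1) (by simpa using hy) (hq ▸ hy2)
        have := h1 (q - 1) y hy3
        rwa [show q - 1 + (p + 1) = q + p by ring] at this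
      have hx' : x = S.proj (q : ZMod 2) x + S.proj (1 + (q : ZMod 2)) x := by
        have hd : ∀ a : ZMod 2, a = 0 ∨ a = 1 := by decide
        rcases hd (q : ZMod 2) with h | h
        · rw [h]; simpa using (S.proj_add_proj x).symm
        · rw [h, show (1 + 1 : ZMod 2) = 0 by decide, add_comm]
          exact (S.proj_add_proj x).symm
      rw [hx', map_add]
      exact Submodule.add_mem _ (hA _ (S.proj_fil hx _) (S.proj_mem _ _))
        (hB _ (S.proj_fil hx _) (S.proj_mem _ _))
    · rintro f ⟨h1, h2⟩
      exact ⟨fun q x hx => S.mono (by omega) (h1 q x hx), h2⟩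

/-- A superfiltration over `K`, regarded as a superfiltration over a smaller ground ring. -/
def restrictScalars (K₀ : Type*) [CommRing K₀] [Algebra K₀ K] [Module K₀ X] [IsScalarTower K₀ K X] :
    Superfiltration K₀ X where
  par i := (S.par i).restrictScalars K₀
  fil p := (S.fil p).restrictScalars K₀
  isCompl := by
    constructor
    · rw [Submodule.disjoint_def]
      exact fun x h0 h1 => Submodule.disjoint_def.1 S.isCompl.disjoint x h0 h1
    · rw [codisjoint_iff, eq_top_iff]
      intro x _
      rw [← S.proj_add_proj x]
      exact Submodule.add_mem_sup (S.proj_mem 0 x) (S.proj_mem 1 x)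
  mono := fun p q h x hx => S.mono h hx
  split := by
    intro p
    apply le_antisymm
    · intro x hx
      rw [← S.proj_add_proj x]
      exact Submodule.add_mem_sup ⟨S.proj_fil hx 0, S.proj_mem 0 x⟩
        ⟨S.proj_fil hx 1, S.proj_mem 1 x⟩
    · exact sup_le inf_le_left inf_le_left
  step := by
    intro p
    ext x
    exact SetLike.ext_iff.1 (S.step p) x

end General

section GradingEndo

variable {K X : Type*} [CommRing K] [AddCommGroup X] [Module K X]
variable (𝒜 : ℕ → Submodule K X) [DirectSum.Decomposition 𝒜]

theorem mem_endo_ofGrading (f : Module.End K X) (r : ℤ)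
    (hf : ∀ m, ∀ x ∈ 𝒜 m, f x = 0 ∨ ∃ l : ℕ, (l : ℤ) = m + r ∧ f x ∈ 𝒜 l) :
    f ∈ (ofGrading 𝒜).endo.par (r : ZMod 2) ∧ f ∈ (ofGrading 𝒜).endo.fil r := by
  constructor
  · intro j x hx
    refine map_supported 𝒜 f (fun m hm y hy => ?_) hx
    rcases hf m y hy with h | ⟨l, hl, h⟩
    · rw [h]; exact Submodule.zero_mem _
    · refine mem_supported_of_mem 𝒜 ?_ h
      have : ((l : ℤ) : ZMod 2) = ((m + r : ℤ) : ZMod 2) := by rw [hl]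
      push_cast at this
      simp only [Set.mem_ofPred_eq] at hm ⊢
      rw [this, hm, add_comm]
  · intro q x hx
    refine map_supported 𝒜 f (fun m hm y hy => ?_) hx
    rcases hf m y hy with h | ⟨l, hl, h⟩
    · rw [h]; exact Submodule.zero_mem _
    · refine mem_supported_of_mem 𝒜 ?_ h
      simp only [Set.mem_ofPred_eq] at hm ⊢
      omega

end GradingEndo

end Superfiltration

/-! ### Superfiltered `A∞`-algebras -/

section AInf

/-- A sequence of `K`-multilinear operations `A^k → B`. The operation with inputs written
`(a_k, …, a_1)` from left to right takes as its argument the tuple whose entry number `i` (counted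
from `0`) is `a_{i+1}`. -/
abbrev Ops (K A B : Type*) [CommRing K] [AddCommGroup A] [Module K A] [AddCommGroup B]
    [Module K B] :=
  (k : ℕ) → MultilinearMap K (fun _ : Fin k => A) B

variable {K A B : Type*} [CommRing K] [AddCommGroup A] [Module K A] [AddCommGroup B] [Module K B]

/-- The value of the `k`-th operation on the first `k` terms of a sequence: `Φ^k(a_k, …, a_1)`,
where `a i` stands for `a_{i+1}`. -/
def Ops.app (Φ : Ops K A B) (k : ℕ) (a : ℕ → A) : B := Φ k (fun q : Fin k => a q)

/-- The sequence obtained from `a` by replacing the `j` consecutive terms `a i, …, a (i + j - 1)` by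
the single term `x`. -/
def replaceBlock (i j : ℕ) (a : ℕ → A) (x : A) : ℕ → A :=
  fun p => if p < i then a p else if p = i then x else a (p - 1 + j)

/-- The common left-hand side of the `A∞`-relations and of the `A∞`-homomorphism relations,
`∑_{i,j} (-1)^{✠_i} Φ^{k-j+1}(a_k, …, a_{i+j+1}, μ^j(a_{i+j}, …, a_{i+1}), a_i, …, a_1)`
with `✠_i = |a_1| + ⋯ + |a_i| - i`, for homogeneous inputs of degrees `d`. -/
def insertionSum (μ : Ops K A A) (Φ : Ops K A B) (k : ℕ) (d : ℕ → ZMod 2) (a : ℕ → A) : B :=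
  ∑ j ∈ Finset.range (k + 1), ∑ i ∈ Finset.range (k - j + 1),
    ((-1 : ℤˣ) ^ (∑ l ∈ Finset.range i, (d l - 1))) •
      Φ.app (k - j + 1) (replaceBlock i j a (μ.app j (fun q => a (i + q))))

/-- Each `Φ^k : A[1]^{⊗k} → B[1]` is superfiltered of degree `r`: it has degree `r` modulo `2`, and
it raises the filtration by at most `r`. Here `A[1]` in degree or level `p` is `A` in degree or level
`p + 1`. -/
structure IsSuperfilteredOps (S : Superfiltration K A) (S' : Superfiltration K B) (r : ℤ)
    (Φ : Ops K A B) : Prop where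
  par : ∀ (k : ℕ), 1 ≤ k → ∀ (d : ℕ → ZMod 2) (a : ℕ → A), (∀ i, a i ∈ S.par (d i)) →
    Φ.app k a ∈ S'.par ((∑ i ∈ Finset.range k, (d i - 1)) + r + 1)
  fil : ∀ (k : ℕ), 1 ≤ k → ∀ (p : ℕ → ℤ) (a : ℕ → A), (∀ i, a i ∈ S.fil (p i)) →
    Φ.app k a ∈ S'.fil ((∑ i ∈ Finset.range k, (p i - 1)) + r + 1)

/-- The operations `μ` make the superfiltered module `A` into a superfiltered `A∞`-algebra, without
curvature and strictly unital with unit `e`. -/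
structure IsSuperfilteredAInf (S : Superfiltration K A) (e : A) (μ : Ops K A A) : Prop where
  curvature : μ 0 = 0
  superfiltered : IsSuperfilteredOps S S 1 μ
  relation : ∀ (k : ℕ) (d : ℕ → ZMod 2) (a : ℕ → A), (∀ i, a i ∈ S.par (d i)) →
    insertionSum μ μ k d a = 0
  unit_par : e ∈ S.par 0
  unit_fil : e ∈ S.fil 0
  unit_one : μ 1 ![e] = 0
  unit_left : ∀ (i : ZMod 2) (a : A), a ∈ S.par i → μ 2 ![a, e] = ((-1 : ℤˣ) ^ i) • a
  unit_right : ∀ a : A, μ 2 ![e, a] = a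
  unit_higher : ∀ (k : ℕ), 3 ≤ k → ∀ a : Fin k → A, (∃ i, a i = e) → μ k a = 0

/-- The sequence `Φ = (Φ^k)_{k ≥ 1}` is a strictly unital homomorphism of `A∞`-algebras which is
superfiltered of degree `0`. The entry `Φ 0` plays no role. The sum over the compositions
`s_1 + ⋯ + s_r = k` is the right-hand side
`∑ μ_B^r(Φ^{s_r}(a_k, …), …, Φ^{s_1}(a_{s_1}, …, a_1))`. -/
structure IsSuperfilteredAInfHom (S : Superfiltration K A) (S' : Superfiltration K B) (e : A)
    (e' : B) (μ : Ops K A A) (μ' : Ops K B B) (Φ : Ops K A B) : Prop where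
  superfiltered : IsSuperfilteredOps S S' 0 Φ
  relation : ∀ (k : ℕ) (d : ℕ → ZMod 2) (a : ℕ → A), (∀ i, a i ∈ S.par (d i)) →
    insertionSum μ Φ k d a =
      ∑ c : Composition k, μ' c.length (fun r => Φ.app (c.blocksFun r)
        (fun q => a (c.sizeUpTo r + q)))
  unit_one : Φ 1 ![e] = e'
  unit_higher : ∀ (k : ℕ), 2 ≤ k → ∀ a : Fin k → A, (∃ i, a i = e) → Φ k a = 0

end AInf

/-! ### Filtered matrix factorisations and their endomorphism algebras -/

/-- A filtered matrix factorisation of `w` over `R` with underlying module `X`. -/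
structure FilteredMF (R : Type*) [CommRing R] (w : R) (X : Type*) [AddCommGroup X] [Module R X] where
  free : Module.Free R X
  finite : Module.Finite R X
  /-- the superfiltered structure on `X` -/
  S : Superfiltration R X
  /-- the endomorphism whose square is `w` -/
  d : Module.End R X
  d_par : d ∈ S.endo.par 1
  d_fil : d ∈ S.endo.fil 1
  d_sq : d * d = w • (1 : Module.End R X)

namespace FilteredMF

variable {R : Type*} [CommRing R] {w : R} {X : Type*} [AddCommGroup X] [Module R X]
  (M : FilteredMF R w X)

/-- The differential `f ↦ d ∘ f - (-1)^|f| f ∘ d` of the endomorphism dg-algebra of `M`. -/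
def differential : Module.End R X →ₗ[R] Module.End R X :=
  LinearMap.mulLeft R M.d - (LinearMap.mulRight R M.d) ∘ₗ M.S.endo.sgn

variable (K : Type*) [CommRing K] [Algebra K R] [Module K X] [IsScalarTower K R X]

/-- The superfiltration of the endomorphism algebra of `M`, over the ground ring `K`. -/
def endSuperfiltration : Superfiltration K (Module.End R X) := M.S.endo.restrictScalars K

/-- The endomorphism dg-algebra of `M`, regarded as an `A∞`-algebra over `K`:
`μ^1(a) = (-1)^|a| d a` and `μ^2(a_2, a_1) = (-1)^|a_1| a_2 a_1`, all other operations being zero. -/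
def endOps : Ops K (Module.End R X) (Module.End R X)
  | 1 =>
    { toFun := fun a => M.differential (M.S.endo.sgn (a 0))
      map_update_add' := by
        intro _ m i x y
        obtain rfl : i = 0 := Subsingleton.elim _ _
        simp
      map_update_smul' := by
        intro _ m i c x
        obtain rfl : i = 0 := Subsingleton.elim _ _
        simp only [Function.update_self]
        rw [LinearMap.map_smul_of_tower, LinearMap.map_smul_of_tower] }
  | 2 =>
    { toFun := fun a => a 1 * M.S.endo.sgn (a 0)
      map_update_add' := by
        intro _ m i x y
        fin_cases i <;> simp [mul_add, add_mul]
      map_update_smul' := by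
        intro _ m i c x
        fin_cases i
        · simp [LinearMap.map_smul_of_tower]
        · simp }
  | _ => 0

end FilteredMF

/-! ### The exterior algebra -/

section Exterior

variable (K : Type u) [CommRing K] (V : Type v) [AddCommGroup V] [Module K V]

/-- The standard superfiltration of the exterior algebra: `F^p = Λ^{≤ p} V`. -/
def extSuper : Superfiltration K (ExteriorAlgebra K V) :=
  Superfiltration.ofGrading (fun n : ℕ => ⋀[K]^n V)

/-- The standard superfiltration of `R ⊗ ΛV`. -/
def extSuperBase (R : Type*) [CommRing R] [Algebra K R] :
    Superfiltration R (R ⊗[K] ExteriorAlgebra K V) :=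
  Superfiltration.ofGrading (fun n : ℕ => (⋀[K]^n V).baseChange R)

variable {K V}

/-- The `R`-linear endomorphism `a ∧ •` of `R ⊗ ΛV`. -/
def wedge (R : Type*) [CommRing R] [Algebra K R] (a : ExteriorAlgebra K V) :
    Module.End R (R ⊗[K] ExteriorAlgebra K V) :=
  (LinearMap.mulLeft K a).baseChange R

/-- The `R`-linear endomorphism of `R ⊗ ΛV` given by contraction with `φ ∈ V^∨`. -/
def contract (R : Type*) [CommRing R] [Algebra K R] (φ : Module.Dual K V) :
    Module.End R (R ⊗[K] ExteriorAlgebra K V) :=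
  LinearMap.baseChange R
    (CliffordAlgebra.contractLeft (Q := (0 : QuadraticForm K V)) φ :
      ExteriorAlgebra K V →ₗ[K] ExteriorAlgebra K V)

theorem contractLeft_mem (φ : Module.Dual K V) {m : ℕ} {x : ExteriorAlgebra K V}
    (hx : x ∈ ⋀[K]^m V) :
    (m = 0 → CliffordAlgebra.contractLeft (Q := (0 : QuadraticForm K V)) φ x = 0) ∧
    ∀ l, m = l + 1 →
      CliffordAlgebra.contractLeft (Q := (0 : QuadraticForm K V)) φ x ∈ ⋀[K]^l V := by
  induction hx using Submodule.pow_induction_on_left' with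
  | algebraMap r =>
    refine ⟨fun _ => CliffordAlgebra.contractLeft_algebraMap _ _ r, fun l h => by omega⟩
  | add x y i hx hy ihx ihy =>
    refine ⟨fun h => ?_, fun l h => ?_⟩
    · rw [map_add, ihx.1 h, ihy.1 h, add_zero]
    · rw [map_add]; exact Submodule.add_mem _ (ihx.2 l h) (ihy.2 l h)
  | mem_mul m hm i x hx ih =>
    refine ⟨fun h => by omega, fun l h => ?_⟩
    obtain rfl : i = l := by omega
    obtain ⟨v, rfl⟩ := hm
    erw [CliffordAlgebra.contractLeft_ι_mul]
    refine Submodule.sub_mem _ (Submodule.smul_mem _ _ hx) ?_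
    cases i with
    | zero => 
      erw [ih.1 rfl, mul_zero]
      exact Submodule.zero_mem _
    | succ i =>
      have := Submodule.mul_mem_mul (show ExteriorAlgebra.ι K v ∈
        LinearMap.range (ExteriorAlgebra.ι K (M := V)) from ⟨v, rfl⟩) (ih.2 i rfl)
      rw [← pow_succ'] at this
      exact this

end Exterior

/-! ### The stabilisation of the ground ring and the minimal model -/

section Stabilisation

variable {K : Type u} [CommRing K] {V : Type v} [AddCommGroup V] [Module K V] {n : ℕ}

/-- The ring `R = K⟦V⟧` of formal functions, in the coordinates `x_1, …, x_n` on `V` dual to a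
basis. -/
abbrev FormalFunctions (K : Type u) [CommRing K] (n : ℕ) : Type u := MvPowerSeries (Fin n) K

/-- The ideal of formal functions which vanish at the origin. -/
def maxIdeal (K : Type u) [CommRing K] (n : ℕ) : Ideal (FormalFunctions K n) :=
  RingHom.ker (MvPowerSeries.constantCoeff (σ := Fin n) (R := K))

/-- `E_R = R ⊗ ΛV`. -/
abbrev ExtR (K : Type u) [CommRing K] (V : Type v) [AddCommGroup V] [Module K V] (n : ℕ) :
    Type (max u v) :=
  FormalFunctions K n ⊗[K] ExteriorAlgebra K V

/-- The operator `a ↦ -(𝐱 ∧ a + 𝐲 ⌟ a)` on `R ⊗ ΛV`, where `𝐱 = ∑ x_i v_i` and `𝐲 = ∑ y_i v_i^∨`. -/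
def koszulOp {R : Type*} [CommRing R] [Algebra K R] (b : Module.Basis (Fin n) K V)
    (x y : Fin n → R) : Module.End R (R ⊗[K] ExteriorAlgebra K V) :=
  -(∑ i, (x i • wedge R (ExteriorAlgebra.ι K (b i)) + y i • contract R (b.coord i)))

section Proofs

variable {R : Type*} [CommRing R] [Algebra K R]

theorem baseChange_apply_mem {p q : Submodule K (ExteriorAlgebra K V)}
    (f : ExteriorAlgebra K V →ₗ[K] ExteriorAlgebra K V) (hf : ∀ x ∈ p, f x ∈ q)
    {x : R ⊗[K] ExteriorAlgebra K V} (hx : x ∈ p.baseChange R) :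
    f.baseChange R x ∈ q.baseChange R := by
  rw [Submodule.baseChange_eq_span] at hx
  induction hx using Submodule.span_induction with
  | mem y hy =>
    obtain ⟨z, hz, rfl⟩ := hy
    exact Submodule.tmul_mem_baseChange_of_mem _ (hf z hz)
  | zero => simp
  | add y z _ _ hy hz => rw [map_add]; exact Submodule.add_mem _ hy hz
  | smul c y _ hy => rw [map_smul]; exact Submodule.smul_mem _ c hy

theorem wedge_ι_mem (x : V) : wedge R (ExteriorAlgebra.ι K x) ∈ (extSuperBase K V R).endo.par 1 ∧
    wedge R (ExteriorAlgebra.ι K x) ∈ (extSuperBase K V R).endo.fil 1 := by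
  have := Superfiltration.mem_endo_ofGrading (fun n : ℕ => (⋀[K]^n V).baseChange R)
    (wedge R (ExteriorAlgebra.ι K x)) 1 (fun m y hy => Or.inr ⟨m + 1, by push_cast; rfl, ?_⟩)
  · have h1 : ((1 : ℤ) : ZMod 2) = 1 := by decide
    exact ⟨h1 ▸ this.1, this.2⟩
  · refine baseChange_apply_mem _ (fun z hz => ?_) hy
    have := Submodule.mul_mem_mul (show ExteriorAlgebra.ι K x ∈
        LinearMap.range (ExteriorAlgebra.ι K (M := V)) from ⟨x, rfl⟩) hz
    rw [← pow_succ'] at this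
    exact this

theorem contract_mem (φ : Module.Dual K V) :
    contract R φ ∈ (extSuperBase K V R).endo.par 1 ∧
    contract R φ ∈ (extSuperBase K V R).endo.fil 1 := by
  have := Superfiltration.mem_endo_ofGrading (fun n : ℕ => (⋀[K]^n V).baseChange R)
    (contract R φ) (-1) (fun m y hy => ?_)
  · refine ⟨?_, (extSuperBase K V R).endo.mono (by norm_num) this.2⟩
    have h1 : ((-1 : ℤ) : ZMod 2) = 1 := by decide
    exact h1 ▸ this.1
  · cases m with
    | zero =>
      left
      have h : contract R φ y ∈ (⊥ : Submodule K (ExteriorAlgebra K V)).baseChange R :=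
        baseChange_apply_mem _ (fun z hz => (contractLeft_mem φ hz).1 rfl) hy
      simpa using h
    | succ m =>
      exact Or.inr ⟨m, by push_cast; ring,
        baseChange_apply_mem _ (fun z hz => (contractLeft_mem φ hz).2 m rfl) hy⟩

theorem wedge_wedge_self (x : V) :
    wedge R (ExteriorAlgebra.ι K x) * wedge R (ExteriorAlgebra.ι K x) = 0 := by
  ext a
  simp [wedge, ← mul_assoc]

theorem wedge_wedge_add (x y : V) :
    wedge R (ExteriorAlgebra.ι K x) * wedge R (ExteriorAlgebra.ι K y) +
    wedge R (ExteriorAlgebra.ι K y) * wedge R (ExteriorAlgebra.ι K x) = 0 := by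
  have h := wedge_wedge_self (K := K) (R := R) (x + y)
  have hadd : wedge R (ExteriorAlgebra.ι K (x + y)) =
      wedge R (ExteriorAlgebra.ι K x) + wedge R (ExteriorAlgebra.ι K y) := by
    apply TensorProduct.AlgebraTensorModule.ext
    intro r a
    simp [wedge, add_mul, TensorProduct.tmul_add]
  rw [hadd, add_mul, mul_add, mul_add, wedge_wedge_self, wedge_wedge_self] at h
  simpa using h

theorem contract_contract_self (φ : Module.Dual K V) : contract R φ * contract R φ = 0 := by
  ext a
  simp [contract, CliffordAlgebra.contractLeft_contractLeft]

theorem contract_contract_add (φ ψ : Module.Dual K V) :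
    contract R φ * contract R ψ + contract R ψ * contract R φ = 0 := by
  ext a
  simp [contract, CliffordAlgebra.contractLeft_comm ψ φ, TensorProduct.tmul_neg]

theorem wedge_contract_add (x : V) (φ : Module.Dual K V) :
    wedge R (ExteriorAlgebra.ι K x) * contract R φ +
    contract R φ * wedge R (ExteriorAlgebra.ι K x) = algebraMap K R (φ x) • 1 := by
  have h : ∀ a : ExteriorAlgebra K V, ExteriorAlgebra.ι K x *
      CliffordAlgebra.contractLeft (Q := (0 : QuadraticForm K V)) φ a +
      CliffordAlgebra.contractLeft (Q := (0 : QuadraticForm K V)) φ (ExteriorAlgebra.ι K x * a) =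
      φ x • a := by
    intro a
    erw [CliffordAlgebra.contractLeft_ι_mul]
    exact add_sub_cancel _ _
  apply TensorProduct.AlgebraTensorModule.ext
  intro r a
  simp only [wedge, contract, LinearMap.add_apply, Module.End.mul_apply, LinearMap.baseChange_tmul,
    LinearMap.mulLeft_apply, LinearMap.smul_apply, Module.End.one_apply]
  rw [← TensorProduct.tmul_add, h, algebraMap_smul, TensorProduct.tmul_smul]

theorem sum_sum_anticomm {B : Type*} [Ring B] [Algebra R B] (c : Fin n → R) (A : Fin n → B)
    (h0 : ∀ i, A i * A i = 0) (h1 : ∀ i j, A i * A j + A j * A i = 0) :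
    (∑ i, c i • A i) * (∑ i, c i • A i) = 0 := by
  rw [Finset.sum_mul_sum, ← Finset.sum_product']
  refine Finset.sum_involution (fun p _ => (p.2, p.1)) ?_ ?_ ?_ ?_
  · rintro ⟨i, j⟩ _
    simp only [smul_mul_smul_comm]
    rw [mul_comm (c j) (c i), ← smul_add, h1, smul_zero]
  · rintro ⟨i, j⟩ _ h he
    apply h
    obtain rfl : j = i := congrArg Prod.fst he
    simp [h0]
  · intros; simp
  · intros; rfl

theorem sum_sum_comm {B : Type*} [Ring B] [Algebra R B] (c e : Fin n → R) (A C : Fin n → B)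
    (h : ∀ i j, A i * C j + C j * A i = if i = j then 1 else 0) :
    (∑ i, c i • A i) * (∑ i, e i • C i) + (∑ i, e i • C i) * (∑ i, c i • A i) =
      (∑ i, c i * e i) • (1 : B) := by
  have h1 : (∑ i, e i • C i) * (∑ i, c i • A i) = ∑ i, ∑ j, (e j • C j) * (c i • A i) := by
    rw [Finset.sum_mul_sum, Finset.sum_comm]
  rw [h1, Finset.sum_mul_sum, ← Finset.sum_add_distrib, Finset.sum_smul]
  refine Finset.sum_congr rfl fun i _ => ?_
  rw [← Finset.sum_add_distrib]
  have h2 : ∀ j, (c i • A i) * (e j • C j) + (e j • C j) * (c i • A i) =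
      if i = j then (c i * e j) • (1 : B) else 0 := by
    intro j
    rw [smul_mul_smul_comm, smul_mul_smul_comm, mul_comm (e j), ← smul_add, h]
    split_ifs <;> simp
  simp_rw [h2]
  simp

theorem neg_sum_sq {B : Type*} [Ring B] [Algebra R B] (c e : Fin n → R) (A C : Fin n → B)
    (hA : ∀ i, A i * A i = 0) (hA' : ∀ i j, A i * A j + A j * A i = 0)
    (hC : ∀ i, C i * C i = 0) (hC' : ∀ i j, C i * C j + C j * C i = 0)
    (h : ∀ i j, A i * C j + C j * A i = if i = j then 1 else 0) :
    (-∑ i, (c i • A i + e i • C i)) * (-∑ i, (c i • A i + e i • C i)) =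
      (∑ i, c i * e i) • (1 : B) := by
  rw [neg_mul_neg, Finset.sum_add_distrib, add_mul, mul_add, mul_add,
    sum_sum_anticomm c A hA hA', sum_sum_anticomm e C hC hC', ← sum_sum_comm c e A C h]
  abel

theorem koszulOp_sq (b : Module.Basis (Fin n) K V) (x y : Fin n → R) :
    koszulOp b x y * koszulOp b x y = (∑ i, x i * y i) • 1 := by
  refine neg_sum_sq x y _ _
    (fun i => wedge_wedge_self _) (fun i j => wedge_wedge_add _ _)
    (fun i => contract_contract_self _) (fun i j => contract_contract_add _ _) ?_
  intro i j
  rw [wedge_contract_add, Module.Basis.coord_apply, Module.Basis.repr_self, Finsupp.single_apply]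
  by_cases h : i = j
  · simp [h]
  · simp [h]

theorem koszulOp_mem (b : Module.Basis (Fin n) K V) (x y : Fin n → R)
    (P : Submodule R (Module.End R (R ⊗[K] ExteriorAlgebra K V)))
    (h1 : ∀ x : V, wedge R (ExteriorAlgebra.ι K x) ∈ P)
    (h2 : ∀ φ : Module.Dual K V, contract R φ ∈ P) : koszulOp b x y ∈ P := by
  unfold koszulOp
  exact P.neg_mem (P.sum_mem fun i _ => P.add_mem (P.smul_mem _ (h1 _)) (P.smul_mem _ (h2 _)))

end Proofs

/-- The stabilisation `𝓔₀` of `K = R/𝔪`: the filtered matrix factorisation of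
`w = ŵ ⌟ 𝐯 = ∑ x_i ŵ_i` with underlying module `R ⊗ ΛV` and `d a = -(𝐯 ∧ a + ŵ ⌟ a)`. -/
def stab (b : Module.Basis (Fin n) K V) (ŵ : Fin n → FormalFunctions K n)
    {w : FormalFunctions K n} (hw : ∑ i, MvPowerSeries.X i * ŵ i = w) :
    FilteredMF (FormalFunctions K n) w (ExtR K V n) where
  free := 
    haveI : Module.Free K (ExteriorAlgebra K V) := Module.Free.of_basis b.ExteriorAlgebra
    inferInstance
  finite :=
    haveI : Module.Finite K (ExteriorAlgebra K V) := Module.Finite.of_basis b.ExteriorAlgebra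
    inferInstance
  S := extSuperBase K V (FormalFunctions K n)
  d := koszulOp b MvPowerSeries.X ŵ
  d_par := koszulOp_mem b _ ŵ _ (fun x => (wedge_ι_mem x).1) (fun φ => (contract_mem φ).1)
  d_fil := koszulOp_mem b _ ŵ _ (fun x => (wedge_ι_mem x).2) (fun φ => (contract_mem φ).2)
  d_sq := by rw [koszulOp_sq, hw]

/-- The underlying algebra `End_R(R ⊗ ΛV)` of the endomorphism dg-algebra `𝓑₀` of `𝓔₀`. -/
abbrev EndAlg (K : Type u) [CommRing K] (V : Type v) [AddCommGroup V] [Module K V] (n : ℕ) :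
    Type (max u v) :=
  Module.End (FormalFunctions K n) (ExtR K V n)

/-- The superfiltration of `𝓑₀ = end(𝓔₀)`, as a `K`-module. -/
def endS (b : Module.Basis (Fin n) K V) (ŵ : Fin n → FormalFunctions K n)
    {w : FormalFunctions K n} (hw : ∑ i, MvPowerSeries.X i * ŵ i = w) :
    Superfiltration K (EndAlg K V n) :=
  (stab b ŵ hw).endSuperfiltration K

/-- The operations `μ^1`, `μ^2` of `𝓑₀ = end(𝓔₀)`, as an `A∞`-algebra over `K`. -/
def endμ (b : Module.Basis (Fin n) K V) (ŵ : Fin n → FormalFunctions K n)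
    {w : FormalFunctions K n} (hw : ∑ i, MvPowerSeries.X i * ŵ i = w) :
    Ops K (EndAlg K V n) (EndAlg K V n) :=
  (stab b ŵ hw).endOps K

/-- The map `π : 𝓑₀ → ΛV` sending `f` to the reduction of `f(1)` modulo `𝔪`. -/
def reduction (K : Type u) [CommRing K] (V : Type v) [AddCommGroup V] [Module K V] (n : ℕ) :
    EndAlg K V n →ₗ[K] ExteriorAlgebra K V where
  toFun f := TensorProduct.lid K (ExteriorAlgebra K V)
    ((MvPowerSeries.coeff (R := K) (0 : Fin n →₀ ℕ)).rTensor (ExteriorAlgebra K V) (f (1 ⊗ₜ[K] 1)))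
  map_add' f g := by simp
  map_smul' c f := by simp

/-- The data for transferring the `A∞`-structure from `𝓑₀ = end(𝓔₀)` to `E = ΛV`: a chain map
`ι : (E, 0) → 𝓑₀`, superfiltered of degree `0`, whose leading term is the canonical
`a ↦ (a ∧ •)` and which is a section of `π`, and a homotopy `η`, superfiltered of degree `-1`,
with `μ¹ ∘ η + η ∘ μ¹ = ι ∘ π - id` and satisfying the side conditions. -/
structure TransferData (b : Module.Basis (Fin n) K V) (ŵ : Fin n → FormalFunctions K n)
    {w : FormalFunctions K n} (hw : ∑ i, MvPowerSeries.X i * ŵ i = w) where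
  /-- the map `ι` -/
  incl : ExteriorAlgebra K V →ₗ[K] EndAlg K V n
  /-- the homotopy `η` -/
  htpy : EndAlg K V n →ₗ[K] EndAlg K V n
  incl_cocycle : ∀ a, (stab b ŵ hw).differential (incl a) = 0
  incl_one : incl 1 = 1
  incl_par : ∀ i, ∀ a ∈ (extSuper K V).par i, incl a ∈ (endS b ŵ hw).par i
  incl_fil : ∀ p, ∀ a ∈ (extSuper K V).fil p, incl a ∈ (endS b ŵ hw).fil p
  incl_lead : ∀ p : ℕ, ∀ a ∈ ⋀[K]^p V, incl a - wedge (FormalFunctions K n) a ∈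
    (endS b ŵ hw).fil ((p : ℤ) - 1)
  reduction_incl : ∀ a, reduction K V n (incl a) = a
  htpy_par : ∀ i, ∀ f ∈ (endS b ŵ hw).par i,
    htpy f ∈ (endS b ŵ hw).par (i - 1)
  htpy_fil : ∀ p, ∀ f ∈ (endS b ŵ hw).fil p,
    htpy f ∈ (endS b ŵ hw).fil (p - 1)
  homotopy : ∀ f, endμ b ŵ hw 1 ![htpy f] + htpy (endμ b ŵ hw 1 ![f]) =
    incl (reduction K V n f) - f
  htpy_incl : ∀ a, htpy (incl a) = 0
  reduction_htpy : ∀ f, reduction K V n (htpy f) = 0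
  htpy_htpy : ∀ f, htpy (htpy f) = 0

/-- The corrected cocycle `f_i : a ↦ v_i ∧ a + ∑_j λ_{ij} v_j^∨ ⌟ a`. -/
def correctedCocycle (b : Module.Basis (Fin n) K V) (c : Fin n → Fin n → FormalFunctions K n)
    (i : Fin n) : EndAlg K V n :=
  wedge (FormalFunctions K n) (ExteriorAlgebra.ι K (b i)) +
    ∑ j, c i j • contract (FormalFunctions K n) (b.coord j)

/-- The `m`-ary operations `η ∘ 𝐩_m` of homotopy transfer for a differential graded algebra with
product operation `μ²` and homotopy `η`, with `η ∘ 𝐩_1` interpreted as the identity. In the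
sequence `a`, the term `a i` stands for `a_{i+1}`. -/
def htpyKernel {B : Type*} [AddCommGroup B] (mul : B → B → B) (η : B → B) :
    ℕ → (ℕ → B) → B
  | 0, _ => 0
  | 1, a => a 0
  | m + 2, a => η (∑ j : Fin (m + 1),
      mul (htpyKernel mul η (m + 1 - j) (fun i => a (i + (j + 1))))
        (htpyKernel mul η (j + 1) a))

/-- The kernels `𝐩_k(a_k, …, a_1) = ∑_{j=1}^{k-1} μ²(η 𝐩_{k-j}(a_k, …, a_{j+1}), η 𝐩_j(a_j, …, a_1))`
of homotopy transfer. -/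
def kernel {B : Type*} [AddCommGroup B] (mul : B → B → B) (η : B → B) (k : ℕ) (a : ℕ → B) : B :=
  ∑ j ∈ Finset.Ico 1 k,
    mul (htpyKernel mul η (k - j) (fun i => a (i + j))) (htpyKernel mul η j a)

namespace TransferData

variable {b : Module.Basis (Fin n) K V} {ŵ : Fin n → FormalFunctions K n}
    {w : FormalFunctions K n} {hw : ∑ i, MvPowerSeries.X i * ŵ i = w} (T : TransferData b ŵ hw)

/-- The operation `μ²(a_2, a_1)` of `𝓑₀`. -/
def mul (_ : TransferData b ŵ hw) (x y : EndAlg K V n) : EndAlg K V n :=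
  endμ b ŵ hw 2 ![y, x]

/-- The operations `μ_min^k = π ∘ 𝐩_k ∘ ι^{⊗k}` of the minimal model, for `k ≥ 2`. -/
def minOp (k : ℕ) (a : ℕ → ExteriorAlgebra K V) : ExteriorAlgebra K V :=
  reduction K V n (kernel T.mul T.htpy k (fun i => T.incl (a i)))

/-- The maps `I^1 = ι` and `I^k = η ∘ 𝐩_k ∘ ι^{⊗k}` for `k ≥ 2`. -/
def inclOp (k : ℕ) (a : ℕ → ExteriorAlgebra K V) : EndAlg K V n :=
  htpyKernel T.mul T.htpy k (fun i => T.incl (a i))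

end TransferData

end Stabilisation

/-! ### Superfiltered `A∞`-deformations of the exterior algebra and their disc potentials -/

section Deformations

/-- A superfiltered `A∞`-deformation of `E = ΛV`: a strictly unital superfiltered `A∞`-algebra
structure `(μ^k)_{k ≥ 2}` on `E` whose leading term is the formal `A∞`-structure of `E`, with
`μ^2(a_2, a_1) = (-1)^|a_1| a_2 ∧ a_1`. -/
@[ext]
structure Deformation (K : Type u) [CommRing K] (V : Type v) [AddCommGroup V] [Module K V] where
  /-- the operations -/
  μ : Ops K (ExteriorAlgebra K V) (ExteriorAlgebra K V)
  isAInf : IsSuperfilteredAInf (extSuper K V) 1 μ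
  minimal : μ 1 = 0
  leading_two : ∀ p q : ℕ, ∀ a₁ ∈ ⋀[K]^p V, ∀ a₂ ∈ ⋀[K]^q V,
    μ 2 ![a₁, a₂] - ((-1 : ℤˣ) ^ p) • (a₂ * a₁) ∈ (extSuper K V).fil ((p : ℤ) + q - 1)
  leading_higher : ∀ k : ℕ, 3 ≤ k → ∀ (p : Fin k → ℕ) (a : Fin k → ExteriorAlgebra K V),
    (∀ i, a i ∈ ⋀[K]^(p i) V) →
    μ k a ∈ (extSuper K V).fil ((∑ i, ((p i : ℤ) - 1)) + 2 - 1)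

variable {K : Type u} [CommRing K] {V : Type v} [AddCommGroup V] [Module K V] {n : ℕ}

namespace Deformation

/-- `μ^k(𝐯, …, 𝐯)`, as a formal power series with coefficients in `E`, for `𝐯 = ∑ x_i v_i`. -/
def diagonalTerm (A : Deformation K V) (b : Module.Basis (Fin n) K V) (k : ℕ) :
    MvPowerSeries (Fin n) (ExteriorAlgebra K V) :=
  ∑ s : Fin k → Fin n, MvPowerSeries.monomial (∑ j, Finsupp.single (s j) 1)
    (A.μ k (fun j => ExteriorAlgebra.ι K (b (s j))))

/-- `∑_{k ≥ 2} μ^k(𝐯, …, 𝐯)`, as a formal power series with coefficients in `E`. The `k`-th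
term is homogeneous of degree `k`, so only finitely many terms contribute to each coefficient. -/
def potentialE (A : Deformation K V) (b : Module.Basis (Fin n) K V) :
    MvPowerSeries (Fin n) (ExteriorAlgebra K V) :=
  fun m => ∑ k ∈ Finset.Icc 2 m.degree, MvPowerSeries.coeff m (A.diagonalTerm b k)

/-- The disc potential: `∑_{k ≥ 2} μ^k(𝐯, …, 𝐯)` read as an element of `R = K⟦V⟧`, through the
projection of `E` to its degree zero part `K`. -/
def discPotential (A : Deformation K V) (b : Module.Basis (Fin n) K V) : FormalFunctions K n :=
  MvPowerSeries.map (ExteriorAlgebra.algebraMapInv (R := K) (M := V)).toRingHom (A.potentialE b)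

/-- `d`-equivalence of superfiltered `A∞`-deformations. -/
def Equivalent (d : ℕ∞) (A₁ A₂ : Deformation K V) : Prop :=
  ∃ Φ : Ops K (ExteriorAlgebra K V) (ExteriorAlgebra K V),
    IsSuperfilteredAInfHom (extSuper K V) (extSuper K V) 1 1 A₁.μ A₂.μ Φ ∧
    Function.Bijective (fun a => Φ 1 ![a]) ∧
    (1 ≤ d → ∀ p : ℕ, ∀ a ∈ ⋀[K]^p V, Φ 1 ![a] - a ∈ (extSuper K V).fil ((p : ℤ) - 1)) ∧
    (∀ k : ℕ, 2 ≤ k → (k : ℕ∞) ≤ d → ∀ (p : Fin k → ℕ) (a : Fin k → ExteriorAlgebra K V),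
      (∀ i, a i ∈ ⋀[K]^(p i) V) →
      Φ k a ∈ (extSuper K V).fil ((∑ i, ((p i : ℤ) - 1)) + 1 - 1))

end Deformation

/-- `d`-equivalence of formal functions: `P₁ = P₂ ∘ f` for an invertible formal change of variables
`f : V → V` fixing the origin with `f = id` modulo `𝔪^{d+1}`. -/
def PotentialEquivalent (d : ℕ∞) (P₁ P₂ : FormalFunctions K n) : Prop :=
  ∃ f g : Fin n → FormalFunctions K n,
    (∀ i, f i ∈ maxIdeal K n) ∧ (∀ i, g i ∈ maxIdeal K n) ∧
    (∀ i, MvPowerSeries.subst g (f i) = MvPowerSeries.X i) ∧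
    (∀ i, MvPowerSeries.subst f (g i) = MvPowerSeries.X i) ∧
    P₁ = MvPowerSeries.subst f P₂ ∧
    (∀ k : ℕ, (k : ℕ∞) ≤ d → ∀ i, f i - MvPowerSeries.X i ∈ maxIdeal K n ^ (k + 1))

end Deformations

end MFPot

end

/-!
The theorem has three ingredients: homotopy transfer, the construction of transfer data, and a
Maurer–Cartan argument which computes disc potentials.

*Homotopy transfer.* It is carried out for an abstract `Contraction` of a differential graded
algebra. The kernels `𝐩_k` are compositions of convolution products, and inserting the transferred
operations into a convolution product obeys a Leibniz rule (`insertion_convolution`). By induction on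
`k`, this rule, the homotopy identity and associativity give
`Contraction.insertion_relations`, whose images under `π` and `η` are the `A∞`-relations of the
minimal model and the homomorphism relations of `I`. The side conditions give strict unitality
(`Contraction.inclOp_unit`). The leading terms of the higher operations vanish since `η` kills the
operators `a ∧ •` to leading order (`Contraction.inclOp_lead`).

*Transfer data.* To leading order in the filtration, the differential of `End_R(R ⊗ ΛV)` is
`∑ x_i [v_i ∧ •, ·]`. Division of coefficients by `x_i`, combined with multiplication by
`v_i^∨ ⌟ •`, contracts the `i`-th summand onto the image of an idempotent
(`KoszulRelations`), and the composition of these idempotents is `f ↦ π(f) ∧ •`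
(`prod_koszulProjection_apply`). The remaining part of the differential lowers the filtration, so
that the contraction extends to the full differential by inverting `1 - N` for a nilpotent `N`, and
is then corrected to satisfy the side conditions (`exists_special_homotopy_of_perturbation`,
`exists_homotopy`). For `ι` one takes ordered products of the cocycles
`f_i = v_i ∧ • + ∑_j λ_{ij} v_j^∨ ⌟ •` (`koszulIncl`). If `λ` is triangular modulo `𝔪`, then
`π ∘ ι = id`; in general `π ∘ ι` is unipotent, and one composes `ι` with its inverse
(`exists_normalised_section`).

*Disc potentials.* For degree reasons, `μ^k(v_{s_k}, …, v_{s_1})` is a scalar up to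
`v_{s_2} ∧ v_{s_1}` for `k = 2`, and these products cancel in symmetrised sums. Hence the sum over
`s` of the left-hand sides of the homomorphism relations, weighted by monomials, is the degree `k`
component of the disc potential times the unit (`Deformation.sum_insertionSum`). For the homomorphism
`I : 𝓑₀^min → 𝓑₀`, the right-hand sides say that the square of `D = d + ∑_k I^k(𝐯, …, 𝐯)` is `w - 𝔓`.
The exterior products cancel in `D`, which therefore lowers the filtration and annihilates `1`; so
`𝔓 = w` (`Deformation.discPotential_eq_of_hom`). For a homomorphism `Φ` between deformations, the
right-hand sides are the components of `𝔓₂ ∘ f` with `f = ∑_k Φ^k(𝐯, …, 𝐯)`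
(`discPotential_eq_subst`). The linear part of `f` is invertible since a surjective endomorphism of
the finitely generated module `E / F¹E` is injective (`exists_ι_preimage`), and the formal inverse
function theorem (`exists_formal_inverse`) makes `f` a change of variables. All identities of
power series are checked modulo each power of `𝔪`.
-/

noncomputable section

namespace MFPot

/-! ### The order filtration of formal power series -/

section PowerSeries

variable {K : Type u} [CommRing K] {n : ℕ}

/-- The ideal of power series whose coefficients in degrees below `N` vanish. By
`ordIdeal_eq_pow` it is `𝔪 ^ N`. -/
def ordIdeal (K : Type u) [CommRing K] (n N : ℕ) : Ideal (FormalFunctions K n) where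
  carrier := {f | ∀ m : Fin n →₀ ℕ, m.degree < N → MvPowerSeries.coeff m f = 0}
  zero_mem' := by intro m _; simp
  add_mem' := by
    intro f g hf hg m hm
    rw [map_add, hf m hm, hg m hm, add_zero]
  smul_mem' := by
    classical
    intro c f hf m hm
    rw [smul_eq_mul, MvPowerSeries.coeff_mul]
    refine Finset.sum_eq_zero fun p hp => ?_
    have : p.1.degree + p.2.degree = m.degree := by
      rw [← map_add, Finset.HasAntidiagonal.mem_antidiagonal.1 hp]
    rw [hf p.2 (by omega), mul_zero]

theorem mem_ordIdeal {N : ℕ} {f : FormalFunctions K n} :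
    f ∈ ordIdeal K n N ↔ ∀ m : Fin n →₀ ℕ, m.degree < N → MvPowerSeries.coeff m f = 0 :=
  Iff.rfl

theorem ordIdeal_anti {M N : ℕ} (h : M ≤ N) : ordIdeal K n N ≤ ordIdeal K n M :=
  fun _ hf m hm => hf m (by omega)

theorem ordIdeal_one : ordIdeal K n 1 = maxIdeal K n := by
  ext f
  rw [mem_ordIdeal, maxIdeal, RingHom.mem_ker, ← MvPowerSeries.coeff_zero_eq_constantCoeff_apply]
  constructor
  · intro h
    exact h 0 (by simp)
  · intro h m hm
    have : m = 0 := by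
      rw [← Finsupp.degree_eq_zero_iff]; omega
    rwa [this]

theorem mul_mem_ordIdeal {M N : ℕ} {f g : FormalFunctions K n} (hf : f ∈ ordIdeal K n M)
    (hg : g ∈ ordIdeal K n N) : f * g ∈ ordIdeal K n (M + N) := by
  classical
  intro m hm
  rw [MvPowerSeries.coeff_mul]
  refine Finset.sum_eq_zero fun p hp => ?_
  have : p.1.degree + p.2.degree = m.degree := by
    rw [← map_add, Finset.HasAntidiagonal.mem_antidiagonal.1 hp]
  by_cases h : p.1.degree < M
  · rw [hf p.1 h, zero_mul]
  · rw [hg p.2 (by omega), mul_zero]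

theorem X_mem_ordIdeal (i : Fin n) :
    (MvPowerSeries.X i : FormalFunctions K n) ∈ ordIdeal K n 1 := by
  rw [ordIdeal_one, maxIdeal, RingHom.mem_ker, MvPowerSeries.constantCoeff_X]

theorem eq_zero_of_mem_ordIdeal {f : FormalFunctions K n} (h : ∀ N, f ∈ ordIdeal K n N) :
    f = 0 := by
  ext m
  exact h (m.degree + 1) m (by omega)

theorem monomial_mem_ordIdeal {N : ℕ} (m : Fin n →₀ ℕ) (hm : N ≤ m.degree) (c : K) :
    (MvPowerSeries.monomial m c : FormalFunctions K n) ∈ ordIdeal K n N := by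
  classical
  intro m' hm'
  rw [MvPowerSeries.coeff_monomial, if_neg]
  rintro rfl
  omega

/-- The divided difference `(f - f|_{x_i = 0}) / x_i`. -/
def divX (i : Fin n) : FormalFunctions K n →ₗ[K] FormalFunctions K n where
  toFun f := fun m => MvPowerSeries.coeff (m + Finsupp.single i 1) f
  map_add' f g := by
    ext m; exact map_add (MvPowerSeries.coeff (R := K) _) f g
  map_smul' c f := by
    ext m; exact map_smul (MvPowerSeries.coeff (R := K) _) c f

/-- The restriction `f|_{x_i = 0}`. -/
def restrictX (i : Fin n) : FormalFunctions K n →ₗ[K] FormalFunctions K n where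
  toFun f := fun m => if m i = 0 then MvPowerSeries.coeff m f else 0
  map_add' f g := by
    ext m
    change (if m i = 0 then MvPowerSeries.coeff m (f + g) else 0) =
      (if m i = 0 then MvPowerSeries.coeff m f else 0) +
      (if m i = 0 then MvPowerSeries.coeff m g else 0)
    split_ifs <;> simp
  map_smul' c f := by
    ext m
    change (if m i = 0 then MvPowerSeries.coeff m (c • f) else 0) =
      c • (if m i = 0 then MvPowerSeries.coeff m f else 0)
    split_ifs <;> simp

theorem coeff_divX (i : Fin n) (f : FormalFunctions K n) (m : Fin n →₀ ℕ) :
    MvPowerSeries.coeff m (divX i f) = MvPowerSeries.coeff (m + Finsupp.single i 1) f := rfl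

theorem coeff_restrictX (i : Fin n) (f : FormalFunctions K n) (m : Fin n →₀ ℕ) :
    MvPowerSeries.coeff m (restrictX i f) = if m i = 0 then MvPowerSeries.coeff m f else 0 := rfl

theorem coeff_X_mul_of_ne {i : Fin n} {m : Fin n →₀ ℕ} (h : m i ≠ 0) (f : FormalFunctions K n) :
    MvPowerSeries.coeff m (MvPowerSeries.X i * f) =
      MvPowerSeries.coeff (m - Finsupp.single i 1) f := by
  have hm : m = Finsupp.single i 1 + (m - Finsupp.single i 1) := by
    rw [add_tsub_cancel_of_le]
    simpa [Nat.one_le_iff_ne_zero] using h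
  conv_lhs => rw [hm]
  rw [MvPowerSeries.X, MvPowerSeries.coeff_add_monomial_mul, one_mul]

theorem coeff_X_mul_of_eq {i : Fin n} {m : Fin n →₀ ℕ} (h : m i = 0) (f : FormalFunctions K n) :
    MvPowerSeries.coeff m (MvPowerSeries.X i * f) = 0 := by
  classical
  rw [MvPowerSeries.X, MvPowerSeries.coeff_monomial_mul, if_neg]
  simp [h]

theorem X_mul_divX (i : Fin n) (f : FormalFunctions K n) :
    MvPowerSeries.X i * divX i f = f - restrictX i f := by
  ext m
  rw [map_sub, coeff_restrictX]
  by_cases h : m i = 0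
  · rw [coeff_X_mul_of_eq h, if_pos h, sub_self]
  · rw [coeff_X_mul_of_ne h, coeff_divX, if_neg h, sub_zero, tsub_add_cancel_of_le]
    simpa [Nat.one_le_iff_ne_zero] using h

theorem divX_X_mul (i : Fin n) (f : FormalFunctions K n) :
    divX i (MvPowerSeries.X i * f) = f := by
  ext m
  rw [coeff_divX, coeff_X_mul_of_ne (by simp), add_tsub_cancel_right]

theorem divX_X_mul_of_ne {i j : Fin n} (h : i ≠ j) (f : FormalFunctions K n) :
    divX i (MvPowerSeries.X j * f) = MvPowerSeries.X j * divX i f := by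
  ext m
  rw [coeff_divX]
  by_cases hm : m j = 0
  · rw [coeff_X_mul_of_eq hm, coeff_X_mul_of_eq (by simp [hm, h])]
  · rw [coeff_X_mul_of_ne hm, coeff_X_mul_of_ne (by simp [hm]), coeff_divX]
    congr 2
    ext l
    simp only [Finsupp.coe_tsub, Finsupp.coe_add, Pi.sub_apply, Pi.add_apply]
    rcases eq_or_ne l j with rfl | hl
    · simp [h]
    · simp [hl.symm]

theorem restrictX_restrictX (i : Fin n) (f : FormalFunctions K n) :
    restrictX i (restrictX i f) = restrictX i f := by
  ext m
  simp only [coeff_restrictX]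
  split_ifs <;> rfl

theorem restrictX_comm (i j : Fin n) (f : FormalFunctions K n) :
    restrictX i (restrictX j f) = restrictX j (restrictX i f) := by
  ext m
  simp only [coeff_restrictX]
  split_ifs <;> rfl

theorem exists_sum_X_mul {N : ℕ} {f : FormalFunctions K n} (hf : f ∈ ordIdeal K n (N + 1)) :
    ∃ g : Fin n → FormalFunctions K n, (∀ i, g i ∈ ordIdeal K n N) ∧
      f = ∑ i, MvPowerSeries.X i * g i := by
  classical
  have key : ∀ s : Finset (Fin n), ∃ g : Fin n → FormalFunctions K n,
      (∀ i, g i ∈ ordIdeal K n N) ∧ f - ∑ i, MvPowerSeries.X i * g i ∈ ordIdeal K n (N + 1) ∧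
      ∀ m : Fin n →₀ ℕ, (∃ i ∈ s, m i ≠ 0) →
        MvPowerSeries.coeff m (f - ∑ i, MvPowerSeries.X i * g i) = 0 := by
    intro s
    induction s using Finset.induction_on with
    | empty => exact ⟨0, fun i => zero_mem _, by simpa using hf, by simp⟩
    | insert j s hj ih =>
      obtain ⟨g, h1, h2, h3⟩ := ih
      set r := f - ∑ i, MvPowerSeries.X i * g i with hr
      have hd : divX j r ∈ ordIdeal K n N := by
        intro m hm
        rw [coeff_divX]
        exact h2 _ (by simpa using hm)
      let g' : Fin n → FormalFunctions K n := g + Pi.single j (divX j r)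
      have e : f - ∑ i, MvPowerSeries.X i * g' i = restrictX j r := by
        have : ∑ i, MvPowerSeries.X i * g' i =
            ∑ i, MvPowerSeries.X i * g i + MvPowerSeries.X j * divX j r := by
          simp only [g', Pi.add_apply, mul_add, Finset.sum_add_distrib]
          congr 1
          rw [Finset.sum_eq_single j]
          · simp
          · intro i _ hi; simp [hi]
          · simp
        rw [this, X_mul_divX, ← sub_sub, ← hr, sub_sub_cancel]
      refine ⟨g', ?_, ?_, ?_⟩
      · intro i
        refine add_mem (h1 i) ?_
        rcases eq_or_ne i j with rfl | hi
        · simpa using hd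
        · simp [hi]
      · rw [e]
        intro m hm
        rw [coeff_restrictX, h2 m hm, ite_self]
      · rw [e]
        rintro m ⟨i, hi, hm⟩
        rw [coeff_restrictX]
        split_ifs with h0
        · rcases Finset.mem_insert.1 hi with rfl | hi
          · exact absurd h0 hm
          · exact h3 m ⟨i, hi, hm⟩
        · rfl
  obtain ⟨g, h1, h2, h3⟩ := key Finset.univ
  refine ⟨g, h1, ?_⟩
  rw [← sub_eq_zero]
  ext m
  by_cases hm : m = 0
  · subst hm
    exact h2 0 (by simp)
  · obtain ⟨i, hi⟩ := Finsupp.ne_iff.1 hm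
    exact h3 m ⟨i, Finset.mem_univ _, by simpa using hi⟩

theorem ordIdeal_eq_pow (N : ℕ) : ordIdeal K n N = maxIdeal K n ^ N := by
  induction N with
  | zero =>
    rw [pow_zero, Ideal.one_eq_top, eq_top_iff]
    intro f _ m hm
    omega
  | succ N ih =>
    apply le_antisymm
    · intro f hf
      obtain ⟨g, hg, rfl⟩ := exists_sum_X_mul hf
      refine sum_mem fun i _ => ?_
      rw [pow_succ', ← ih, ← ordIdeal_one]
      exact Ideal.mul_mem_mul (X_mem_ordIdeal i) (hg i)
    · rw [pow_succ, ← ih, Ideal.mul_le, ← ordIdeal_one]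
      exact fun r hr s hs => mul_mem_ordIdeal hr hs

theorem exists_stabilisation_choice {w : FormalFunctions K n} (hw : w ∈ maxIdeal K n ^ 2) :
    ∃ (ŵ : Fin n → FormalFunctions K n) (c : Fin n → Fin n → FormalFunctions K n),
      (∀ i, ŵ i ∈ maxIdeal K n) ∧ ∑ i, MvPowerSeries.X i * ŵ i = w ∧
      (∀ i, ŵ i = -∑ j, c i j * MvPowerSeries.X j) ∧ ∀ i j, i < j → c i j ∈ maxIdeal K n := by
  rw [← ordIdeal_eq_pow] at hw
  obtain ⟨g, hg, hw⟩ := exists_sum_X_mul hw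
  choose h _ hgh using fun i => exists_sum_X_mul (hg i)
  -- the quadratic form `∑ x_i x_j h_ij` only depends on the symmetrisation of `h`, which is used
  -- to move everything to the entries with `j ≤ i`
  let c : Fin n → Fin n → FormalFunctions K n := fun i j =>
    if i < j then 0 else if i = j then -h i i else -(h i j + h j i)
  refine ⟨fun i => -∑ j, c i j * MvPowerSeries.X j, c, ?_, ?_, fun i => rfl, ?_⟩
  · intro i
    rw [← ordIdeal_one]
    exact neg_mem (sum_mem fun j _ => Ideal.mul_mem_left _ _ (X_mem_ordIdeal j))
  · rw [hw]
    simp_rw [hgh, mul_neg, Finset.mul_sum, ← Finset.sum_neg_distrib]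
    rw [← Finset.sum_product', ← Finset.sum_product', ← sub_eq_zero, ← Finset.sum_sub_distrib]
    refine Finset.sum_involution (fun p _ => (p.2, p.1)) ?_ ?_ ?_ ?_
    · rintro ⟨i, j⟩ _
      simp only [c]
      rcases lt_trichotomy i j with hij | rfl | hij
      · rw [if_pos hij, if_neg (by omega), if_neg (by omega)]; ring
      · simp; ring
      · rw [if_pos hij, if_neg (by omega), if_neg (by omega)]; ring
    · rintro ⟨i, j⟩ _ hne he
      apply hne
      obtain rfl : j = i := congrArg Prod.fst he
      simp [c]; ring
    · intros; simp
    · intros; rfl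
  · intro i j hij
    simp [c, hij]

/-! ### Substitution and formal changes of variables -/

theorem hasSubst_of_mem {f : Fin n → FormalFunctions K n} (hf : ∀ i, f i ∈ maxIdeal K n) :
    MvPowerSeries.HasSubst f :=
  MvPowerSeries.hasSubst_of_constantCoeff_zero hf

theorem subst_mem_ordIdeal {f : Fin n → FormalFunctions K n} (hf : ∀ i, f i ∈ maxIdeal K n)
    {N : ℕ} {P : FormalFunctions K n} (hP : P ∈ ordIdeal K n N) :
    MvPowerSeries.subst f P ∈ ordIdeal K n N := by
  have hs := hasSubst_of_mem hf
  induction N generalizing P with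
  | zero => intro m hm; omega
  | succ N ih =>
    obtain ⟨g, hg, rfl⟩ := exists_sum_X_mul hP
    rw [← MvPowerSeries.coe_substAlgHom hs, map_sum]
    refine sum_mem fun i _ => ?_
    rw [map_mul, MvPowerSeries.coe_substAlgHom hs, MvPowerSeries.subst_X hs, add_comm]
    exact mul_mem_ordIdeal (ordIdeal_one (K := K) (n := n) ▸ hf i) (ih (hg i))

theorem exists_polynomial_sub_mem (N : ℕ) (P : FormalFunctions K n) :
    ∃ p : MvPolynomial (Fin n) K, P - (p : MvPowerSeries (Fin n) K) ∈ ordIdeal K n N := by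
  refine ⟨MvPowerSeries.truncTotal N P, fun m hm => ?_⟩
  rw [map_sub, MvPolynomial.coeff_coe, MvPowerSeries.coeff_truncTotal _ hm, sub_self]

theorem subst_sub_subst_mem {f f' : Fin n → FormalFunctions K n} (hf : ∀ i, f i ∈ maxIdeal K n)
    (hf' : ∀ i, f' i ∈ maxIdeal K n) {N : ℕ} (h : ∀ i, f i - f' i ∈ ordIdeal K n N)
    (P : FormalFunctions K n) :
    MvPowerSeries.subst f P - MvPowerSeries.subst f' P ∈ ordIdeal K n N := by
  have hs := hasSubst_of_mem hf
  have hs' := hasSubst_of_mem hf'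
  obtain ⟨p, hp⟩ := exists_polynomial_sub_mem N P
  have hpol : MvPolynomial.aeval f p - MvPolynomial.aeval f' p ∈ ordIdeal K n N := by
    rw [← Ideal.Quotient.eq]
    clear hp
    induction p using MvPolynomial.induction_on with
    | C a => simp
    | add p q hp hq =>
      rw [map_add, map_add, map_add, map_add]
      rw [hp, hq]
    | mul_X p i hp =>
      rw [map_mul, map_mul, map_mul, map_mul, hp, MvPolynomial.aeval_X,
        MvPolynomial.aeval_X, Ideal.Quotient.eq.2 (h i)]
  have e : MvPowerSeries.subst f P - MvPowerSeries.subst f' P =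
      MvPowerSeries.subst f (P - (p : MvPowerSeries (Fin n) K)) -
      MvPowerSeries.subst f' (P - (p : MvPowerSeries (Fin n) K)) +
      (MvPolynomial.aeval f p - MvPolynomial.aeval f' p) := by
    rw [MvPowerSeries.subst_sub hs, MvPowerSeries.subst_sub hs', MvPowerSeries.subst_coe,
      MvPowerSeries.subst_coe]
    ring
  rw [e]
  exact add_mem (sub_mem (subst_mem_ordIdeal hf hp) (subst_mem_ordIdeal hf' hp)) hpol

/-- Substitution into a power series without constant and linear terms gains one order. -/
theorem subst_sub_subst_mem_succ {f f' : Fin n → FormalFunctions K n}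
    (hf : ∀ i, f i ∈ maxIdeal K n) (hf' : ∀ i, f' i ∈ maxIdeal K n) {N : ℕ}
    (h : ∀ i, f i - f' i ∈ ordIdeal K n N) {P : FormalFunctions K n} (hP : P ∈ ordIdeal K n 2) :
    MvPowerSeries.subst f P - MvPowerSeries.subst f' P ∈ ordIdeal K n (N + 1) := by
  have hs := hasSubst_of_mem hf
  have hs' := hasSubst_of_mem hf'
  obtain ⟨g, hg, rfl⟩ := exists_sum_X_mul hP
  rw [← MvPowerSeries.coe_substAlgHom hs, ← MvPowerSeries.coe_substAlgHom hs', map_sum, map_sum,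
    ← Finset.sum_sub_distrib]
  refine sum_mem fun i _ => ?_
  rw [map_mul, map_mul, MvPowerSeries.coe_substAlgHom hs, MvPowerSeries.coe_substAlgHom hs',
    MvPowerSeries.subst_X hs, MvPowerSeries.subst_X hs']
  have e : f i * MvPowerSeries.subst f (g i) - f' i * MvPowerSeries.subst f' (g i) =
      (f i - f' i) * MvPowerSeries.subst f (g i) +
      f' i * (MvPowerSeries.subst f (g i) - MvPowerSeries.subst f' (g i)) := by ring
  rw [e]
  refine add_mem (mul_mem_ordIdeal (h i) (subst_mem_ordIdeal hf (hg i))) ?_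
  rw [add_comm]
  exact mul_mem_ordIdeal (ordIdeal_one (K := K) (n := n) ▸ hf' i) (subst_sub_subst_mem hf hf' h _)

/-- A contraction for the order filtration has a fixed point. -/
theorem exists_fixed_point (T : (Fin n → FormalFunctions K n) → (Fin n → FormalFunctions K n))
    (hT : ∀ f, (∀ i, f i ∈ maxIdeal K n) → ∀ i, T f i ∈ maxIdeal K n)
    (hc : ∀ f f', (∀ i, f i ∈ maxIdeal K n) → (∀ i, f' i ∈ maxIdeal K n) → ∀ N,
      (∀ i, f i - f' i ∈ ordIdeal K n N) → ∀ i, T f i - T f' i ∈ ordIdeal K n (N + 1)) :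
    ∃ f, (∀ i, f i ∈ maxIdeal K n) ∧ T f = f := by
  let g : ℕ → Fin n → FormalFunctions K n := fun N => T^[N] 0
  have hgs : ∀ N, g (N + 1) = T (g N) := fun N => Function.iterate_succ_apply' T N 0
  have hgm : ∀ N i, g N i ∈ maxIdeal K n := by
    intro N
    induction N with
    | zero => intro i; exact zero_mem _
    | succ N ih => intro i; rw [hgs]; exact hT _ ih i
  have hstep : ∀ N i, g (N + 1) i - g N i ∈ ordIdeal K n N := by
    intro N
    induction N with
    | zero => intro i m hm; omega
    | succ N ih =>
      intro i
      rw [hgs (N + 1), hgs N]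
      exact hc _ _ (by rw [← hgs]; exact hgm _) (hgm _) N (by rw [← hgs]; exact ih) i
  have hdist : ∀ N k i, g (N + k) i - g N i ∈ ordIdeal K n N := by
    intro N k i
    induction k with
    | zero => simp
    | succ k ih =>
      rw [← sub_add_sub_cancel _ (g (N + k) i)]
      exact add_mem (ordIdeal_anti (by omega) (hstep (N + k) i)) ih
  let f : Fin n → FormalFunctions K n := fun i m => MvPowerSeries.coeff m (g (m.degree + 1) i)
  have hf : ∀ N i, f i - g N i ∈ ordIdeal K n N := by
    intro N i m hm
    obtain ⟨k, rfl⟩ : ∃ k, N = m.degree + 1 + k := ⟨N - (m.degree + 1), by omega⟩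
    have := hdist (m.degree + 1) k i m (by omega)
    rw [map_sub, sub_eq_zero] at this ⊢
    exact this.symm
  have hfm : ∀ i, f i ∈ maxIdeal K n := by
    intro i
    rw [← sub_add_cancel (f i) (g 1 i)]
    exact add_mem (ordIdeal_one (K := K) (n := n) ▸ hf 1 i) (hgm 1 i)
  refine ⟨f, hfm, funext fun i => ?_⟩
  rw [← sub_eq_zero]
  refine eq_zero_of_mem_ordIdeal fun N => ?_
  have h1 := ordIdeal_anti (by omega) (hc f (g N) hfm (hgm N) N (hf N) i) (M := N)
  have h2 := ordIdeal_anti (by omega) (hf (N + 1) i) (M := N)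
  rw [hgs] at h2
  have := sub_mem h1 h2
  rwa [sub_sub_sub_cancel_right] at this

/-- A formal map whose linear part `A` has the right inverse `B` has a formal right inverse, with
linear part `B`. -/
theorem exists_subst_eq_X {f : Fin n → FormalFunctions K n}
    (A B : Matrix (Fin n) (Fin n) K) (hAB : A * B = 1)
    (hA : ∀ i, f i - ∑ j, A i j • MvPowerSeries.X j ∈ ordIdeal K n 2) :
    ∃ g : Fin n → FormalFunctions K n, (∀ i, g i ∈ maxIdeal K n) ∧
      (∀ i, g i - ∑ j, B i j • MvPowerSeries.X j ∈ ordIdeal K n 2) ∧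
      ∀ i, MvPowerSeries.subst g (f i) = MvPowerSeries.X i := by
  set h : Fin n → FormalFunctions K n := fun i => f i - ∑ j, A i j • MvPowerSeries.X j with hh
  have hsm : ∀ (N : ℕ) (a : K) (r : FormalFunctions K n), r ∈ ordIdeal K n N →
      a • r ∈ ordIdeal K n N := by
    intro N a r hr m hm
    rw [map_smul (MvPowerSeries.coeff (R := K) m) a r, hr m hm, smul_zero]
  -- the equation `f(g) = x`, that is `A g + h(g) = x`, is solved as a fixed point equation
  obtain ⟨g, hg, hgT⟩ := exists_fixed_point
    (fun g i => ∑ j, B i j •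
      ((MvPowerSeries.X j : FormalFunctions K n) - MvPowerSeries.subst g (h j)))
    (by
      intro g hg i
      rw [← ordIdeal_one]
      exact sum_mem fun j _ => hsm _ _ _ (sub_mem (X_mem_ordIdeal j)
        (subst_mem_ordIdeal hg (ordIdeal_anti (by omega) (hA j)))))
    (by
      intro g g' hg hg' N hN i
      rw [← Finset.sum_sub_distrib]
      refine sum_mem fun j _ => ?_
      rw [← smul_sub, sub_sub_sub_cancel_left]
      refine hsm _ _ _ ?_
      rw [← neg_sub]
      exact neg_mem (subst_sub_subst_mem_succ hg hg' hN (hA j)))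
  have hs := hasSubst_of_mem hg
  have hgT' : ∀ i, ∑ j, B i j • ((MvPowerSeries.X j : FormalFunctions K n) -
      MvPowerSeries.subst g (h j)) = g i := fun i => congrFun hgT i
  refine ⟨g, hg, fun i => ?_, fun i => ?_⟩
  · have := hgT' i
    rw [← this, ← Finset.sum_sub_distrib]
    refine sum_mem fun j _ => ?_
    rw [← smul_sub, sub_sub_cancel_left]
    exact hsm _ _ _ (neg_mem (subst_mem_ordIdeal hg (hA j)))
  · have hfi : f i = ∑ j, A i j • MvPowerSeries.X j + h i := by rw [hh]; ring
    have e1 : MvPowerSeries.subst g (f i) = ∑ j, A i j • g j + MvPowerSeries.subst g (h i) := by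
      conv_lhs => rw [hfi]
      rw [← MvPowerSeries.coe_substAlgHom hs, map_add, map_sum]
      congr 1
      refine Finset.sum_congr rfl fun j _ => ?_
      rw [map_smul, MvPowerSeries.substAlgHom_X]
    have e2 : ∑ j, A i j • g j = MvPowerSeries.X i - MvPowerSeries.subst g (h i) := by
      have hsum : ∀ y : Fin n → FormalFunctions K n,
          ∑ j, A i j • ∑ l, B j l • y l = y i := by
        intro y
        simp_rw [Finset.smul_sum, smul_smul]
        rw [Finset.sum_comm]
        simp_rw [← Finset.sum_smul, ← Matrix.mul_apply, hAB, Matrix.one_apply, ite_smul, one_smul,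
          zero_smul]
        simp
      simp_rw [← hgT']
      exact hsum (fun l => MvPowerSeries.X l - MvPowerSeries.subst g (h l))
    rw [e1, e2, sub_add_cancel]

/-- The formal inverse function theorem. -/
theorem exists_formal_inverse {f : Fin n → FormalFunctions K n}
    (A B : Matrix (Fin n) (Fin n) K) (hAB : A * B = 1)
    (hA : ∀ i, f i - ∑ j, A i j • MvPowerSeries.X j ∈ ordIdeal K n 2) :
    ∃ g : Fin n → FormalFunctions K n, (∀ i, g i ∈ maxIdeal K n) ∧
      (∀ i, MvPowerSeries.subst g (f i) = MvPowerSeries.X i) ∧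
      (∀ i, MvPowerSeries.subst f (g i) = MvPowerSeries.X i) := by
  obtain ⟨g, hg, hgB, hgf⟩ := exists_subst_eq_X A B hAB hA
  obtain ⟨f', hf', -, hfg⟩ := exists_subst_eq_X B A (mul_eq_one_comm.1 hAB) hgB
  -- a right inverse `f'` of the right inverse `g` of `f` is `f` itself
  have hff : f' = f := by
    funext i
    have h1 := MvPowerSeries.subst_comp_subst_apply (hasSubst_of_mem hg) (hasSubst_of_mem hf') (f i)
    rw [hgf, MvPowerSeries.subst_X (hasSubst_of_mem hf'), funext hfg, MvPowerSeries.subst_self] at h1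
    exact h1
  exact ⟨g, hg, hgf, hff ▸ hfg⟩

end PowerSeries

/-! ### Signs and parity in superfiltered modules -/

namespace Superfiltration

variable {K X : Type*} [CommRing K] [AddCommGroup X] [Module K X] (S : Superfiltration K X)

theorem sgn_of_mem {i : ZMod 2} {x : X} (hx : x ∈ S.par i) : S.sgn x = ((-1 : ℤˣ) ^ i) • x := by
  have h1 : (1 + 1 : ZMod 2) = 0 := by decide
  have hd : ∀ a : ZMod 2, a = 0 ∨ a = 1 := by decide
  rw [sgn, LinearMap.sub_apply]
  rcases hd i with rfl | rfl
  · rw [S.proj_of_mem hx, S.proj_of_mem_add (i := 1) (by rwa [h1]), sub_zero, uzpow_zero, one_smul]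
  · rw [S.proj_of_mem hx, S.proj_of_mem_add (i := 0) (by rwa [add_zero]), zero_sub, uzpow_one]
    simp

theorem sgn_mem_par {i : ZMod 2} {x : X} (hx : x ∈ S.par i) : S.sgn x ∈ S.par i := by
  rw [S.sgn_of_mem hx, Units.smul_def]
  exact zsmul_mem hx _

theorem sgn_mem_fil {p : ℤ} {x : X} (hx : x ∈ S.fil p) : S.sgn x ∈ S.fil p :=
  sub_mem (S.proj_fil hx 0) (S.proj_fil hx 1)

/-- Two additive maps which agree on homogeneous elements are equal. -/
theorem map_eq_of_par {Y : Type*} [AddCommGroup Y] (f g : X →+ Y)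
    (h : ∀ i, ∀ x ∈ S.par i, f x = g x) (x : X) : f x = g x := by
  rw [← S.proj_add_proj x, map_add, map_add, h 0 _ (S.proj_mem 0 x), h 1 _ (S.proj_mem 1 x)]

theorem sgn_sgn (x : X) : S.sgn (S.sgn x) = x := by
  refine S.map_eq_of_par (S.sgn.toAddMonoidHom.comp S.sgn.toAddMonoidHom) (AddMonoidHom.id X) ?_ x
  intro i y hy
  change S.sgn (S.sgn y) = y
  rw [S.sgn_of_mem (S.sgn_mem_par hy), S.sgn_of_mem hy, smul_smul, ← uzpow_add]
  have : ∀ a : ZMod 2, a + a = 0 := by decide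
  rw [this, uzpow_zero, one_smul]

end Superfiltration

section Maps

variable {K X Y Z : Type*} [CommRing K] [AddCommGroup X] [Module K X] [AddCommGroup Y] [Module K Y]
  [AddCommGroup Z] [Module K Z]

/-- A linear map which is superfiltered of degree `r`. -/
structure IsSuperfilteredMap (S : Superfiltration K X) (S' : Superfiltration K Y) (r : ℤ)
    (f : X →ₗ[K] Y) : Prop where
  par : ∀ i, ∀ x ∈ S.par i, f x ∈ S'.par (i + r)
  fil : ∀ p, ∀ x ∈ S.fil p, f x ∈ S'.fil (p + r)

variable {S : Superfiltration K X} {S' : Superfiltration K Y} {S'' : Superfiltration K Z}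

namespace IsSuperfilteredMap

theorem comp {r s : ℤ} {f : X →ₗ[K] Y} {g : Y →ₗ[K] Z} (hg : IsSuperfilteredMap S' S'' s g)
    (hf : IsSuperfilteredMap S S' r f) : IsSuperfilteredMap S S'' (r + s) (g ∘ₗ f) where
  par i x hx := by
    have := hg.par _ _ (hf.par i x hx)
    rw [add_assoc, ← Int.cast_add] at this
    exact this
  fil p x hx := by
    have := hg.fil _ _ (hf.fil p x hx)
    rwa [add_assoc] at this

theorem add {r : ℤ} {f g : X →ₗ[K] Y} (hf : IsSuperfilteredMap S S' r f)
    (hg : IsSuperfilteredMap S S' r g) : IsSuperfilteredMap S S' r (f + g) where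
  par i x hx := add_mem (hf.par i x hx) (hg.par i x hx)
  fil i x hx := add_mem (hf.fil i x hx) (hg.fil i x hx)

theorem sub {r : ℤ} {f g : X →ₗ[K] Y} (hf : IsSuperfilteredMap S S' r f)
    (hg : IsSuperfilteredMap S S' r g) : IsSuperfilteredMap S S' r (f - g) where
  par i x hx := sub_mem (hf.par i x hx) (hg.par i x hx)
  fil i x hx := sub_mem (hf.fil i x hx) (hg.fil i x hx)

theorem neg {r : ℤ} {f : X →ₗ[K] Y} (hf : IsSuperfilteredMap S S' r f) :
    IsSuperfilteredMap S S' r (-f) where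
  par i x hx := neg_mem (hf.par i x hx)
  fil i x hx := neg_mem (hf.fil i x hx)

theorem sum {ι : Type*} {r : ℤ} (s : Finset ι) {f : ι → X →ₗ[K] Y}
    (hf : ∀ i ∈ s, IsSuperfilteredMap S S' r (f i)) : IsSuperfilteredMap S S' r (∑ i ∈ s, f i) where
  par i x hx := by
    rw [LinearMap.sum_apply]
    exact sum_mem fun j hj => (hf j hj).par i x hx
  fil i x hx := by
    rw [LinearMap.sum_apply]
    exact sum_mem fun j hj => (hf j hj).fil i x hx

theorem id : IsSuperfilteredMap S S 0 LinearMap.id where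
  par i x hx := by simpa using hx
  fil i x hx := by simpa using hx

theorem map_sgn {r : ℤ} {f : X →ₗ[K] Y} (hf : IsSuperfilteredMap S S' r f) (x : X) :
    S'.sgn (f x) = ((-1 : ℤˣ) ^ (r : ZMod 2)) • f (S.sgn x) := by
  refine S.map_eq_of_par (S'.sgn.toAddMonoidHom.comp f.toAddMonoidHom)
    (((-1 : ℤˣ) ^ (r : ZMod 2)) • (f.toAddMonoidHom.comp S.sgn.toAddMonoidHom)) ?_ x
  intro i y hy
  change S'.sgn (f y) = ((-1 : ℤˣ) ^ (r : ZMod 2)) • f (S.sgn y)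
  rw [S'.sgn_of_mem (hf.par i y hy), S.sgn_of_mem hy, Units.smul_def ((-1 : ℤˣ) ^ i), map_zsmul,
    ← Units.smul_def, smul_smul, uzpow_add, mul_comm]

end IsSuperfilteredMap

/-- A map which lowers a finite filtration is nilpotent, so that `1 - N` has a two-sided inverse,
which is superfiltered if `N` is. -/
theorem exists_inverse_one_sub {N : X →ₗ[K] X} (hpar : ∀ i, ∀ x ∈ S.par i, N x ∈ S.par i)
    (hfil : ∀ p, ∀ x ∈ S.fil p, N x ∈ S.fil (p - 1)) {p q : ℤ} (hp : S.fil p = ⊥)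
    (hq : S.fil q = ⊤) :
    ∃ U : X →ₗ[K] X, IsSuperfilteredMap S S 0 U ∧ (∀ x, U (x - N x) = x) ∧
      (∀ x, U x - N (U x) = x) ∧ (∀ p, ∀ x ∈ S.fil p, U x - x ∈ S.fil (p - 1)) := by
  have hpow : ∀ (m : ℕ) (r : ℤ) (x : X), x ∈ S.fil r → (N ^ m) x ∈ S.fil (r - m) := by
    intro m
    induction m with
    | zero => intro r x hx; simpa using hx
    | succ m ih =>
      intro r x hx
      rw [pow_succ', Module.End.mul_apply]
      have := hfil _ _ (ih r x hx)
      rwa [sub_sub, ← Nat.cast_succ] at this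
  have hpowp : ∀ (m : ℕ) (i : ZMod 2) (x : X), x ∈ S.par i → (N ^ m) x ∈ S.par i := by
    intro m
    induction m with
    | zero => intro r x hx; simpa using hx
    | succ m ih =>
      intro r x hx
      rw [pow_succ', Module.End.mul_apply]
      exact hpar _ _ (ih r x hx)
  have hnil : N ^ (q - p).toNat = 0 := by
    ext x
    have h1 := hpow (q - p).toNat q x (by rw [hq]; trivial)
    have h2 : (N ^ (q - p).toNat) x ∈ S.fil p := S.mono (by omega) h1
    rw [hp] at h2
    simpa using h2
  set M := (q - p).toNat
  have hU1 : (∑ i ∈ Finset.range M, N ^ i) * (1 - N) = 1 := by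
    rw [geom_sum_mul_neg, hnil, sub_zero]
  have hU2 : (1 - N) * (∑ i ∈ Finset.range M, N ^ i) = 1 := by
    rw [mul_neg_geom_sum, hnil, sub_zero]
  have hUf : ∀ p, ∀ x ∈ S.fil p, (∑ i ∈ Finset.range M, N ^ i : Module.End K X) x ∈ S.fil p := by
    intro p x hx
    rw [LinearMap.sum_apply]
    exact sum_mem fun j _ => S.mono (by omega) (hpow j p x hx)
  have h2 : ∀ x, (∑ i ∈ Finset.range M, N ^ i : Module.End K X) x -
      N ((∑ i ∈ Finset.range M, N ^ i : Module.End K X) x) = x := fun x => by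
    simpa using LinearMap.congr_fun hU2 x
  refine ⟨∑ i ∈ Finset.range M, N ^ i, ⟨fun i x hx => ?_, fun p x hx => ?_⟩, fun x => ?_, h2,
    fun p x hx => ?_⟩
  · rw [Int.cast_zero, add_zero, LinearMap.sum_apply]
    exact sum_mem fun j _ => hpowp j i x hx
  · rw [add_zero]
    exact hUf p x hx
  · simpa using LinearMap.congr_fun hU1 x
  · have := h2 x
    rw [sub_eq_iff_eq_add] at this
    rw [this, add_sub_cancel_left]
    exact hfil _ _ (hUf p x hx)

end Maps

/-! ### The endomorphism algebra of a superfiltered module -/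

namespace Superfiltration

variable {K X : Type*} [CommRing K] [AddCommGroup X] [Module K X] (S : Superfiltration K X)

theorem mul_mem_endo_par {f g : Module.End K X} {i j : ZMod 2} (hf : f ∈ S.endo.par i)
    (hg : g ∈ S.endo.par j) : f * g ∈ S.endo.par (i + j) := by
  intro l x hx
  rw [add_assoc]
  exact hf _ _ (hg l x hx)

theorem mul_mem_endo_fil {f g : Module.End K X} {p q : ℤ} (hf : f ∈ S.endo.fil p)
    (hg : g ∈ S.endo.fil q) : f * g ∈ S.endo.fil (p + q) := by
  intro l x hx
  have := hf _ _ (hg l x hx)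
  rwa [add_assoc, add_comm q] at this

theorem one_mem_endo_par : (1 : Module.End K X) ∈ S.endo.par 0 := by
  intro i x hx; simpa using hx

theorem one_mem_endo_fil : (1 : Module.End K X) ∈ S.endo.fil 0 := by
  intro i x hx; simpa using hx

theorem endo_sgn (f : Module.End K X) : S.endo.sgn f = S.sgn * f * S.sgn := by
  refine S.endo.map_eq_of_par S.endo.sgn.toAddMonoidHom
    ((AddMonoidHom.mulLeft S.sgn).comp (AddMonoidHom.mulRight S.sgn)) ?_ f |>.trans ?_
  · intro i g hg
    change S.endo.sgn g = S.sgn * (g * S.sgn)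
    rw [S.endo.sgn_of_mem hg]
    ext x
    refine S.map_eq_of_par (((-1 : ℤˣ) ^ i) • g : Module.End K X).toAddMonoidHom
      (S.sgn * (g * S.sgn) : Module.End K X).toAddMonoidHom ?_ x
    intro j y hy
    change ((-1 : ℤˣ) ^ i) • g y = S.sgn (g (S.sgn y))
    rw [S.sgn_of_mem hy, Units.smul_def ((-1 : ℤˣ) ^ j), map_zsmul, map_zsmul,
      S.sgn_of_mem (hg j y hy), ← Units.smul_def, smul_smul, uzpow_add, mul_left_comm,
      ← uzpow_add]
    have : ∀ a : ZMod 2, a + a = 0 := by decide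
    rw [this, uzpow_zero, mul_one]
  · change S.sgn * (f * S.sgn) = _
    rw [mul_assoc]

theorem sgn_mul_sgn : (S.sgn * S.sgn : Module.End K X) = 1 := by
  ext x; exact S.sgn_sgn x

theorem endo_sgn_mul (f g : Module.End K X) :
    S.endo.sgn (f * g) = S.endo.sgn f * S.endo.sgn g := by
  simp only [endo_sgn]
  calc S.sgn * (f * g) * S.sgn = S.sgn * f * 1 * g * S.sgn := by simp only [mul_assoc, one_mul]
    _ = _ := by rw [← S.sgn_mul_sgn]; simp only [mul_assoc]

theorem endo_sgn_one : S.endo.sgn (1 : Module.End K X) = 1 := by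
  rw [endo_sgn, mul_one, sgn_mul_sgn]

theorem endo_fil_eq_bot {p q : ℤ} (hp : S.fil p = ⊥) (hq : S.fil q = ⊤) :
    S.endo.fil (p - q) = ⊥ := by
  rw [eq_bot_iff]
  intro f hf
  rw [Submodule.mem_bot]
  ext x
  have := hf q x (by rw [hq]; trivial)
  rw [add_sub_cancel, hp] at this
  simpa using this

theorem endo_fil_eq_top {p q : ℤ} (hp : S.fil p = ⊥) (hq : S.fil q = ⊤) :
    S.endo.fil (q - p) = ⊤ := by
  rw [eq_top_iff]
  intro f _ r x hx
  rcases le_or_gt r p with h | h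
  · have := S.mono h hx
    rw [hp, Submodule.mem_bot] at this
    rw [this, map_zero]
    exact zero_mem _
  · refine S.mono (show q ≤ r + (q - p) by omega) ?_
    rw [hq]; trivial

end Superfiltration

/-! ### The endomorphism dg-algebra of a filtered matrix factorisation -/

namespace FilteredMF

variable {R : Type*} [CommRing R] {w : R} {X : Type*} [AddCommGroup X] [Module R X]
  (M : FilteredMF R w X)

theorem sgn_d : M.S.endo.sgn M.d = -M.d := by
  rw [M.S.endo.sgn_of_mem M.d_par, uzpow_one]; simp

theorem differential_apply (f : Module.End R X) :
    M.differential f = M.d * f - M.S.endo.sgn f * M.d := rfl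

theorem differential_mul (f g : Module.End R X) :
    M.differential (f * g) = M.differential f * g + M.S.endo.sgn f * M.differential g := by
  simp only [differential_apply, M.S.endo_sgn_mul, sub_mul, mul_sub, mul_assoc]
  abel

theorem differential_one : M.differential 1 = 0 := by
  rw [differential_apply, M.S.endo_sgn_one, mul_one, one_mul, sub_self]

/-- The operation `μ^1` of the endomorphism algebra of a matrix factorisation. -/
def μOne : Module.End R X →ₗ[R] Module.End R X := M.differential ∘ₗ M.S.endo.sgn

theorem μOne_apply (f : Module.End R X) :
    M.μOne f = M.d * M.S.endo.sgn f - f * M.d := by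
  change M.differential (M.S.endo.sgn f) = _
  rw [differential_apply, M.S.endo.sgn_sgn]

theorem μOne_sgn (f : Module.End R X) : M.μOne (M.S.endo.sgn f) = M.differential f := by
  change M.differential (M.S.endo.sgn (M.S.endo.sgn f)) = _
  rw [M.S.endo.sgn_sgn]

/-- The operation `μ^2(f, g) = (-1)^|g| f g` of the endomorphism algebra. -/
def μTwo : Module.End R X →ₗ[R] Module.End R X →ₗ[R] Module.End R X :=
  (LinearMap.mul R (Module.End R X)).compl₂ M.S.endo.sgn

theorem μTwo_apply (f g : Module.End R X) : M.μTwo f g = f * M.S.endo.sgn g := rfl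

theorem isSuperfilteredMap_μOne : IsSuperfilteredMap M.S.endo M.S.endo 1 M.μOne where
  par i f hf := by
    rw [μOne_apply, Int.cast_one]
    refine sub_mem ?_ (M.S.mul_mem_endo_par hf M.d_par)
    rw [add_comm]
    exact M.S.mul_mem_endo_par M.d_par (M.S.endo.sgn_mem_par hf)
  fil p f hf := by
    rw [μOne_apply]
    refine sub_mem ?_ (M.S.mul_mem_endo_fil hf M.d_fil)
    rw [add_comm]
    exact M.S.mul_mem_endo_fil M.d_fil (M.S.endo.sgn_mem_fil hf)

theorem μOne_μOne (f : Module.End R X) : M.μOne (M.μOne f) = 0 := by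
  simp only [μOne_apply, map_sub, M.S.endo_sgn_mul, M.S.endo.sgn_sgn, sgn_d]
  have h1 : M.d * (-M.d * f) = - (w • f) := by
    rw [neg_mul, mul_neg, ← mul_assoc, M.d_sq, smul_mul_assoc, one_mul]
  have h2 : f * M.d * M.d = w • f := by
    rw [mul_assoc, M.d_sq, mul_smul_comm, mul_one]
  rw [h1, h2, mul_neg, mul_neg, mul_assoc]
  abel

theorem μOne_μTwo (f g : Module.End R X) :
    M.μOne (M.μTwo f g) = M.μTwo (M.μOne f) (M.S.endo.sgn g) - M.μTwo f (M.μOne g) := by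
  simp only [μOne_apply, μTwo_apply, map_sub, LinearMap.sub_apply, M.S.endo_sgn_mul,
    M.S.endo.sgn_sgn, sgn_d, mul_assoc, mul_neg, neg_mul]
  abel

theorem μTwo_assoc (f g h : Module.End R X) :
    M.μTwo f (M.μTwo g h) = M.μTwo (M.μTwo f g) (M.S.endo.sgn h) := by
  simp only [μTwo_apply, M.S.endo_sgn_mul, M.S.endo.sgn_sgn, mul_assoc]

end FilteredMF

/-! ### Insertions and convolution products -/

section Insertion

variable {K A B : Type*} [CommRing K] [AddCommGroup B] [Module K B]

theorem map_units_smul {X Y : Type*} [AddCommGroup X] [Module K X] [AddCommGroup Y] [Module K Y]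
    (f : X →ₗ[K] Y) (e : ℤˣ) (x : X) : f (e • x) = e • f x := by
  rw [Units.smul_def, map_zsmul, ← Units.smul_def]

theorem map_units_smul₂ {X Y Z : Type*} [AddCommGroup X] [Module K X] [AddCommGroup Y] [Module K Y]
    [AddCommGroup Z] [Module K Z] (f : X →ₗ[K] Y →ₗ[K] Z) (e : ℤˣ) (x : X) (y : Y) :
    f (e • x) y = e • f x y :=
  map_units_smul (f.flip y) e x

/-- The sign `(-1)^{|a_1| + ⋯ + |a_i| - i}` for inputs of degrees `d`. -/
def koszulSign (d : ℕ → ZMod 2) (i : ℕ) : ℤˣ := (-1 : ℤˣ) ^ (∑ l ∈ Finset.range i, (d l - 1))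

theorem sum_range_add_shift {M : Type*} [AddCommMonoid M] (f : ℕ → M) (l i : ℕ) :
    ∑ q ∈ Finset.range (l + i), f q =
      ∑ q ∈ Finset.range l, f q + ∑ q ∈ Finset.range i, f (q + l) := by
  rw [Finset.sum_range_add]
  simp_rw [add_comm l]

theorem sum_range_split {M : Type*} [AddCommMonoid M] (f : ℕ → M) {l k : ℕ} (h : l ≤ k) :
    ∑ q ∈ Finset.range k, f q =
      ∑ q ∈ Finset.range l, f q + ∑ q ∈ Finset.range (k - l), f (q + l) := by
  rw [← sum_range_add_shift, Nat.add_sub_cancel' h]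

theorem koszulSign_add (d : ℕ → ZMod 2) (l i : ℕ) :
    koszulSign d (l + i) = koszulSign d l * koszulSign (fun q => d (q + l)) i := by
  rw [koszulSign, sum_range_add_shift, uzpow_add]
  rfl

/-- A family of operations is local if the `k`-th one only depends on the first `k` terms. -/
def IsLocal {A B : Type*} (F : ℕ → (ℕ → A) → B) : Prop :=
  ∀ k a a', (∀ i < k, a i = a' i) → F k a = F k a'

/-- The sum of all insertions of the operations `m^j`, `j ≥ 1`, into the operations `F`. -/
def insertion {A B : Type*} [AddCommGroup B] (m : ℕ → (ℕ → A) → A) (F : ℕ → (ℕ → A) → B) (k : ℕ)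
    (d : ℕ → ZMod 2) (a : ℕ → A) : B :=
  ∑ j ∈ Finset.Icc 1 k, ∑ i ∈ Finset.range (k - j + 1),
    koszulSign d i • F (k - j + 1) (replaceBlock i j a (m j (fun q => a (i + q))))

/-- The product of two families of operations induced by a product on their target, obtained by
applying the factors to the two parts of the input. -/
def convolution (mul : B →ₗ[K] B →ₗ[K] B) (F G : ℕ → (ℕ → A) → B) (k : ℕ) (a : ℕ → A) : B :=
  ∑ l ∈ Finset.Ico 1 k, mul (F (k - l) (fun i => a (i + l))) (G l a)

theorem insertionSum_eq_insertion [AddCommGroup A] [Module K A] (μ : Ops K A A) (h0 : μ 0 = 0) (Φ : Ops K A B) (k : ℕ)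
    (d : ℕ → ZMod 2) (a : ℕ → A) :
    insertionSum μ Φ k d a = insertion (fun j a => μ.app j a) (fun j a => Φ.app j a) k d a := by
  rw [insertionSum, insertion, Finset.range_eq_Ico, Finset.sum_eq_sum_Ico_succ_bot (by omega)]
  rw [Finset.sum_eq_zero, zero_add]
  · rfl
  · intro i hi
    have hi' : i < k - 0 + 1 := Finset.mem_range.1 hi
    rw [Ops.app, MultilinearMap.map_coord_zero _ ⟨i, hi'⟩, smul_zero]
    simp [replaceBlock, Ops.app, h0]

theorem replaceBlock_shift {i j l : ℕ} (h : l ≤ i) (a : ℕ → A) (x : A) :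
    (fun p => replaceBlock i j a x (p + l)) = replaceBlock (i - l) j (fun p => a (p + l)) x := by
  funext p
  simp only [replaceBlock]
  by_cases h1 : p + l < i
  · rw [if_pos h1, if_pos (by omega)]
  · by_cases h2 : p + l = i
    · rw [if_neg h1, if_pos h2, if_neg (by omega), if_pos (by omega)]
    · rw [if_neg h1, if_neg h2, if_neg (by omega), if_neg (by omega)]
      congr 1; omega

theorem replaceBlock_shift_of_lt {i j l : ℕ} (h : i < l) (hj : 1 ≤ j) (a : ℕ → A) (x : A) :
    (fun p => replaceBlock i j a x (p + l)) = fun p => a (p + (l + j - 1)) := by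
  funext p
  simp only [replaceBlock]
  rw [if_neg (by omega), if_neg (by omega)]
  congr 1; omega

/-- Insertion of `m` is a derivation of the convolution product. -/
theorem insertion_convolution (mul : B →ₗ[K] B →ₗ[K] B) (m : ℕ → (ℕ → A) → A)
    (F G : ℕ → (ℕ → A) → B) (hG : IsLocal G) (k : ℕ) (d : ℕ → ZMod 2) (a : ℕ → A) :
    insertion m (convolution mul F G) k d a = ∑ l ∈ Finset.Ico 1 k,
      (koszulSign d l • mul (insertion m F (k - l) (fun q => d (q + l)) (fun q => a (q + l)))
        (G l a) + mul (F (k - l) (fun q => a (q + l))) (insertion m G l d a)) := by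
  -- the summand for the insertion at `i` of a block of length `j`, cut at position `l`
  let T : ℕ → ℕ → ℕ → B := fun j i l => koszulSign d i •
    mul (F (k - j + 1 - l)
      (fun p => replaceBlock i j a (m j (fun q => a (i + q))) (p + l)))
      (G l (replaceBlock i j a (m j (fun q => a (i + q)))))
  have hL : insertion m (convolution mul F G) k d a =
      ∑ x ∈ (Finset.Icc 1 k).sigma fun j => (Finset.range (k - j + 1)).sigma fun _ =>
        Finset.Ico 1 (k - j + 1), T x.1 x.2.1 x.2.2 := by
    rw [Finset.sum_sigma]
    refine Finset.sum_congr rfl fun j _ => ?_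
    rw [Finset.sum_sigma]
    refine Finset.sum_congr rfl fun i _ => ?_
    rw [convolution, Finset.smul_sum]
  rw [hL, ← Finset.sum_filter_add_sum_filter_not _ (fun x => x.2.2 ≤ x.2.1),
    Finset.sum_add_distrib]
  congr 1
  · have : ∑ l ∈ Finset.Ico 1 k, koszulSign d l •
        mul (insertion m F (k - l) (fun q => d (q + l)) (fun q => a (q + l))) (G l a) =
        ∑ x ∈ (Finset.Ico 1 k).sigma fun l => (Finset.Icc 1 (k - l)).sigma fun j =>
          Finset.range (k - l - j + 1), koszulSign d x.1 •
            mul (koszulSign (fun q => d (q + x.1)) x.2.2 • F (k - x.1 - x.2.1 + 1)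
              (replaceBlock x.2.2 x.2.1 (fun q => a (q + x.1))
                (m x.2.1 (fun q => a (x.2.2 + q + x.1))))) (G x.1 a) := by
      rw [Finset.sum_sigma]
      refine Finset.sum_congr rfl fun l _ => ?_
      rw [Finset.sum_sigma, insertion, map_sum, LinearMap.sum_apply, Finset.smul_sum]
      refine Finset.sum_congr rfl fun j _ => ?_
      rw [map_sum, LinearMap.sum_apply, Finset.smul_sum]
    rw [this]
    refine Finset.sum_nbij' (fun x => ⟨x.2.2, x.1, x.2.1 - x.2.2⟩)
      (fun x => ⟨x.2.1, x.1 + x.2.2, x.1⟩) ?_ ?_ ?_ ?_ ?_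
    · rintro ⟨j, i, l⟩ h
      simp only [Finset.mem_filter, Finset.mem_sigma, Finset.mem_Icc, Finset.mem_range,
        Finset.mem_Ico] at h ⊢
      omega
    · rintro ⟨l, j, i⟩ h
      simp only [Finset.mem_filter, Finset.mem_sigma, Finset.mem_Icc, Finset.mem_range,
        Finset.mem_Ico] at h ⊢
      omega
    · rintro ⟨j, i, l⟩ h
      simp only [Finset.mem_filter, Finset.mem_sigma, Finset.mem_Icc, Finset.mem_range,
        Finset.mem_Ico] at h ⊢
      rw [Nat.add_sub_cancel' h.2]
    · rintro ⟨l, j, i⟩ h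
      simp only [Nat.add_sub_cancel_left]
    · rintro ⟨j, i, l⟩ h
      simp only [Finset.mem_filter, Finset.mem_sigma, Finset.mem_Icc, Finset.mem_range,
        Finset.mem_Ico] at h
      obtain ⟨i, rfl⟩ := Nat.exists_eq_add_of_le h.2
      simp only [T, map_units_smul₂, smul_smul, Nat.add_sub_cancel_left, koszulSign_add]
      rw [replaceBlock_shift h.2, Nat.add_sub_cancel_left]
      congr 2
      · congr 2
        · omega
        · congr 2
          funext q
          congr 1; omega
      · exact hG _ _ _ fun p hp => if_pos (by omega)
  · have : ∑ l ∈ Finset.Ico 1 k, mul (F (k - l) (fun q => a (q + l))) (insertion m G l d a) =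
        ∑ x ∈ (Finset.Ico 1 k).sigma fun l => (Finset.Icc 1 l).sigma fun j =>
          Finset.range (l - j + 1), koszulSign d x.2.2 •
            mul (F (k - x.1) (fun q => a (q + x.1))) (G (x.1 - x.2.1 + 1)
              (replaceBlock x.2.2 x.2.1 a (m x.2.1 (fun q => a (x.2.2 + q))))) := by
      rw [Finset.sum_sigma]
      refine Finset.sum_congr rfl fun l _ => ?_
      rw [Finset.sum_sigma, insertion, map_sum]
      refine Finset.sum_congr rfl fun j _ => ?_
      rw [map_sum]
      refine Finset.sum_congr rfl fun i _ => ?_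
      rw [map_units_smul]
    rw [this]
    refine Finset.sum_nbij' (fun x => ⟨x.2.2 + x.1 - 1, x.1, x.2.1⟩)
      (fun x => ⟨x.2.1, x.2.2, x.1 - x.2.1 + 1⟩) ?_ ?_ ?_ ?_ ?_
    · rintro ⟨j, i, l⟩ h
      simp only [Finset.mem_filter, Finset.mem_sigma, Finset.mem_Icc, Finset.mem_range,
        Finset.mem_Ico] at h ⊢
      omega
    · rintro ⟨l, j, i⟩ h
      simp only [Finset.mem_filter, Finset.mem_sigma, Finset.mem_Icc, Finset.mem_range,
        Finset.mem_Ico] at h ⊢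
      omega
    · rintro ⟨j, i, l⟩ h
      simp only [Finset.mem_filter, Finset.mem_sigma, Finset.mem_Icc, Finset.mem_range,
        Finset.mem_Ico] at h ⊢
      rw [show l + j - 1 - j + 1 = l by omega]
    · rintro ⟨l, j, i⟩ h
      simp only [Finset.mem_sigma, Finset.mem_Icc, Finset.mem_range,
        Finset.mem_Ico] at h ⊢
      rw [show l - j + 1 + j - 1 = l by omega]
    · rintro ⟨j, i, l⟩ h
      simp only [Finset.mem_filter, Finset.mem_sigma, Finset.mem_Icc, Finset.mem_range,
        Finset.mem_Ico] at h
      simp only [T]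
      rw [replaceBlock_shift_of_lt (by omega) h.1.1.1, show l + j - 1 - j + 1 = l by omega,
        show k - j + 1 - l = k - (l + j - 1) by omega]

/-- Associativity of the convolution product. -/
theorem sum_convolution_assoc (mul : B →ₗ[K] B →ₗ[K] B) (F : ℕ → (ℕ → A) → B) (e : ℕ → ℤˣ)
    (k : ℕ) (a : ℕ → A)
    (h : ∀ l, 1 ≤ l → l < k → ∀ x y, mul x (mul y (F l a)) = -(e l • mul (mul x y) (F l a))) :
    ∑ l ∈ Finset.Ico 1 k, (e l • mul (convolution mul F F (k - l) (fun q => a (q + l))) (F l a) +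
      mul (F (k - l) (fun q => a (q + l))) (convolution mul F F l a)) = 0 := by
  have h1 : ∑ l ∈ Finset.Ico 1 k,
      mul (F (k - l) (fun q => a (q + l))) (convolution mul F F l a) =
      ∑ x ∈ (Finset.Ico 1 k).sigma fun l => Finset.Ico 1 l,
        mul (F (k - x.1) (fun q => a (q + x.1))) (mul (F (x.1 - x.2) (fun q => a (q + x.2)))
          (F x.2 a)) := by
    rw [Finset.sum_sigma]
    refine Finset.sum_congr rfl fun l _ => ?_
    rw [convolution, map_sum]
  have h2 : ∑ l ∈ Finset.Ico 1 k,
      e l • mul (convolution mul F F (k - l) (fun q => a (q + l))) (F l a) =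
      ∑ x ∈ (Finset.Ico 1 k).sigma fun l => Finset.Ico 1 (k - l),
        e x.1 • mul (mul (F (k - x.1 - x.2) (fun q => a (q + x.2 + x.1)))
          (F x.2 (fun q => a (q + x.1)))) (F x.1 a) := by
    rw [Finset.sum_sigma]
    refine Finset.sum_congr rfl fun l _ => ?_
    rw [convolution, map_sum, LinearMap.sum_apply, Finset.smul_sum]
  rw [Finset.sum_add_distrib, h1, h2, add_eq_zero_iff_eq_neg, ← Finset.sum_neg_distrib]
  refine Finset.sum_nbij' (fun x => ⟨x.1 + x.2, x.1⟩) (fun x => ⟨x.2, x.1 - x.2⟩) ?_ ?_ ?_ ?_ ?_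
  · rintro ⟨l, i⟩ hx
    simp only [Finset.mem_sigma, Finset.mem_Ico] at hx ⊢
    omega
  · rintro ⟨l, i⟩ hx
    simp only [Finset.mem_sigma, Finset.mem_Ico] at hx ⊢
    omega
  · rintro ⟨l, i⟩ hx
    simp only [Nat.add_sub_cancel_left]
  · rintro ⟨l, i⟩ hx
    simp only [Finset.mem_sigma, Finset.mem_Ico] at hx ⊢
    rw [Nat.add_sub_cancel' (by omega)]
  · rintro ⟨l, i⟩ hx
    simp only [Finset.mem_sigma, Finset.mem_Ico] at hx
    simp only
    rw [h l hx.1.1 hx.1.2, neg_neg, Nat.sub_sub, Nat.add_sub_cancel_left]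
    have e1 : (fun q => a (q + i + l)) = fun q => a (q + (l + i)) := by
      funext q
      congr 1; omega
    rw [e1]

end Insertion

/-! ### Multilinear families of operations -/

section Multilinear

variable {K A B : Type*} [CommRing K] [AddCommGroup A] [Module K A] [AddCommGroup B] [Module K B]

/-- A function of sequences which only depends on the first `k` terms, and is multilinear in
these. -/
structure IsMultilinearOn (K : Type*) {A B : Type*} [CommRing K] [AddCommGroup A] [Module K A]
    [AddCommGroup B] [Module K B] (k : ℕ) (F : (ℕ → A) → B) : Prop where
  congr : ∀ a a' : ℕ → A, (∀ i < k, a i = a' i) → F a = F a'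
  add : ∀ (a : ℕ → A) (i : ℕ) (x y : A), i < k →
    F (Function.update a i (x + y)) = F (Function.update a i x) + F (Function.update a i y)
  smul : ∀ (a : ℕ → A) (i : ℕ) (c : K) (x : A), i < k →
    F (Function.update a i (c • x)) = c • F (Function.update a i x)

/-- Extension of a finite tuple by zero. -/
def extendZero {k : ℕ} (v : Fin k → A) (q : ℕ) : A := if h : q < k then v ⟨q, h⟩ else 0

theorem extendZero_of_lt {k : ℕ} (v : Fin k → A) {q : ℕ} (h : q < k) :
    extendZero v q = v ⟨q, h⟩ := dif_pos h

theorem extendZero_coe {k : ℕ} (v : Fin k → A) (q : Fin k) : extendZero v q = v q :=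
  extendZero_of_lt v q.2

theorem extendZero_update {k : ℕ} [DecidableEq (Fin k)] (v : Fin k → A) (i : Fin k) (x : A) :
    extendZero (Function.update v i x) = Function.update (extendZero v) i x := by
  funext q
  by_cases h : q < k
  · rw [extendZero_of_lt _ h]
    by_cases hq : q = i
    · subst hq; simp
    · rw [Function.update_of_ne hq, Function.update_of_ne, extendZero_of_lt _ h]
      exact fun hi => hq (congrArg Fin.val hi)
  · have hq : q ≠ i := fun hq => h (hq ▸ i.2)
    rw [Function.update_of_ne hq, extendZero, extendZero, dif_neg h, dif_neg h]

/-- The multilinear map underlying a function of sequences. -/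
def IsMultilinearOn.toMultilinearMap {k : ℕ} {F : (ℕ → A) → B} (hF : IsMultilinearOn K k F) :
    MultilinearMap K (fun _ : Fin k => A) B where
  toFun v := F (extendZero v)
  map_update_add' v i x y := by
    rw [extendZero_update, extendZero_update, extendZero_update, hF.add _ _ _ _ i.2]
  map_update_smul' v i c x := by
    rw [extendZero_update, extendZero_update, hF.smul _ _ _ _ i.2]

theorem IsMultilinearOn.toMultilinearMap_apply {k : ℕ} {F : (ℕ → A) → B}
    (hF : IsMultilinearOn K k F) (a : ℕ → A) :
    hF.toMultilinearMap (fun q : Fin k => a q) = F a :=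
  hF.congr _ _ fun _ hi => extendZero_of_lt _ hi

theorem IsMultilinearOn.linear_comp {C : Type*} [AddCommGroup C] [Module K C] {k : ℕ}
    {F : (ℕ → A) → B} (hF : IsMultilinearOn K k F) (f : B →ₗ[K] C) :
    IsMultilinearOn K k (fun a => f (F a)) where
  congr a a' h := congrArg f (hF.congr a a' h)
  add a i x y h := by rw [hF.add a i x y h, map_add]
  smul a i c x h := by rw [hF.smul a i c x h, map_smul]

theorem IsMultilinearOn.sum {ι : Type*} (s : Finset ι) {k : ℕ} {F : ι → (ℕ → A) → B}
    (hF : ∀ i ∈ s, IsMultilinearOn K k (F i)) : IsMultilinearOn K k (fun a => ∑ i ∈ s, F i a) where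
  congr a a' h := Finset.sum_congr rfl fun i hi => (hF i hi).congr a a' h
  add a i x y h := by
    rw [← Finset.sum_add_distrib]
    exact Finset.sum_congr rfl fun j hj => (hF j hj).add a i x y h
  smul a i c x h := by
    rw [Finset.smul_sum]
    exact Finset.sum_congr rfl fun j hj => (hF j hj).smul a i c x h

theorem update_shift_of_lt {A : Type*} {i l : ℕ} (h : i < l) (a : ℕ → A) (x : A) :
    (fun q => Function.update a i x (q + l)) = fun q => a (q + l) := by
  funext q
  exact Function.update_of_ne (by omega) _ _

theorem update_shift_of_le {A : Type*} {i l : ℕ} (h : l ≤ i) (a : ℕ → A) (x : A) :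
    (fun q => Function.update a i x (q + l)) =
      Function.update (fun q => a (q + l)) (i - l) x := by
  funext q
  by_cases hq : q = i - l
  · rw [hq, Function.update_self, Nat.sub_add_cancel h, Function.update_self]
  · rw [Function.update_of_ne hq, Function.update_of_ne (by omega)]

theorem IsMultilinearOn.mul_shift (mul : B →ₗ[K] B →ₗ[K] B) {k l : ℕ} (hl : l ≤ k)
    {F G : (ℕ → A) → B} (hF : IsMultilinearOn K (k - l) F) (hG : IsMultilinearOn K l G) :
    IsMultilinearOn K k (fun a => mul (F (fun q => a (q + l))) (G a)) where
  congr a a' h := by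
    rw [hG.congr a a' fun i hi => h i (by omega),
      hF.congr (fun q => a (q + l)) (fun q => a' (q + l)) fun i hi => h _ (by omega)]
  add a i x y h := by
    have hGi : l ≤ i → ∀ z, G (Function.update a i z) = G a := fun hi z =>
      hG.congr _ _ fun j hj => Function.update_of_ne (by omega) _ _
    rcases lt_or_ge i l with hi | hi
    · simp only [update_shift_of_lt hi, hG.add a i x y hi, map_add]
    · simp only [update_shift_of_le hi, hF.add _ _ x y (show i - l < k - l by omega), map_add,
        hGi hi, LinearMap.add_apply]
  smul a i c x h := by
    have hGi : l ≤ i → ∀ z, G (Function.update a i z) = G a := fun hi z =>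
      hG.congr _ _ fun j hj => Function.update_of_ne (by omega) _ _
    rcases lt_or_ge i l with hi | hi
    · simp only [update_shift_of_lt hi, hG.smul a i c x hi, map_smul]
    · simp only [update_shift_of_le hi, hF.smul _ _ c x (show i - l < k - l by omega), map_smul,
        hGi hi, LinearMap.smul_apply]

end Multilinear

/-! ### Homotopy transfer for differential graded algebras -/

section Transfer

variable {K A B : Type*} [CommRing K] [AddCommGroup A] [Module K A] [AddCommGroup B] [Module K B]

theorem htpyKernel_eq (mul : B → B → B) (η : B → B) {k : ℕ} (hk : 2 ≤ k) (a : ℕ → B) :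
    htpyKernel mul η k a = η (kernel mul η k a) := by
  obtain ⟨m, rfl⟩ := Nat.exists_eq_add_of_le' hk
  rw [htpyKernel, kernel, Finset.sum_Ico_eq_sum_range]
  congr 1
  rw [show m + 2 - 1 = m + 1 by omega, ← Fin.sum_univ_eq_sum_range
    (fun j => mul (htpyKernel mul η (m + 2 - (1 + j)) (fun i => a (i + (1 + j))))
      (htpyKernel mul η (1 + j) a))]
  refine Finset.sum_congr rfl fun j _ => ?_
  rw [show m + 2 - (1 + (j : ℕ)) = m + 1 - j by omega, add_comm 1 (j : ℕ)]

/-- A contraction of a superfiltered differential graded algebra `B` (with operations `m1` and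
`mul`, in the sign conventions for `A∞`-algebras) onto a superfiltered module `A` with vanishing
differential, satisfying the side conditions. -/
structure Contraction (S : Superfiltration K A) (S' : Superfiltration K B) (eA : A) (eB : B) where
  /-- the differential `μ^1` -/
  m1 : B →ₗ[K] B
  /-- the product `μ^2` -/
  mul : B →ₗ[K] B →ₗ[K] B
  /-- the inclusion -/
  incl : A →ₗ[K] B
  /-- the projection -/
  proj : B →ₗ[K] A
  /-- the homotopy -/
  htpy : B →ₗ[K] B
  mul_par : ∀ i j, ∀ x ∈ S'.par i, ∀ y ∈ S'.par j, mul x y ∈ S'.par (i + j)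
  mul_fil : ∀ p q, ∀ x ∈ S'.fil p, ∀ y ∈ S'.fil q, mul x y ∈ S'.fil (p + q)
  incl_super : IsSuperfilteredMap S S' 0 incl
  proj_super : IsSuperfilteredMap S' S 0 proj
  htpy_super : IsSuperfilteredMap S' S' (-1) htpy
  leibniz : ∀ x y, m1 (mul x y) = mul (m1 x) (S'.sgn y) - mul x (m1 y)
  assoc : ∀ x y z, mul x (mul y z) = mul (mul x y) (S'.sgn z)
  mul_one : ∀ x, mul x eB = x
  one_mul : ∀ x, mul eB x = S'.sgn x
  m1_incl : ∀ a, m1 (incl a) = 0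
  proj_m1 : ∀ x, proj (m1 x) = 0
  homotopy : ∀ x, m1 (htpy x) + htpy (m1 x) = incl (proj x) - x
  htpy_incl : ∀ a, htpy (incl a) = 0
  proj_htpy : ∀ x, proj (htpy x) = 0
  htpy_htpy : ∀ x, htpy (htpy x) = 0
  proj_incl : ∀ a, proj (incl a) = a
  incl_one : incl eA = eB
  one_par : eA ∈ S.par 0
  one_fil : eA ∈ S.fil 0

namespace Contraction

variable {S : Superfiltration K A} {S' : Superfiltration K B} {eA : A} {eB : B}
  (C : Contraction S S' eA eB)

/-- The operations `I^1 = ι` and `I^k = η ∘ 𝐩_k ∘ ι^{⊗k}`. -/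
def inclOp (k : ℕ) (a : ℕ → A) : B :=
  htpyKernel (fun x y => C.mul x y) C.htpy k (fun i => C.incl (a i))

/-- The kernels `𝐩_k ∘ ι^{⊗k}`. -/
def kernelOp (k : ℕ) (a : ℕ → A) : B :=
  kernel (fun x y => C.mul x y) C.htpy k (fun i => C.incl (a i))

/-- The operations of the minimal model. -/
def minOp (k : ℕ) (a : ℕ → A) : A := C.proj (C.kernelOp k a)

theorem inclOp_zero (a : ℕ → A) : C.inclOp 0 a = 0 := by rw [inclOp, htpyKernel]

theorem inclOp_one (a : ℕ → A) : C.inclOp 1 a = C.incl (a 0) := by rw [inclOp, htpyKernel]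

theorem inclOp_eq {k : ℕ} (hk : 2 ≤ k) (a : ℕ → A) :
    C.inclOp k a = C.htpy (C.kernelOp k a) := htpyKernel_eq _ _ hk _

theorem kernelOp_eq (k : ℕ) (a : ℕ → A) :
    C.kernelOp k a = convolution C.mul C.inclOp C.inclOp k a := rfl

theorem kernelOp_of_lt {k : ℕ} (hk : k < 2) (a : ℕ → A) : C.kernelOp k a = 0 := by
  rw [kernelOp_eq, convolution, Finset.Ico_eq_empty (by omega), Finset.sum_empty]

theorem minOp_of_lt {k : ℕ} (hk : k < 2) (a : ℕ → A) : C.minOp k a = 0 := by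
  rw [minOp, C.kernelOp_of_lt hk, map_zero]

theorem kernelOp_isMultilinearOn_of_lt {k : ℕ}
    (h : ∀ l < k, IsMultilinearOn K l (C.inclOp l)) : IsMultilinearOn K k (C.kernelOp k) := by
  refine IsMultilinearOn.sum (Finset.Ico 1 k) fun l hl => ?_
  rw [Finset.mem_Ico] at hl
  exact IsMultilinearOn.mul_shift C.mul hl.2.le (h (k - l) (by omega)) (h l hl.2)

theorem inclOp_isMultilinearOn (k : ℕ) : IsMultilinearOn K k (C.inclOp k) := by
  induction k using Nat.strong_induction_on with
  | _ k ih =>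
    rcases Nat.lt_or_ge k 2 with hk | hk
    · interval_cases k
      · refine ⟨fun a a' _ => ?_, fun a i x y h => by omega, fun a i c x h => by omega⟩
        rw [inclOp_zero, inclOp_zero]
      · refine ⟨fun a a' h => ?_, fun a i x y h => ?_, fun a i c x h => ?_⟩
        · rw [inclOp_one, inclOp_one, h 0 (by omega)]
        · obtain rfl : i = 0 := by omega
          simp only [inclOp_one, Function.update_self, map_add]
        · obtain rfl : i = 0 := by omega
          simp only [inclOp_one, Function.update_self, map_smul]
    · have := (C.kernelOp_isMultilinearOn_of_lt ih).linear_comp C.htpy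
      rwa [← funext (C.inclOp_eq hk)] at this

theorem kernelOp_isMultilinearOn (k : ℕ) : IsMultilinearOn K k (C.kernelOp k) :=
  C.kernelOp_isMultilinearOn_of_lt fun l _ => C.inclOp_isMultilinearOn l

theorem minOp_isMultilinearOn (k : ℕ) : IsMultilinearOn K k (C.minOp k) :=
  (C.kernelOp_isMultilinearOn k).linear_comp C.proj

/-- The minimal model, as a sequence of multilinear operations. -/
def minOps : Ops K A A := fun k => (C.minOp_isMultilinearOn k).toMultilinearMap

/-- The quasi-isomorphism from the minimal model, as a sequence of multilinear operations. -/
def inclOps : Ops K A B := fun k => (C.inclOp_isMultilinearOn k).toMultilinearMap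

theorem minOps_app (k : ℕ) (a : ℕ → A) : C.minOps.app k a = C.minOp k a :=
  (C.minOp_isMultilinearOn k).toMultilinearMap_apply a

theorem inclOps_app (k : ℕ) (a : ℕ → A) : C.inclOps.app k a = C.inclOp k a :=
  (C.inclOp_isMultilinearOn k).toMultilinearMap_apply a

theorem minOps_zero : C.minOps 0 = 0 := by
  ext v
  exact C.minOp_of_lt (by omega) _

theorem minOps_one : C.minOps 1 = 0 := by
  ext v
  exact C.minOp_of_lt (by omega) _

/-! #### Parity and filtration of the transferred operations -/

theorem kernelOp_par_of_lt {k : ℕ} {d : ℕ → ZMod 2} {a : ℕ → A}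
    (h : ∀ l, 1 ≤ l → l < k → ∀ s,
      C.inclOp l (fun q => a (q + s)) ∈ S'.par ((∑ i ∈ Finset.range l, (d (i + s) - 1)) + 1)) :
    C.kernelOp k a ∈ S'.par (∑ i ∈ Finset.range k, (d i - 1)) := by
  rw [kernelOp_eq, convolution]
  refine sum_mem fun l hl => ?_
  rw [Finset.mem_Ico] at hl
  have := C.mul_par _ _ _ (h (k - l) (by omega) (by omega) l) _ (h l hl.1 hl.2 0)
  have e2 : ∀ x y : ZMod 2, x + 1 + (y + 1) = y + x := by decide
  rw [e2] at this
  rw [sum_range_split _ hl.2.le]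
  exact this

theorem inclOp_par (k : ℕ) (hk : 1 ≤ k) (d : ℕ → ZMod 2) (a : ℕ → A)
    (ha : ∀ i, a i ∈ S.par (d i)) :
    C.inclOp k a ∈ S'.par ((∑ i ∈ Finset.range k, (d i - 1)) + 1) := by
  induction k using Nat.strong_induction_on generalizing d a with
  | _ k ih =>
    rcases Nat.lt_or_ge k 2 with hk2 | hk2
    · obtain rfl : k = 1 := by omega
      have := C.incl_super.par _ _ (ha 0)
      simpa [inclOp_one] using this
    · rw [C.inclOp_eq hk2]
      have := C.htpy_super.par _ _ (C.kernelOp_par_of_lt (k := k) (d := d) (a := a)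
        fun l h1 h2 s => ih l h2 h1 _ _ fun i => ha _)
      have e : ((-1 : ℤ) : ZMod 2) = 1 := by decide
      rwa [e] at this

theorem kernelOp_par (k : ℕ) (d : ℕ → ZMod 2) (a : ℕ → A) (ha : ∀ i, a i ∈ S.par (d i)) :
    C.kernelOp k a ∈ S'.par (∑ i ∈ Finset.range k, (d i - 1)) :=
  C.kernelOp_par_of_lt fun l h1 _ _ => C.inclOp_par l h1 _ _ fun _ => ha _

theorem inclOp_fil (k : ℕ) (hk : 1 ≤ k) (p : ℕ → ℤ) (a : ℕ → A) (ha : ∀ i, a i ∈ S.fil (p i)) :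
    C.inclOp k a ∈ S'.fil ((∑ i ∈ Finset.range k, (p i - 1)) + 1) := by
  induction k using Nat.strong_induction_on generalizing p a with
  | _ k ih =>
    rcases Nat.lt_or_ge k 2 with hk2 | hk2
    · obtain rfl : k = 1 := by omega
      have := C.incl_super.fil _ _ (ha 0)
      simpa [inclOp_one] using this
    · rw [C.inclOp_eq hk2]
      have : C.kernelOp k a ∈ S'.fil (∑ i ∈ Finset.range k, (p i - 1) + 2) := by
        rw [kernelOp_eq, convolution]
        refine sum_mem fun l hl => ?_
        rw [Finset.mem_Ico] at hl
        have h1 := ih (k - l) (by omega) (by omega) (fun q => p (q + l)) (fun q => a (q + l))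
          fun i => ha _
        have h2 := ih l hl.2 hl.1 p a ha
        have := C.mul_fil _ _ _ h1 _ h2
        rw [sum_range_split _ hl.2.le]
        convert! this using 2
        ring
      have := C.htpy_super.fil _ _ this
      rwa [add_assoc] at this

theorem kernelOp_fil (k : ℕ) (p : ℕ → ℤ) (a : ℕ → A) (ha : ∀ i, a i ∈ S.fil (p i)) :
    C.kernelOp k a ∈ S'.fil (∑ i ∈ Finset.range k, (p i - 1) + 2) := by
  rw [kernelOp_eq, convolution]
  refine sum_mem fun l hl => ?_
  rw [Finset.mem_Ico] at hl
  have h1 := C.inclOp_fil (k - l) (by omega) (fun q => p (q + l)) (fun q => a (q + l))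
    fun i => ha _
  have h2 := C.inclOp_fil l hl.1 p a ha
  have := C.mul_fil _ _ _ h1 _ h2
  rw [sum_range_split _ hl.2.le]
  convert! this using 2
  ring

/-- If `η` kills the products of inputs to leading order, then the operations `I^k` with `k ≥ 2`
vanish to leading order. -/
theorem inclOp_lead {k : ℕ} (hk : 2 ≤ k) {p : ℕ → ℤ} {a : ℕ → A} (ha : ∀ i, a i ∈ S.fil (p i))
    (hL : ∀ i, C.htpy (C.mul (C.incl (a (i + 1))) (C.incl (a i))) ∈
      S'.fil (p (i + 1) + p i - 2)) :
    C.inclOp k a ∈ S'.fil (∑ i ∈ Finset.range k, (p i - 1)) ∧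
      (3 ≤ k → C.kernelOp k a ∈ S'.fil (∑ i ∈ Finset.range k, (p i - 1) + 1)) := by
  induction k using Nat.strong_induction_on generalizing p a with
  | _ k ih =>
    have hker : 3 ≤ k → C.kernelOp k a ∈ S'.fil (∑ i ∈ Finset.range k, (p i - 1) + 1) := by
      intro hk3
      rw [kernelOp_eq, convolution]
      refine sum_mem fun l hl => ?_
      rw [Finset.mem_Ico] at hl
      rw [sum_range_split _ hl.2.le]
      -- one of the two factors has at least two inputs
      rcases Nat.lt_or_ge l 2 with hl2 | hl2
      · have h1 := (ih (k - l) (by omega) (by omega) (p := fun q => p (q + l))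
          (a := fun q => a (q + l)) (fun i => ha _)
          fun i => by rw [Nat.add_right_comm]; exact hL _).1
        have h2 := C.inclOp_fil l hl.1 p a ha
        have := C.mul_fil _ _ _ h1 _ h2
        convert! this using 2
        ring
      · have h1 := C.inclOp_fil (k - l) (by omega) (fun q => p (q + l)) (fun q => a (q + l))
          fun i => ha _
        have h2 := (ih l hl.2 hl2 ha hL).1
        have := C.mul_fil _ _ _ h1 _ h2
        convert! this using 2
        ring
    refine ⟨?_, hker⟩
    rw [C.inclOp_eq hk]
    rcases Nat.lt_or_ge k 3 with hk3 | hk3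
    · obtain rfl : k = 2 := by omega
      have := hL 0
      rw [kernelOp_eq, convolution, Finset.sum_Ico_succ_top (by omega)]
      simp only [Finset.Ico_self, Finset.sum_empty, zero_add, Finset.sum_range_succ,
        Finset.range_zero] at this ⊢
      rw [show 2 - 1 = 1 by rfl, C.inclOp_one, C.inclOp_one]
      convert! this using 2
      ring
    · have := C.htpy_super.fil _ _ (hker hk3)
      rwa [add_assoc, show (1 : ℤ) + -1 = 0 by rfl, add_zero] at this

/-! #### The `A∞`-relations -/

theorem isLocal_inclOp : IsLocal C.inclOp := fun k => (C.inclOp_isMultilinearOn k).congr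

/-- The `A∞`-relations before `π` or `η` is applied. The second identity follows from the first in
lower arity, by the Leibniz rule for insertions and associativity; the first follows from the second
by the homotopy identity. Applying `π` to the second gives the relations of the minimal model, and the
first expresses that the inclusions form a homomorphism. -/
theorem insertion_relations (k : ℕ) (d : ℕ → ZMod 2) (a : ℕ → A) (ha : ∀ i, a i ∈ S.par (d i)) :
    insertion C.minOp C.inclOp k d a = C.m1 (C.inclOp k a) + C.kernelOp k a ∧
    insertion C.minOp C.kernelOp k d a = -C.m1 (C.kernelOp k a) := by
  induction k using Nat.strong_induction_on generalizing d a with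
  | _ k ih =>
    have hsgn : ∀ l, 1 ≤ l → S'.sgn (C.inclOp l a) = -(koszulSign d l • C.inclOp l a) := by
      intro l hl
      rw [S'.sgn_of_mem (C.inclOp_par l hl d a ha), uzpow_add, uzpow_one, mul_comm, koszulSign,
        neg_one_mul, Units.neg_smul]
    have hP : insertion C.minOp C.kernelOp k d a = -C.m1 (C.kernelOp k a) := by
      have e : C.kernelOp = convolution C.mul C.inclOp C.inclOp := rfl
      rw [e, insertion_convolution _ _ _ _ C.isLocal_inclOp]
      have h1 : ∀ l ∈ Finset.Ico 1 k,
          koszulSign d l • C.mul (insertion C.minOp C.inclOp (k - l) (fun q => d (q + l))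
            (fun q => a (q + l))) (C.inclOp l a) +
          C.mul (C.inclOp (k - l) (fun q => a (q + l))) (insertion C.minOp C.inclOp l d a) =
          -C.m1 (C.mul (C.inclOp (k - l) (fun q => a (q + l))) (C.inclOp l a)) +
          (koszulSign d l • C.mul (convolution C.mul C.inclOp C.inclOp (k - l)
            (fun q => a (q + l))) (C.inclOp l a) +
          C.mul (C.inclOp (k - l) (fun q => a (q + l)))
            (convolution C.mul C.inclOp C.inclOp l a)) := by
        intro l hl
        rw [Finset.mem_Ico] at hl
        rw [(ih (k - l) (by omega) _ _ fun i => ha _).1, (ih l hl.2 _ _ ha).1, C.leibniz,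
          hsgn l hl.1, ← kernelOp_eq, ← kernelOp_eq]
        simp only [map_add, map_neg, LinearMap.add_apply, smul_add, map_units_smul]
        abel
      rw [Finset.sum_congr rfl h1, Finset.sum_add_distrib, sum_convolution_assoc, add_zero,
        convolution, map_sum, Finset.sum_neg_distrib]
      intro l hl1 hl2 x y
      rw [C.assoc, hsgn l hl1, map_neg, map_units_smul]
    refine ⟨?_, hP⟩
    rcases Nat.lt_or_ge k 2 with hk | hk
    · interval_cases k
      · simp [insertion, inclOp_zero, kernelOp_of_lt]
      · simp [insertion, inclOp_one, kernelOp_of_lt, C.m1_incl, minOp_of_lt, replaceBlock]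
    · -- the insertion of `m^k` contributes `ι π p_k`, all others are in the image of `η`
      have h1 : insertion C.minOp C.inclOp k d a =
          C.htpy (insertion C.minOp C.kernelOp k d a) + C.incl (C.proj (C.kernelOp k a)) := by
        rw [insertion, insertion, ← Finset.Ico_succ_right_eq_Icc, Order.succ_eq_add_one,
          Finset.sum_Ico_succ_top (by omega), Finset.sum_Ico_succ_top (by omega), map_add, map_sum,
          add_assoc]
        congr 1
        · refine Finset.sum_congr rfl fun j hj => ?_
          rw [Finset.mem_Ico] at hj
          rw [map_sum]
          refine Finset.sum_congr rfl fun i _ => ?_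
          rw [C.inclOp_eq (by omega), map_units_smul]
        · simp [inclOp_one, kernelOp_of_lt, replaceBlock, koszulSign, minOp]
      have h2 := C.homotopy (C.kernelOp k a)
      rw [h1, hP, map_neg, C.inclOp_eq hk]
      rw [eq_sub_iff_add_eq] at h2
      rw [← h2]
      abel

/-! #### Strict unitality -/

theorem sgn_htpy (x : B) : S'.sgn (C.htpy x) = -C.htpy (S'.sgn x) := by
  have e : ((-1 : ℤ) : ZMod 2) = 1 := by decide
  rw [C.htpy_super.map_sgn, e, uzpow_one]
  simp

theorem sgn_incl (a : A) : S'.sgn (C.incl a) = C.incl (S.sgn a) := by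
  rw [C.incl_super.map_sgn, Int.cast_zero, uzpow_zero, one_smul]

theorem inclOp_unit {k : ℕ} (hk : 2 ≤ k) (a : ℕ → A) (h : ∃ i < k, a i = eA) :
    C.inclOp k a = 0 ∧ (3 ≤ k → C.minOp k a = 0) := by
  induction k using Nat.strong_induction_on generalizing a with
  | _ k ih =>
    obtain ⟨i, hi, hai⟩ := h
    -- the kernel is a multiple of `I^{k-1}`, or of `ι` if `k = 2`
    have key : C.kernelOp k a = (if i = 0 then C.inclOp (k - 1) (fun q => a (q + 1)) else 0) +
        (if i = k - 1 then S'.sgn (C.inclOp (k - 1) a) else 0) := by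
      rw [kernelOp_eq, convolution]
      have hl : ∀ l ∈ Finset.Ico 1 k,
          C.mul (C.inclOp (k - l) (fun q => a (q + l))) (C.inclOp l a) =
          (if l = 1 then (if i = 0 then C.inclOp (k - 1) (fun q => a (q + 1)) else 0) else 0) +
          (if l = k - 1 then (if i = k - 1 then S'.sgn (C.inclOp (k - 1) a) else 0) else 0) := by
        intro l hl
        rw [Finset.mem_Ico] at hl
        rcases lt_or_ge i l with hil | hil
        · have h2 : ¬(l = k - 1 ∧ i = k - 1) := by omega
          have h3 : (if l = k - 1 then
              (if i = k - 1 then S'.sgn (C.inclOp (k - 1) a) else 0) else 0) = 0 := by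
            split_ifs <;> first | rfl | omega
          rw [h3, add_zero]
          rcases Nat.lt_or_ge l 2 with hl2 | hl2
          · obtain rfl : l = 1 := by omega
            obtain rfl : i = 0 := by omega
            rw [if_pos rfl, if_pos rfl, C.inclOp_one, hai, C.incl_one, C.mul_one]
          · rw [if_neg (by omega), (ih l hl.2 hl2 a ⟨i, hil, hai⟩).1, map_zero]
        · have h3 : (if l = 1 then
              (if i = 0 then C.inclOp (k - 1) (fun q => a (q + 1)) else 0) else 0) = 0 := by
            split_ifs <;> first | rfl | omega
          rw [h3, zero_add]
          rcases Nat.lt_or_ge (k - l) 2 with hl2 | hl2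
          · obtain rfl : l = k - 1 := by omega
            rw [if_pos rfl, if_pos (by omega), show k - (k - 1) = 1 by omega, C.inclOp_one,
              show 0 + (k - 1) = i by omega, hai, C.incl_one, C.one_mul]
          · rw [if_neg (by omega), (ih (k - l) (by omega) hl2 (fun q => a (q + l))
              ⟨i - l, by omega, by rw [Nat.sub_add_cancel hil, hai]⟩).1, map_zero,
              LinearMap.zero_apply]
      rw [Finset.sum_congr rfl hl, Finset.sum_add_distrib, Finset.sum_ite_eq',
        Finset.sum_ite_eq', if_pos (Finset.mem_Ico.2 ⟨le_rfl, by omega⟩),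
        if_pos (Finset.mem_Ico.2 ⟨by omega, by omega⟩)]
    have hη : ∀ (j : ℕ) (b : ℕ → A), C.htpy (C.inclOp j b) = 0 ∧
        C.htpy (S'.sgn (C.inclOp j b)) = 0 := by
      intro j b
      rcases Nat.lt_or_ge j 2 with hj | hj
      · interval_cases j
        · simp [inclOp_zero]
        · rw [C.inclOp_one, C.sgn_incl, C.htpy_incl, C.htpy_incl]
          exact ⟨rfl, rfl⟩
      · rw [C.inclOp_eq hj, C.sgn_htpy, map_neg, C.htpy_htpy, C.htpy_htpy, neg_zero]
        exact ⟨rfl, rfl⟩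
    have hπ : ∀ (j : ℕ) (b : ℕ → A), 2 ≤ j → C.proj (C.inclOp j b) = 0 ∧
        C.proj (S'.sgn (C.inclOp j b)) = 0 := by
      intro j b hj
      rw [C.inclOp_eq hj, C.sgn_htpy, map_neg, C.proj_htpy, C.proj_htpy, neg_zero]
      exact ⟨rfl, rfl⟩
    constructor
    · rw [C.inclOp_eq hk, key, map_add]
      split_ifs <;> simp [hη]
    · intro hk3
      rw [minOp, key, map_add]
      split_ifs <;> simp [hπ (k - 1) _ (show 2 ≤ k - 1 by omega)]

/-! #### The minimal model -/

theorem minOp_two (a : ℕ → A) : C.minOp 2 a = C.proj (C.mul (C.incl (a 1)) (C.incl (a 0))) := by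
  rw [minOp, kernelOp_eq, convolution, Finset.sum_Ico_succ_top (by omega)]
  simp only [Finset.Ico_self, Finset.sum_empty, zero_add]
  rw [show 2 - 1 = 1 by rfl, C.inclOp_one, C.inclOp_one]

theorem minOps_two (x y : A) : C.minOps 2 ![x, y] = C.proj (C.mul (C.incl y) (C.incl x)) :=
  C.minOp_two _

theorem isSuperfilteredAInf_minOps : IsSuperfilteredAInf S eA C.minOps where
  curvature := C.minOps_zero
  superfiltered := by
    refine ⟨fun k _ d a ha => ?_, fun k _ p a ha => ?_⟩
    · rw [minOps_app]
      have := C.proj_super.par _ _ (C.kernelOp_par k d a ha)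
      rwa [add_assoc, Int.cast_one, show (1 + 1 : ZMod 2) = 0 by decide, ← Int.cast_zero]
    · rw [minOps_app]
      have := C.proj_super.fil _ _ (C.kernelOp_fil k p a ha)
      rwa [add_zero, ← one_add_one_eq_two, ← add_assoc] at this
  relation k d a ha := by
    rw [insertionSum_eq_insertion _ C.minOps_zero]
    have h1 : (fun j a => C.minOps.app j a) = C.minOp := by
      funext j b; exact C.minOps_app j b
    have h2 : insertion C.minOp C.minOp k d a =
        C.proj (insertion C.minOp C.kernelOp k d a) := by
      simp only [insertion, map_sum, map_units_smul]
      rfl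
    rw [h1, h2, (C.insertion_relations k d a ha).2, map_neg, C.proj_m1, neg_zero]
  unit_par := C.one_par
  unit_fil := C.one_fil
  unit_one := by rw [C.minOps_one]; rfl
  unit_left i a ha := by
    rw [minOps_two, C.incl_one, C.one_mul, C.sgn_incl, C.proj_incl, S.sgn_of_mem ha]
  unit_right a := by
    rw [minOps_two, C.incl_one, C.mul_one, C.proj_incl]
  unit_higher k hk a := by
    rintro ⟨i, hi⟩
    exact (C.inclOp_unit (by omega) (extendZero a) ⟨i, i.2, by rw [extendZero_coe, hi]⟩).2 hk

/-- The compositions of `k` of length `1` and `2` are the trivial one and the pairs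
`l + (k - l)`. -/
theorem sum_composition_eq {X : Type*} [AddCommGroup X] {k : ℕ} (T : Composition k → X)
    (h : ∀ c, c.length ≠ 1 → c.length ≠ 2 → T c = 0) (hk : 1 ≤ k) :
    ∑ c, T c = T ⟨[k], by simp; omega, by simp⟩ +
      ∑ l ∈ (Finset.Ico 1 k).attach, T ⟨[l.1, k - l.1], by
        have := Finset.mem_Ico.1 l.2
        simp; omega, by
        have := Finset.mem_Ico.1 l.2
        simp; omega⟩ := by
  classical
  set U : Finset (Composition k) := {⟨[k], by simp; omega, by simp⟩} with hU
  set W : Finset (Composition k) := (Finset.Ico 1 k).attach.image fun l => ⟨[l.1, k - l.1], by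
        have := Finset.mem_Ico.1 l.2
        simp; omega, by
        have := Finset.mem_Ico.1 l.2
        simp; omega⟩ with hW
  have hdisj : Disjoint U W := by
    rw [Finset.disjoint_left]
    intro c hc hc'
    rw [hU, Finset.mem_singleton] at hc
    obtain ⟨l, -, hl⟩ := Finset.mem_image.1 hc'
    rw [hc] at hl
    have := congrArg Composition.length hl
    simp [Composition.length] at this
  rw [← Finset.sum_subset (Finset.subset_univ (U ∪ W)), Finset.sum_union hdisj, hU,
    Finset.sum_singleton, hW, Finset.sum_image]
  · intro l _ l' _ hll
    have := congrArg Composition.blocks hll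
    simp only [List.cons.injEq] at this
    exact Subtype.ext this.1
  · intro c _ hc
    apply h
    · intro hlen
      apply hc
      rw [Finset.mem_union]
      left
      rw [hU, Finset.mem_singleton]
      obtain ⟨x, hx⟩ := List.length_eq_one_iff.1 hlen
      ext1
      have := c.blocks_sum
      rw [hx] at this ⊢
      simpa using this
    · intro hlen
      apply hc
      rw [Finset.mem_union]
      right
      obtain ⟨x, y, hx⟩ := List.length_eq_two.1 hlen
      have h1 := c.blocks_sum
      have h2 := fun i (hi : i ∈ c.blocks) => c.blocks_pos hi
      rw [hx] at h1 h2
      simp only [List.sum_cons, List.sum_nil, add_zero, List.mem_cons, List.not_mem_nil, or_false,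
        forall_eq_or_imp, forall_eq] at h1 h2
      rw [hW, Finset.mem_image]
      refine ⟨⟨x, by rw [Finset.mem_Ico]; omega⟩, Finset.mem_attach _ _, ?_⟩
      ext1
      rw [hx]
      simp only [List.cons.injEq, and_true, true_and]
      omega

/-- The right-hand side of the homomorphism relations, for a differential graded target. -/
theorem sum_composition_dg {k : ℕ} (hk : 1 ≤ k) (μ : Ops K B B)
    (h0 : ∀ r, r ≠ 1 → r ≠ 2 → μ r = 0) (F : ℕ → ℕ → B) :
    ∑ c : Composition k, μ c.length (fun r => F (c.blocksFun r) (c.sizeUpTo r)) =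
      μ 1 ![F k 0] + ∑ l ∈ Finset.Ico 1 k, μ 2 ![F l 0, F (k - l) l] := by
  rw [sum_composition_eq _ (fun c h1 h2 => by rw [h0 _ h1 h2]; rfl) hk,
    ← Finset.sum_attach (Finset.Ico 1 k)]
  congr 1
  · change μ 1 _ = _
    congr 1
    funext r
    obtain rfl : r = ⟨0, Nat.one_pos⟩ := Fin.ext (Nat.lt_one_iff.1 r.2)
    rfl
  · refine Finset.sum_congr rfl fun l _ => ?_
    change μ 2 _ = _
    congr 1
    funext r
    fin_cases r <;> rfl

theorem isSuperfilteredAInfHom_inclOps (μ : Ops K B B) (h1 : ∀ x, μ 1 ![x] = C.m1 x)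
    (h2 : ∀ x y, μ 2 ![x, y] = C.mul y x) (h0 : ∀ r, r ≠ 1 → r ≠ 2 → μ r = 0) :
    IsSuperfilteredAInfHom S S' eA eB C.minOps μ C.inclOps where
  superfiltered := by
    refine ⟨fun k hk d a ha => ?_, fun k hk p a ha => ?_⟩
    · rw [inclOps_app, Int.cast_zero, add_zero]
      exact C.inclOp_par k hk d a ha
    · rw [inclOps_app, add_zero]
      exact C.inclOp_fil k hk p a ha
  relation k d a ha := by
    rw [insertionSum_eq_insertion _ C.minOps_zero]
    have e1 : (fun j a => C.minOps.app j a) = C.minOp := by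
      funext j b; exact C.minOps_app j b
    have e2 : (fun j a => C.inclOps.app j a) = C.inclOp := by
      funext j b; exact C.inclOps_app j b
    rw [e1, e2]
    rcases Nat.eq_zero_or_pos k with rfl | hk
    · rw [insertion, Finset.Icc_eq_empty (by omega), Finset.sum_empty, Finset.sum_eq_zero]
      intro c _
      have := c.length_le
      rw [h0 _ (by omega) (by omega)]
      rfl
    · simp_rw [C.inclOps_app]
      rw [(C.insertion_relations k d a ha).1,
        sum_composition_dg hk μ h0 (fun j s => C.inclOp j (fun q => a (s + q))), h1]
      congr 1
      · simp only [zero_add]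
      · rw [kernelOp_eq, convolution]
        refine Finset.sum_congr rfl fun l _ => ?_
        rw [h2]
        simp only [zero_add, add_comm l]
  unit_one := (C.inclOp_one _).trans C.incl_one
  unit_higher k hk a := by
    rintro ⟨i, hi⟩
    exact (C.inclOp_unit hk (extendZero a) ⟨i, i.2, by rw [extendZero_coe, hi]⟩).1

end Contraction

end Transfer

/-! ### The `A∞`-algebra of endomorphisms of a matrix factorisation -/

namespace Superfiltration

variable {K X : Type*} [CommRing K] [AddCommGroup X] [Module K X] (S : Superfiltration K X)

theorem restrictScalars_sgn (K₀ : Type*) [CommRing K₀] [Algebra K₀ K] [Module K₀ X]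
    [IsScalarTower K₀ K X] (x : X) : (S.restrictScalars K₀).sgn x = S.sgn x := by
  refine S.map_eq_of_par (S.restrictScalars K₀).sgn.toAddMonoidHom S.sgn.toAddMonoidHom ?_ x
  intro i y hy
  exact ((S.restrictScalars K₀).sgn_of_mem (i := i) hy).trans (S.sgn_of_mem hy).symm

end Superfiltration

namespace FilteredMF

variable {R : Type*} [CommRing R] {w : R} {X : Type*} [AddCommGroup X] [Module R X]
  (M : FilteredMF R w X)
variable (K : Type*) [CommRing K] [Algebra K R] [Module K X] [IsScalarTower K R X]

theorem endOps_one (f : Module.End R X) : M.endOps K 1 ![f] = M.μOne f := rfl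

theorem endOps_two (f g : Module.End R X) : M.endOps K 2 ![f, g] = M.μTwo g f := rfl

theorem endOps_eq_zero : ∀ r, r ≠ 1 → r ≠ 2 → M.endOps K r = 0
  | 0, _, _ => rfl
  | 1, h, _ => absurd rfl h
  | 2, _, h => absurd rfl h
  | _ + 3, _, _ => rfl

theorem endOps_app_one (a : ℕ → Module.End R X) : (M.endOps K).app 1 a = M.μOne (a 0) := rfl

theorem endOps_app_two (a : ℕ → Module.End R X) :
    (M.endOps K).app 2 a = M.μTwo (a 1) (a 0) := rfl

theorem endOps_app_eq_zero {r : ℕ} (h1 : r ≠ 1) (h2 : r ≠ 2) (a : ℕ → Module.End R X) :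
    (M.endOps K).app r a = 0 := by
  rw [Ops.app, M.endOps_eq_zero K r h1 h2]; rfl

theorem endSuperfiltration_sgn (f : Module.End R X) :
    (M.endSuperfiltration K).sgn f = M.S.endo.sgn f :=
  M.S.endo.restrictScalars_sgn K f

theorem μTwo_par {i j : ZMod 2} {f g : Module.End R X} (hf : f ∈ M.S.endo.par i)
    (hg : g ∈ M.S.endo.par j) : M.μTwo f g ∈ M.S.endo.par (i + j) :=
  M.S.mul_mem_endo_par hf (M.S.endo.sgn_mem_par hg)

theorem μTwo_fil {i j : ℤ} {f g : Module.End R X} (hf : f ∈ M.S.endo.fil i)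
    (hg : g ∈ M.S.endo.fil j) : M.μTwo f g ∈ M.S.endo.fil (i + j) :=
  M.S.mul_mem_endo_fil hf (M.S.endo.sgn_mem_fil hg)

theorem isSuperfilteredOps_endOps :
    IsSuperfilteredOps (M.endSuperfiltration K) (M.endSuperfiltration K) 1 (M.endOps K) where
  par k hk d a ha := by
    by_cases h1 : k = 1
    · subst h1
      rw [endOps_app_one]
      have := M.isSuperfilteredMap_μOne.par _ _ (ha 0)
      rw [Finset.sum_range_one, Int.cast_one, sub_add_cancel]
      simpa only [Int.cast_one] using! this
    by_cases h2 : k = 2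
    · subst h2
      rw [endOps_app_two]
      have := M.μTwo_par (ha 1) (ha 0)
      have e : ∀ x y : ZMod 2, y - 1 + (x - 1) + 1 + 1 = x + y := by decide
      rw [Finset.sum_range_succ, Finset.sum_range_one, Int.cast_one, e]
      exact this
    · rw [M.endOps_app_eq_zero K h1 h2]
      exact zero_mem _
  fil k hk p a ha := by
    by_cases h1 : k = 1
    · subst h1
      rw [endOps_app_one]
      rw [Finset.sum_range_one, sub_add_cancel]
      exact M.isSuperfilteredMap_μOne.fil _ _ (ha 0)
    by_cases h2 : k = 2
    · subst h2
      rw [endOps_app_two]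
      have := M.μTwo_fil (ha 1) (ha 0)
      rw [Finset.sum_range_succ, Finset.sum_range_one,
        show p 0 - 1 + (p 1 - 1) + 1 + 1 = p 1 + p 0 by ring]
      exact this
    · rw [M.endOps_app_eq_zero K h1 h2]
      exact zero_mem _

theorem koszulSign_smul_sgn {d : ℕ → ZMod 2} {a : ℕ → Module.End R X}
    (ha : ∀ i, a i ∈ M.S.endo.par (d i)) :
    koszulSign d 1 • a 0 = -M.S.endo.sgn (a 0) := by
  rw [M.S.endo.sgn_of_mem (ha 0), koszulSign, Finset.sum_range_one,
    show d 0 - 1 = d 0 + 1 by have : ∀ x : ZMod 2, x - 1 = x + 1 := by decide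
                              exact this _,
    uzpow_add, uzpow_one, mul_comm, neg_one_mul, Units.neg_smul]

theorem insertion_endOps_of_ge {k : ℕ} (hk : 4 ≤ k) (d : ℕ → ZMod 2) (a : ℕ → Module.End R X) :
    insertion (fun j a => (M.endOps K).app j a) (fun j a => (M.endOps K).app j a) k d a = 0 := by
  refine Finset.sum_eq_zero fun j hj => Finset.sum_eq_zero fun i hi => ?_
  rw [Finset.mem_Icc] at hj
  rw [Finset.mem_range] at hi
  beta_reduce
  by_cases h : j < 3
  · rw [M.endOps_app_eq_zero K (r := k - j + 1) (by omega) (by omega), smul_zero]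
  · rw [M.endOps_app_eq_zero K (r := j) (by omega) (by omega), Ops.app,
      MultilinearMap.map_coord_zero _ ⟨i, hi⟩, smul_zero]
    simp [replaceBlock]

theorem insertion_endOps (k : ℕ) (d : ℕ → ZMod 2) (a : ℕ → Module.End R X)
    (ha : ∀ i, a i ∈ M.S.endo.par (d i)) :
    insertion (fun j a => (M.endOps K).app j a) (fun j a => (M.endOps K).app j a) k d a = 0 := by
  rcases Nat.lt_or_ge k 4 with hk | hk
  · have h0 : koszulSign d 0 = 1 := by simp [koszulSign]
    have h1 : ∀ f, koszulSign d 1 • M.μTwo f (a 0) = -M.μTwo f (M.S.endo.sgn (a 0)) := fun f => by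
      rw [← map_units_smul, M.koszulSign_smul_sgn ha, map_neg]
    interval_cases k
    · rfl
    · simp [insertion, endOps_app_one, replaceBlock, μOne_μOne]
    · rw [insertion, Finset.sum_Icc_succ_top (by omega), Finset.Icc_self, Finset.sum_singleton]
      simp only [Finset.sum_range_succ, Finset.sum_range_zero, zero_add]
      simp [endOps_app_one, endOps_app_two, replaceBlock, h0, h1,
        μOne_μTwo]
      abel
    · rw [insertion, Finset.sum_Icc_succ_top (by omega), Finset.sum_Icc_succ_top (by omega),
        Finset.Icc_self, Finset.sum_singleton]
      have h3 : ∀ b, (M.endOps K).app 3 b = 0 := fun b =>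
        M.endOps_app_eq_zero K (by omega) (by omega) b
      simp only [Finset.sum_range_succ, Finset.sum_range_zero, zero_add]
      simp [endOps_app_one, endOps_app_two, replaceBlock, h0, h1, h3,
        μTwo_assoc]
  · exact M.insertion_endOps_of_ge K hk d a

theorem isSuperfilteredAInf_endOps :
    IsSuperfilteredAInf (M.endSuperfiltration K) (1 : Module.End R X) (M.endOps K) where
  curvature := rfl
  superfiltered := M.isSuperfilteredOps_endOps K
  relation k d a ha := by
    rw [insertionSum_eq_insertion _ rfl]
    exact M.insertion_endOps K k d a ha
  unit_par := M.S.one_mem_endo_par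
  unit_fil := M.S.one_mem_endo_fil
  unit_one := by
    rw [endOps_one, μOne_apply, M.S.endo_sgn_one, mul_one, one_mul, sub_self]
  unit_left i a ha := by
    rw [endOps_two, μTwo_apply, one_mul]
    exact M.S.endo.sgn_of_mem ha
  unit_right a := by
    rw [endOps_two, μTwo_apply, M.S.endo_sgn_one, mul_one]
  unit_higher k hk a _ := by
    rw [M.endOps_eq_zero K k (by omega) (by omega)]; rfl

end FilteredMF

/-! ### Maps out of graded modules -/

namespace Superfiltration

variable {K X : Type*} [CommRing K] [AddCommGroup X] [Module K X]
variable (𝒜 : ℕ → Submodule K X) [DirectSum.Decomposition 𝒜]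

theorem mem_of_mem_supported {s : Set ℕ} {P : Submodule K X} (h : ∀ m ∈ s, 𝒜 m ≤ P) {x : X}
    (hx : x ∈ supported 𝒜 s) : x ∈ P := by
  classical
  rw [← DirectSum.sum_support_decompose 𝒜 x]
  refine sum_mem fun m _ => ?_
  by_cases hm : m ∈ s
  · exact h m hm (SetLike.coe_mem _)
  · rw [hx m hm]
    exact zero_mem _

theorem mem_par_ofGrading {m : ℕ} {x : X} (hx : x ∈ 𝒜 m) : x ∈ (ofGrading 𝒜).par (m : ZMod 2) :=
  mem_supported_of_mem 𝒜 (s := {l | (l : ZMod 2) = (m : ZMod 2)}) rfl hx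

theorem mem_fil_ofGrading {m : ℕ} {x : X} (hx : x ∈ 𝒜 m) : x ∈ (ofGrading 𝒜).fil m :=
  mem_supported_of_mem 𝒜 (s := {l | (l : ℤ) ≤ (m : ℤ)}) (le_refl (m : ℤ)) hx

theorem fil_ofGrading_of_neg {p : ℤ} (hp : p < 0) : (ofGrading 𝒜).fil p = ⊥ := by
  rw [eq_bot_iff]
  intro x hx
  refine mem_of_mem_supported 𝒜 (fun m hm => ?_) hx
  have : (m : ℤ) ≤ p := hm
  omega

theorem mem_of_fil_zero {x : X} (hx : x ∈ (ofGrading 𝒜).fil 0) : x ∈ 𝒜 0 := by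
  refine mem_of_mem_supported 𝒜 (fun m hm => ?_) hx
  have h : (m : ℤ) ≤ 0 := hm
  obtain rfl : m = 0 := by omega
  exact le_rfl

theorem mem_of_fil_one_of_par_one {x : X} (hx : x ∈ (ofGrading 𝒜).fil 1)
    (hx' : x ∈ (ofGrading 𝒜).par 1) : x ∈ 𝒜 1 := by
  have : x ∈ supported 𝒜 {1} := by
    intro m hm
    by_cases h : m = 0
    · exact hx' m (by simp [h])
    · refine hx m (fun hm' => hm ?_)
      have : (m : ℤ) ≤ 1 := hm'
      simp only [Set.mem_singleton_iff]
      omega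
  refine mem_of_mem_supported 𝒜 (fun m hm => ?_) this
  rw [hm]

theorem isSuperfilteredMap_ofGrading {Y : Type*} [AddCommGroup Y] [Module K Y]
    {S' : Superfiltration K Y} {r : ℤ} {f : X →ₗ[K] Y}
    (h : ∀ m, ∀ x ∈ 𝒜 m, f x ∈ S'.par (m + r) ∧ f x ∈ S'.fil (m + r)) :
    IsSuperfilteredMap (ofGrading 𝒜) S' r f where
  par i x hx := by
    refine mem_of_mem_supported 𝒜 (P := (S'.par (i + r)).comap f) (fun m hm y hy => ?_) hx
    obtain rfl : (m : ZMod 2) = i := hm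
    exact (h m y hy).1
  fil p x hx := by
    refine mem_of_mem_supported 𝒜 (P := (S'.fil (p + r)).comap f) (fun m hm y hy => ?_) hx
    have hm' : (m : ℤ) ≤ p := hm
    exact S'.mono (by omega) (h m y hy).2

end Superfiltration

/-! ### The exterior algebra and its base change -/

section Exterior

variable {K : Type u} [CommRing K] {V : Type v} [AddCommGroup V] [Module K V] {n : ℕ}

theorem ι_mem_exteriorPower (x : V) : ExteriorAlgebra.ι K x ∈ ⋀[K]^1 V := by
  rw [ExteriorAlgebra.exteriorPower, pow_one]
  exact ⟨x, rfl⟩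

theorem one_mem_exteriorPower : (1 : ExteriorAlgebra K V) ∈ ⋀[K]^0 V := by
  rw [ExteriorAlgebra.exteriorPower, pow_zero]
  exact Submodule.one_le.1 le_rfl

theorem mul_mem_exteriorPower {p q : ℕ} {x y : ExteriorAlgebra K V} (hx : x ∈ ⋀[K]^p V)
    (hy : y ∈ ⋀[K]^q V) : x * y ∈ ⋀[K]^(p + q) V := by
  rw [ExteriorAlgebra.exteriorPower, pow_add]
  exact Submodule.mul_mem_mul hx hy

theorem ext_par {m : ℕ} {x : ExteriorAlgebra K V} (hx : x ∈ ⋀[K]^m V) :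
    x ∈ (extSuper K V).par (m : ZMod 2) := Superfiltration.mem_par_ofGrading _ hx

theorem ext_fil {m : ℕ} {x : ExteriorAlgebra K V} (hx : x ∈ ⋀[K]^m V) :
    x ∈ (extSuper K V).fil m := Superfiltration.mem_fil_ofGrading _ hx

theorem basis_mem_exteriorPower (b : Module.Basis (Fin n) K V) (s : Finset (Fin n)) :
    b.ExteriorAlgebra s ∈ ⋀[K]^s.card V := by
  rw [ExteriorAlgebra.basis_apply]
  exact ((exteriorPower.ιMulti_family K s.card b
    (Set.powersetCard.prodEquiv.symm s).2 : ⋀[K]^s.card V)).2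

theorem ext_fil_eq_top (b : Module.Basis (Fin n) K V) : (extSuper K V).fil n = ⊤ := by
  rw [eq_top_iff, ← b.ExteriorAlgebra.span_eq, Submodule.span_le]
  rintro _ ⟨s, rfl⟩
  refine (extSuper K V).mono ?_ (ext_fil (basis_mem_exteriorPower b s))
  have := s.card_le_univ
  simpa using this

theorem ext_fil_neg_one : (extSuper K V).fil (-1) = ⊥ :=
  Superfiltration.fil_ofGrading_of_neg _ (by norm_num)

theorem ext_fil_base_neg_one (R : Type*) [CommRing R] [Algebra K R] :
    (extSuperBase K V R).fil (-1) = ⊥ :=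
  Superfiltration.fil_ofGrading_of_neg _ (by norm_num)

theorem ext_fil_base_eq_top (R : Type*) [CommRing R] [Algebra K R]
    (b : Module.Basis (Fin n) K V) : (extSuperBase K V R).fil n = ⊤ := by
  rw [eq_top_iff, ← (b.ExteriorAlgebra.baseChange R).span_eq, Submodule.span_le]
  rintro _ ⟨s, rfl⟩
  rw [Module.Basis.baseChange_apply]
  refine (extSuperBase K V R).mono ?_ (Superfiltration.mem_fil_ofGrading _
    (Submodule.tmul_mem_baseChange_of_mem 1 (basis_mem_exteriorPower b s)))
  have := s.card_le_univ
  simpa using this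

theorem mem_range_algebraMap_of_fil_zero {x : ExteriorAlgebra K V}
    (hx : x ∈ (extSuper K V).fil 0) :
    x = algebraMap K _ (ExteriorAlgebra.algebraMapInv x) := by
  have := Superfiltration.mem_of_fil_zero _ hx
  rw [ExteriorAlgebra.exteriorPower, pow_zero] at this
  obtain ⟨c, hc⟩ := Submodule.mem_one.1 this
  rw [← hc, ExteriorAlgebra.algebraMap_leftInverse]

/-- The homogeneous parts of `R ⊗ ΛV` are generated by elements `1 ⊗ e`. -/
theorem baseChange_le {R : Type*} [CommRing R] [Algebra K R] {p : Submodule K (ExteriorAlgebra K V)}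
    {P : Submodule R (R ⊗[K] ExteriorAlgebra K V)} (h : ∀ e ∈ p, (1 : R) ⊗ₜ[K] e ∈ P) :
    p.baseChange R ≤ P := by
  rw [Submodule.baseChange_eq_span, Submodule.span_le]
  rintro _ ⟨e, he, rfl⟩
  exact h e he

section Endo

variable {R : Type*} [CommRing R] [Algebra K R]

theorem mem_endo_par_of_tmul {f : Module.End R (R ⊗[K] ExteriorAlgebra K V)} {i : ZMod 2}
    (h : ∀ m : ℕ, ∀ e ∈ ⋀[K]^m V, f (1 ⊗ₜ e) ∈ (extSuperBase K V R).par (i + m)) :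
    f ∈ (extSuperBase K V R).endo.par i := by
  intro j x hx
  refine Superfiltration.mem_of_mem_supported _
    (P := ((extSuperBase K V R).par (i + j)).comap f) (fun m hm => ?_) hx
  obtain rfl : (m : ZMod 2) = j := hm
  exact baseChange_le fun e he => h m e he

theorem mem_endo_fil_of_tmul {f : Module.End R (R ⊗[K] ExteriorAlgebra K V)} {p : ℤ}
    (h : ∀ m : ℕ, ∀ e ∈ ⋀[K]^m V, f (1 ⊗ₜ e) ∈ (extSuperBase K V R).fil (m + p)) :
    f ∈ (extSuperBase K V R).endo.fil p := by
  intro q x hx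
  refine Superfiltration.mem_of_mem_supported _
    (P := ((extSuperBase K V R).fil (q + p)).comap f) (fun m hm => ?_) hx
  have hm' : (m : ℤ) ≤ q := hm
  exact baseChange_le fun e he => (extSuperBase K V R).mono (by omega) (h m e he)

theorem tmul_mem_par (r : R) {m : ℕ} {e : ExteriorAlgebra K V} (he : e ∈ ⋀[K]^m V) :
    r ⊗ₜ[K] e ∈ (extSuperBase K V R).par m :=
  Superfiltration.mem_par_ofGrading _ (Submodule.tmul_mem_baseChange_of_mem r he)

theorem tmul_mem_fil (r : R) {m : ℕ} {e : ExteriorAlgebra K V} (he : e ∈ ⋀[K]^m V) :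
    r ⊗ₜ[K] e ∈ (extSuperBase K V R).fil m :=
  Superfiltration.mem_fil_ofGrading _ (Submodule.tmul_mem_baseChange_of_mem r he)

theorem one_tmul_one_mem_par : (1 : R) ⊗ₜ[K] (1 : ExteriorAlgebra K V) ∈
    (extSuperBase K V R).par 0 := by
  have := tmul_mem_par (1 : R) (one_mem_exteriorPower (K := K) (V := V))
  simpa using this

theorem one_tmul_one_mem_fil : (1 : R) ⊗ₜ[K] (1 : ExteriorAlgebra K V) ∈
    (extSuperBase K V R).fil 0 := by
  have := tmul_mem_fil (1 : R) (one_mem_exteriorPower (K := K) (V := V))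
  simpa using this

theorem wedge_tmul (a : ExteriorAlgebra K V) (r : R) (e : ExteriorAlgebra K V) :
    wedge R a (r ⊗ₜ e) = r ⊗ₜ (a * e) := rfl

theorem contract_tmul (φ : Module.Dual K V) (r : R) (e : ExteriorAlgebra K V) :
    contract R φ (r ⊗ₜ e) =
      r ⊗ₜ (CliffordAlgebra.contractLeft (Q := (0 : QuadraticForm K V)) φ e) := rfl

/-- Endomorphisms of `R ⊗ ΛV` are determined by their values on the elements `1 ⊗ e`. -/
theorem end_ext {f g : Module.End R (R ⊗[K] ExteriorAlgebra K V)}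
    (h : ∀ e, f (1 ⊗ₜ e) = g (1 ⊗ₜ e)) : f = g := by
  apply TensorProduct.AlgebraTensorModule.ext
  intro r e
  have : r ⊗ₜ[K] e = r • ((1 : R) ⊗ₜ[K] e) := by rw [TensorProduct.smul_tmul', smul_eq_mul, mul_one]
  rw [this, map_smul, map_smul, h]

theorem wedge_one : wedge R (1 : ExteriorAlgebra K V) = 1 :=
  end_ext fun e => by rw [wedge_tmul, one_mul]; rfl

theorem wedge_mul (a a' : ExteriorAlgebra K V) : wedge R (a * a') = wedge R a * wedge R a' :=
  end_ext fun e => by rw [wedge_tmul, mul_assoc]; rfl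

/-- The map `a ↦ a ∧ •`. -/
def wedgeMap (R : Type*) [CommRing R] [Algebra K R] :
    ExteriorAlgebra K V →ₗ[K] Module.End R (R ⊗[K] ExteriorAlgebra K V) where
  toFun := wedge R
  map_add' a a' := end_ext fun e => by
    rw [LinearMap.add_apply, wedge_tmul, wedge_tmul, wedge_tmul, add_mul, TensorProduct.tmul_add]
  map_smul' c a := end_ext fun e => by
    rw [RingHom.id_apply, LinearMap.smul_apply, wedge_tmul, wedge_tmul, smul_mul_assoc,
      TensorProduct.tmul_smul]

theorem wedge_mem {m : ℕ} {a : ExteriorAlgebra K V} (ha : a ∈ ⋀[K]^m V) :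
    wedge R a ∈ (extSuperBase K V R).endo.par m ∧
    wedge R a ∈ (extSuperBase K V R).endo.fil m := by
  constructor
  · refine mem_endo_par_of_tmul fun l e he => ?_
    rw [wedge_tmul, ← Nat.cast_add]
    exact tmul_mem_par _ (mul_mem_exteriorPower ha he)
  · refine mem_endo_fil_of_tmul fun l e he => ?_
    rw [wedge_tmul, add_comm, ← Nat.cast_add]
    exact tmul_mem_fil _ (mul_mem_exteriorPower ha he)

theorem contract_mem_fil (φ : Module.Dual K V) :
    contract R φ ∈ (extSuperBase K V R).endo.fil (-1) := by
  refine mem_endo_fil_of_tmul fun l e he => ?_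
  rw [contract_tmul]
  cases l with
  | zero =>
    rw [(contractLeft_mem φ he).1 rfl, TensorProduct.tmul_zero]
    exact zero_mem _
  | succ l =>
    rw [Nat.cast_succ, add_neg_cancel_right]
    exact tmul_mem_fil _ ((contractLeft_mem φ he).2 l rfl)

theorem contract_one_tmul_one (φ : Module.Dual K V) :
    contract R φ (1 ⊗ₜ[K] (1 : ExteriorAlgebra K V)) = 0 := by
  rw [contract_tmul, (contractLeft_mem φ one_mem_exteriorPower).1 rfl, TensorProduct.tmul_zero]

end Endo

/-! ### Reduction modulo the augmentation ideal -/

section Reduction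

variable {R : Type*} [CommRing R] [Algebra K R] (ε : R →ₐ[K] K)

/-- The reduction `R ⊗ ΛV → ΛV` along an augmentation of `R`. -/
def redMod : R ⊗[K] ExteriorAlgebra K V →ₗ[K] ExteriorAlgebra K V :=
  (TensorProduct.lid K (ExteriorAlgebra K V)).toLinearMap ∘ₗ
    ε.toLinearMap.rTensor (ExteriorAlgebra K V)

/-- The map `f ↦ f(1)`, reduced along an augmentation of `R`. -/
def augReduction : Module.End R (R ⊗[K] ExteriorAlgebra K V) →ₗ[K] ExteriorAlgebra K V where
  toFun f := redMod ε (f (1 ⊗ₜ[K] 1))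
  map_add' f g := by simp
  map_smul' c f := by simp

theorem augReduction_apply (f : Module.End R (R ⊗[K] ExteriorAlgebra K V)) :
    augReduction ε f = redMod ε (f (1 ⊗ₜ[K] 1)) := rfl

theorem redMod_tmul (r : R) (e : ExteriorAlgebra K V) :
    redMod ε (r ⊗ₜ e) = ε r • e := rfl

theorem redMod_smul (r : R) (x : R ⊗[K] ExteriorAlgebra K V) :
    redMod ε (r • x) = ε r • redMod ε x := by
  induction x using TensorProduct.induction_on with
  | zero => simp
  | tmul s e => rw [TensorProduct.smul_tmul', redMod_tmul, redMod_tmul, smul_eq_mul, map_mul,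
      mul_smul]
  | add x y hx hy => rw [smul_add, map_add, hx, hy, map_add, smul_add]

theorem redMod_wedge (a : ExteriorAlgebra K V) (x : R ⊗[K] ExteriorAlgebra K V) :
    redMod ε (wedge _ a x) = a * redMod ε x := by
  induction x using TensorProduct.induction_on with
  | zero => simp
  | tmul s e => rw [wedge_tmul, redMod_tmul, redMod_tmul, mul_smul_comm]
  | add x y hx hy => rw [map_add, map_add, hx, hy, map_add, mul_add]

theorem redMod_contract (φ : Module.Dual K V) (x : R ⊗[K] ExteriorAlgebra K V) :
    redMod ε (contract _ φ x) =
      CliffordAlgebra.contractLeft (Q := (0 : QuadraticForm K V)) φ (redMod ε x) := by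
  induction x using TensorProduct.induction_on with
  | zero => simp
  | tmul s e =>
    rw [contract_tmul, redMod_tmul, redMod_tmul]
    exact (map_smul _ _ _).symm
  | add x y hx hy =>
    rw [map_add, map_add, hx, hy, map_add]
    exact (map_add _ _ _).symm

theorem augReduction_smul (r : R) (f : Module.End R (R ⊗[K] ExteriorAlgebra K V)) :
    augReduction ε (r • f) = ε r • augReduction ε f :=
  redMod_smul ε r _

theorem augReduction_wedge (a : ExteriorAlgebra K V) :
    augReduction ε (wedge R a) = a := by
  rw [augReduction_apply, redMod_wedge, redMod_tmul, map_one, one_smul, mul_one]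

theorem augReduction_one :
    augReduction ε (1 : Module.End R (R ⊗[K] ExteriorAlgebra K V)) = 1 := by
  rw [← wedge_one, augReduction_wedge]

theorem redMod_mem {S : Submodule K (ExteriorAlgebra K V)} {s : Set ℕ}
    (h : ∀ m ∈ s, ⋀[K]^m V ≤ S) {x : R ⊗[K] ExteriorAlgebra K V}
    (hx : x ∈ Superfiltration.supported (fun m : ℕ => (⋀[K]^m V).baseChange R) s) :
    redMod ε x ∈ S := by
  classical
  rw [← DirectSum.sum_support_decompose (fun m : ℕ => (⋀[K]^m V).baseChange R) x, map_sum]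
  refine sum_mem fun m _ => ?_
  by_cases hm : m ∈ s
  · have hy : ((DirectSum.decompose (fun m : ℕ => (⋀[K]^m V).baseChange R) x m) :
        R ⊗[K] ExteriorAlgebra K V) ∈ (⋀[K]^m V).baseChange R := SetLike.coe_mem _
    generalize ((DirectSum.decompose (fun m : ℕ => (⋀[K]^m V).baseChange R) x m) :
        R ⊗[K] ExteriorAlgebra K V) = y at hy
    rw [Submodule.baseChange_eq_span] at hy
    induction hy using Submodule.span_induction with
    | mem y hy =>
      obtain ⟨e, he, rfl⟩ := hy
      change redMod ε (1 ⊗ₜ e) ∈ S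
      rw [redMod_tmul]
      exact S.smul_mem _ (h m hm he)
    | zero => rw [map_zero]; exact zero_mem _
    | add y z _ _ hy hz => rw [map_add]; exact add_mem hy hz
    | smul c y _ hy => rw [redMod_smul]; exact S.smul_mem _ hy
  · rw [hx m hm, map_zero]; exact zero_mem _

/-- The superfiltration of `End_R(R ⊗ ΛV)`, over `K`. -/
def endSuper (K : Type u) [CommRing K] (V : Type v) [AddCommGroup V] [Module K V]
    (R : Type*) [CommRing R] [Algebra K R] :
    Superfiltration K (Module.End R (R ⊗[K] ExteriorAlgebra K V)) :=
  (extSuperBase K V R).endo.restrictScalars K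

theorem augReduction_isSuperfilteredMap :
    IsSuperfilteredMap (endSuper K V R) (extSuper K V) 0 (augReduction ε) where
  par i f hf := by
    rw [Int.cast_zero, augReduction_apply]
    exact redMod_mem ε (fun m hm e he => hm ▸ ext_par he) (hf 0 _ one_tmul_one_mem_par)
  fil p f hf := by
    rw [add_zero, augReduction_apply]
    have := hf 0 _ one_tmul_one_mem_fil
    rw [zero_add] at this
    exact redMod_mem ε (fun m hm e he => (extSuper K V).mono hm (ext_fil he)) this

theorem wedgeMap_isSuperfilteredMap :
    IsSuperfilteredMap (extSuper K V) (endSuper K V R) 0 (wedgeMap R) :=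
  Superfiltration.isSuperfilteredMap_ofGrading _ fun m x hx => by
    rw [Int.cast_zero, add_zero, add_zero]
    exact wedge_mem hx

end Reduction

/-! ### Koszul matrix factorisations and transfer data -/

section Koszul

variable {R : Type*} [CommRing R] [Algebra K R] (b : Module.Basis (Fin n) K V) {x y : Fin n → R}
  {w : R}

/-- The Koszul matrix factorisation of `∑ x_i y_i`. -/
def koszulMF (hw : ∑ i, x i * y i = w) : FilteredMF R w (R ⊗[K] ExteriorAlgebra K V) where
  free :=
    haveI : Module.Free K (ExteriorAlgebra K V) := Module.Free.of_basis b.ExteriorAlgebra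
    inferInstance
  finite :=
    haveI : Module.Finite K (ExteriorAlgebra K V) := Module.Finite.of_basis b.ExteriorAlgebra
    inferInstance
  S := extSuperBase K V R
  d := koszulOp b x y
  d_par := koszulOp_mem b _ y _ (fun x => (wedge_ι_mem x).1) (fun φ => (contract_mem φ).1)
  d_fil := koszulOp_mem b _ y _ (fun x => (wedge_ι_mem x).2) (fun φ => (contract_mem φ).2)
  d_sq := by rw [koszulOp_sq, hw]

variable (hw : ∑ i, x i * y i = w) (ε : R →ₐ[K] K)

theorem koszulMF_d : (koszulMF b hw).d = -(∑ i, (x i • wedge R (ExteriorAlgebra.ι K (b i)) +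
    y i • contract R (b.coord i))) := rfl

theorem augReduction_d_mul (hx : ∀ i, ε (x i) = 0) (hy : ∀ i, ε (y i) = 0)
    (f : Module.End R (R ⊗[K] ExteriorAlgebra K V)) :
    augReduction ε ((koszulMF b hw).d * f) = 0 := by
  rw [koszulMF_d, show ∀ D : Module.End R (R ⊗[K] ExteriorAlgebra K V), -D * f = -(D * f) from
    fun D => neg_mul D f, Finset.sum_mul, map_neg, map_sum, Finset.sum_eq_zero, neg_zero]
  intro i _
  rw [add_mul, smul_mul_assoc, smul_mul_assoc, map_add, augReduction_smul, augReduction_smul,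
    hx, hy, zero_smul, zero_smul, add_zero]

theorem augReduction_mul_d (hx : ∀ i, ε (x i) = 0) (hy : ∀ i, ε (y i) = 0)
    (f : Module.End R (R ⊗[K] ExteriorAlgebra K V)) :
    augReduction ε (f * (koszulMF b hw).d) = 0 := by
  rw [koszulMF_d, show ∀ D : Module.End R (R ⊗[K] ExteriorAlgebra K V), f * -D = -(f * D) from
    fun D => mul_neg f D, Finset.mul_sum, map_neg, map_sum, Finset.sum_eq_zero, neg_zero]
  intro i _
  rw [mul_add, mul_smul_comm, mul_smul_comm, map_add, augReduction_smul, augReduction_smul,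
    hx, hy, zero_smul, zero_smul, add_zero]

theorem augReduction_μOne (hx : ∀ i, ε (x i) = 0) (hy : ∀ i, ε (y i) = 0)
    (f : Module.End R (R ⊗[K] ExteriorAlgebra K V)) :
    augReduction ε ((koszulMF b hw).μOne f) = 0 := by
  rw [FilteredMF.μOne_apply, map_sub, augReduction_d_mul b hw ε hx hy,
    augReduction_mul_d b hw ε hx hy, sub_zero]

theorem endSuper_sgn (f : Module.End R (R ⊗[K] ExteriorAlgebra K V)) :
    (endSuper K V R).sgn f = (koszulMF b hw).S.endo.sgn f :=
  (koszulMF b hw).endSuperfiltration_sgn K f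

theorem μOne_isSuperfilteredMap :
    IsSuperfilteredMap (endSuper K V R) (endSuper K V R) 1
      ((koszulMF b hw).μOne.restrictScalars K) :=
  ⟨(koszulMF b hw).isSuperfilteredMap_μOne.par, (koszulMF b hw).isSuperfilteredMap_μOne.fil⟩

/-- The properties of transfer data `(ι, η)` for the endomorphism algebra of a Koszul matrix
factorisation. -/
structure IsTransfer (incl : ExteriorAlgebra K V →ₗ[K] Module.End R (R ⊗[K] ExteriorAlgebra K V))
    (htpy : Module.End R (R ⊗[K] ExteriorAlgebra K V) →ₗ[K]
      Module.End R (R ⊗[K] ExteriorAlgebra K V)) : Prop where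
  incl_cocycle : ∀ a, (koszulMF b hw).differential (incl a) = 0
  incl_one : incl 1 = 1
  incl_super : IsSuperfilteredMap (extSuper K V) (endSuper K V R) 0 incl
  incl_lead : ∀ p : ℕ, ∀ a ∈ ⋀[K]^p V, incl a - wedge R a ∈ (endSuper K V R).fil ((p : ℤ) - 1)
  reduction_incl : ∀ a, augReduction ε (incl a) = a
  htpy_super : IsSuperfilteredMap (endSuper K V R) (endSuper K V R) (-1) htpy
  homotopy : ∀ f, (koszulMF b hw).μOne (htpy f) + htpy ((koszulMF b hw).μOne f) =
    incl (augReduction ε f) - f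
  htpy_incl : ∀ a, htpy (incl a) = 0
  reduction_htpy : ∀ f, augReduction ε (htpy f) = 0
  htpy_htpy : ∀ f, htpy (htpy f) = 0

namespace IsTransfer

variable {b hw ε} {incl : ExteriorAlgebra K V →ₗ[K] Module.End R (R ⊗[K] ExteriorAlgebra K V)}
  {htpy : Module.End R (R ⊗[K] ExteriorAlgebra K V) →ₗ[K]
      Module.End R (R ⊗[K] ExteriorAlgebra K V)}
  (T : IsTransfer b hw ε incl htpy)

include T

theorem μOne_incl (a : ExteriorAlgebra K V) : (koszulMF b hw).μOne (incl a) = 0 := by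
  rw [← (koszulMF b hw).S.endo.sgn_sgn (incl a), FilteredMF.μOne_sgn, ← endSuper_sgn,
    T.incl_super.map_sgn, Int.cast_zero, uzpow_zero, one_smul]
  exact T.incl_cocycle _

/-- Transfer data as a contraction. -/
def contraction (hx : ∀ i, ε (x i) = 0) (hy : ∀ i, ε (y i) = 0) :
    Contraction (extSuper K V) (endSuper K V R) 1
      (1 : Module.End R (R ⊗[K] ExteriorAlgebra K V)) where
  m1 := (koszulMF b hw).μOne.restrictScalars K
  mul := (koszulMF b hw).μTwo.restrictScalars₁₂ K K
  incl := incl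
  proj := augReduction ε
  htpy := htpy
  mul_par i j f hf g hg := (koszulMF b hw).μTwo_par hf hg
  mul_fil i j f hf g hg := (koszulMF b hw).μTwo_fil hf hg
  incl_super := T.incl_super
  proj_super := augReduction_isSuperfilteredMap ε
  htpy_super := T.htpy_super
  leibniz f g := by rw [endSuper_sgn b hw]; exact (koszulMF b hw).μOne_μTwo f g
  assoc f g h := by rw [endSuper_sgn b hw]; exact (koszulMF b hw).μTwo_assoc f g h
  mul_one f := by
    change f * (koszulMF b hw).S.endo.sgn 1 = f
    rw [Superfiltration.endo_sgn_one, _root_.mul_one]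
  one_mul f := by
    rw [endSuper_sgn b hw]
    exact _root_.one_mul _
  m1_incl := T.μOne_incl
  proj_m1 := augReduction_μOne b hw ε hx hy
  homotopy := T.homotopy
  htpy_incl := T.htpy_incl
  proj_htpy := T.reduction_htpy
  htpy_htpy := T.htpy_htpy
  proj_incl := T.reduction_incl
  incl_one := T.incl_one
  one_par := by simpa using ext_par (one_mem_exteriorPower (K := K) (V := V))
  one_fil := by simpa using ext_fil (one_mem_exteriorPower (K := K) (V := V))

/-- The product of `ι(a₂)` and `ι(a₁)` to leading order. -/
theorem incl_mul_incl_sub_mem {p q : ℕ} {a₁ a₂ : ExteriorAlgebra K V} (h₁ : a₁ ∈ ⋀[K]^p V)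
    (h₂ : a₂ ∈ ⋀[K]^q V) :
    (koszulMF b hw).μTwo (incl a₂) (incl a₁) -
      ((-1 : ℤˣ) ^ p) • wedge R (a₂ * a₁) ∈ (endSuper K V R).fil ((p : ℤ) + q - 1) := by
  have h1 : (koszulMF b hw).S.endo.sgn (incl a₁) = ((-1 : ℤˣ) ^ p) • incl a₁ := by
    have := T.incl_super.par _ _ (ext_par h₁)
    rw [Int.cast_zero, add_zero] at this
    rw [(koszulMF b hw).S.endo.sgn_of_mem this, uzpow_natCast]
  rw [FilteredMF.μTwo_apply, h1, Units.smul_def, Units.smul_def, mul_smul_comm]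
  refine (smul_sub (((-1 : ℤˣ) ^ p : ℤˣ) : ℤ) (incl a₂ * incl a₁) (wedge R (a₂ * a₁))) ▸ ?_
  refine zsmul_mem ?_ _
  rw [wedge_mul]
  have e : incl a₂ * incl a₁ - wedge R a₂ * wedge R a₁ =
      (incl a₂ - wedge R a₂) * incl a₁ + wedge R a₂ * (incl a₁ - wedge R a₁) := by
    rw [sub_mul, mul_sub]; abel
  rw [e]
  have i1 := (extSuperBase K V R).mul_mem_endo_fil (T.incl_lead q a₂ h₂)
    (T.incl_super.fil _ _ (ext_fil h₁))
  have i2 := (extSuperBase K V R).mul_mem_endo_fil (wedge_mem h₂).2 (T.incl_lead p a₁ h₁)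
  refine add_mem ?_ ?_
  · exact (extSuperBase K V R).endo.mono (by omega) i1
  · exact (extSuperBase K V R).endo.mono (by omega) i2

/-- The homotopy vanishes to leading order on the operators `a ∧ •`. -/
theorem htpy_wedge_mem {p : ℕ} {a : ExteriorAlgebra K V} (ha : a ∈ ⋀[K]^p V) :
    htpy (wedge R a) ∈ (endSuper K V R).fil ((p : ℤ) - 2) := by
  have h1 := T.htpy_super.fil _ _ (T.incl_lead p a ha)
  rw [map_sub, T.htpy_incl, zero_sub, neg_mem_iff] at h1
  convert h1 using 2
  ring

theorem htpy_incl_mul_incl_mem {p q : ℕ} {a₁ a₂ : ExteriorAlgebra K V} (h₁ : a₁ ∈ ⋀[K]^p V)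
    (h₂ : a₂ ∈ ⋀[K]^q V) :
    htpy ((koszulMF b hw).μTwo (incl a₂) (incl a₁)) ∈
      (endSuper K V R).fil ((q : ℤ) + p - 2) := by
  have h := T.htpy_super.fil _ _ (T.incl_mul_incl_sub_mem h₁ h₂)
  rw [map_sub, map_units_smul] at h
  have h2 := T.htpy_wedge_mem (mul_mem_exteriorPower h₂ h₁)
  rw [← sub_add_cancel (htpy _) (((-1 : ℤˣ) ^ p) • htpy (wedge R (a₂ * a₁)))]
  refine add_mem ?_ ?_
  · convert! h using 2
    ring
  · rw [Units.smul_def]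
    refine zsmul_mem ?_ _
    rwa [Nat.cast_add] at h2

theorem leading_two (hx : ∀ i, ε (x i) = 0) (hy : ∀ i, ε (y i) = 0) (p q : ℕ)
    (a₁ : ExteriorAlgebra K V) (h₁ : a₁ ∈ ⋀[K]^p V) (a₂ : ExteriorAlgebra K V)
    (h₂ : a₂ ∈ ⋀[K]^q V) :
    (T.contraction hx hy).minOps 2 ![a₁, a₂] - ((-1 : ℤˣ) ^ p) • (a₂ * a₁) ∈
      (extSuper K V).fil ((p : ℤ) + q - 1) := by
  rw [Contraction.minOps_two]
  have h := (augReduction_isSuperfilteredMap ε).fil _ _ (T.incl_mul_incl_sub_mem h₁ h₂)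
  rw [map_sub, map_units_smul, augReduction_wedge, add_zero] at h
  exact h

theorem leading_higher (hx : ∀ i, ε (x i) = 0) (hy : ∀ i, ε (y i) = 0) (k : ℕ) (hk : 3 ≤ k)
    (p : Fin k → ℕ) (a : Fin k → ExteriorAlgebra K V) (ha : ∀ i, a i ∈ ⋀[K]^(p i) V) :
    (T.contraction hx hy).minOps k a ∈ (extSuper K V).fil ((∑ i, ((p i : ℤ) - 1)) + 2 - 1) := by
  set p' : ℕ → ℕ := fun i => if h : i < k then p ⟨i, h⟩ else 0 with hp'
  have ha' : ∀ i, extendZero a i ∈ ⋀[K]^(p' i) V := by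
    intro i
    by_cases hi : i < k
    · rw [extendZero_of_lt a hi, hp']
      simp only [dif_pos hi]
      exact ha _
    · rw [extendZero, dif_neg hi]; exact zero_mem _
  have h := ((T.contraction hx hy).inclOp_lead (k := k) (by omega)
    (p := fun i => (p' i : ℤ)) (a := extendZero a) (fun i => ext_fil (ha' i))
    (fun i => T.htpy_incl_mul_incl_mem (ha' i) (ha' (i + 1)))).2 hk
  have h2 := (augReduction_isSuperfilteredMap ε).fil _ _ h
  rw [add_zero, ← Fin.sum_univ_eq_sum_range (fun i => (p' i : ℤ) - 1)] at h2
  simp only [hp', Fin.is_lt, dite_true] at h2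
  rw [add_sub_assoc]
  exact h2

end IsTransfer

end Koszul

/-! ### The minimal model as a deformation of the exterior algebra -/

/-- The evaluation of formal functions at the origin. -/
def augmentation (K : Type u) [CommRing K] (n : ℕ) : FormalFunctions K n →ₐ[K] K :=
  { MvPowerSeries.constantCoeff with
    commutes' := fun r => by
      change MvPowerSeries.constantCoeff (algebraMap K (FormalFunctions K n) r) = r
      rw [MvPowerSeries.algebraMap_apply]
      simp }

theorem augmentation_X (i : Fin n) :
    augmentation K n (MvPowerSeries.X i : FormalFunctions K n) = 0 :=
  MvPowerSeries.constantCoeff_X i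

theorem augmentation_of_mem {r : FormalFunctions K n} (hr : r ∈ maxIdeal K n) :
    augmentation K n r = 0 := hr

namespace TransferData

variable {b : Module.Basis (Fin n) K V} {ŵ : Fin n → FormalFunctions K n}
  {w : FormalFunctions K n} {hw : ∑ i, MvPowerSeries.X i * ŵ i = w}

theorem isTransfer (T : TransferData b ŵ hw) :
    IsTransfer b hw (augmentation K n) T.incl T.htpy where
  incl_cocycle := T.incl_cocycle
  incl_one := T.incl_one
  incl_super :=
    { par := fun i a ha => by
        rw [Int.cast_zero, add_zero]; exact T.incl_par i a ha
      fil := fun p a ha => by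
        rw [add_zero]; exact T.incl_fil p a ha }
  incl_lead := T.incl_lead
  reduction_incl := T.reduction_incl
  htpy_super :=
    { par := fun i f hf => by
        have := T.htpy_par i f hf
        rw [sub_eq_add_neg, ← Int.cast_one, ← Int.cast_neg] at this
        exact this
      fil := fun p f hf => T.htpy_fil p f hf }
  homotopy := T.homotopy
  htpy_incl := T.htpy_incl
  reduction_htpy := T.reduction_htpy
  htpy_htpy := T.htpy_htpy

/-- Transfer data from a pair of linear maps with the required properties. -/
def ofIsTransfer {incl : ExteriorAlgebra K V →ₗ[K] EndAlg K V n}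
    {htpy : EndAlg K V n →ₗ[K] EndAlg K V n}
    (T : IsTransfer b hw (augmentation K n) incl htpy) : TransferData b ŵ hw where
  incl := incl
  htpy := htpy
  incl_cocycle := T.incl_cocycle
  incl_one := T.incl_one
  incl_par i a ha := by
    have := T.incl_super.par i a ha
    rw [Int.cast_zero, add_zero] at this
    exact this
  incl_fil p a ha := by
    have := T.incl_super.fil p a ha
    rw [add_zero] at this
    exact this
  incl_lead := T.incl_lead
  reduction_incl := T.reduction_incl
  htpy_par i f hf := by
    have := T.htpy_super.par i f hf
    rw [Int.cast_neg, Int.cast_one, ← sub_eq_add_neg] at this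
    exact this
  htpy_fil p f hf := T.htpy_super.fil p f hf
  homotopy := T.homotopy
  htpy_incl := T.htpy_incl
  reduction_htpy := T.reduction_htpy
  htpy_htpy := T.htpy_htpy

variable (T : TransferData b ŵ hw)

/-- Transfer data as a contraction. -/
def contraction (hŵ : ∀ i, ŵ i ∈ maxIdeal K n) :
    Contraction (extSuper K V) (endSuper K V (FormalFunctions K n)) 1 (1 : EndAlg K V n) :=
  T.isTransfer.contraction augmentation_X fun i => augmentation_of_mem (hŵ i)

/-- The minimal model `𝓑₀^min`. -/
def deformation (hŵ : ∀ i, ŵ i ∈ maxIdeal K n) : Deformation K V where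
  μ := (T.contraction hŵ).minOps
  isAInf := (T.contraction hŵ).isSuperfilteredAInf_minOps
  minimal := (T.contraction hŵ).minOps_one
  leading_two := T.isTransfer.leading_two _ _
  leading_higher := T.isTransfer.leading_higher _ _

theorem deformation_app (hŵ : ∀ i, ŵ i ∈ maxIdeal K n) (k : ℕ)
    (a : ℕ → ExteriorAlgebra K V) : (T.deformation hŵ).μ.app k a = T.minOp k a :=
  (T.contraction hŵ).minOps_app k a

theorem inclOps_app (hŵ : ∀ i, ŵ i ∈ maxIdeal K n) (k : ℕ)
    (a : ℕ → ExteriorAlgebra K V) : (T.contraction hŵ).inclOps.app k a = T.inclOp k a :=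
  (T.contraction hŵ).inclOps_app k a

theorem isSuperfilteredAInfHom (hŵ : ∀ i, ŵ i ∈ maxIdeal K n) :
    IsSuperfilteredAInfHom (extSuper K V) (endS b ŵ hw) 1 (1 : EndAlg K V n)
      (T.deformation hŵ).μ (endμ b ŵ hw) (T.contraction hŵ).inclOps :=
  (T.contraction hŵ).isSuperfilteredAInfHom_inclOps _ (fun _ => rfl) (fun _ _ => rfl)
    ((stab b ŵ hw).endOps_eq_zero K)

end TransferData

end Exterior

/-! ### Contracting Koszul differentials -/

section KoszulRing

/-- Operators `A_i`, `C_i`, `X_i`, `∂_i`, `P_i` in a ring, subject to the relations satisfied on a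
Koszul complex by exterior multiplications, contractions, coordinates, division by coordinates, and
restrictions to coordinate hyperplanes. -/
structure KoszulRelations {n : ℕ} {𝒪 : Type*} [Ring 𝒪] (A C X D P : Fin n → 𝒪) : Prop where
  A_sq : ∀ i, A i * A i = 0
  A_anticomm : ∀ i j, A i * A j + A j * A i = 0
  A_C_self : ∀ i, A i * C i + C i * A i = 1
  A_C : ∀ i j, i ≠ j → A i * C j + C j * A i = 0
  X_A : ∀ i j, Commute (X i) (A j)
  X_C : ∀ i j, Commute (X i) (C j)
  D_A : ∀ i j, Commute (D i) (A j)
  P_A : ∀ i j, Commute (P i) (A j)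
  P_C : ∀ i j, Commute (P i) (C j)
  X_D : ∀ i, X i * D i = 1 - P i
  D_X : ∀ i, D i * X i = 1
  D_X_of_ne : ∀ i j, i ≠ j → Commute (D i) (X j)
  P_X_of_ne : ∀ i j, i ≠ j → Commute (P i) (X j)
  P_sq : ∀ i, P i * P i = P i
  P_comm : ∀ i j, Commute (P i) (P j)

namespace KoszulRelations

variable {n : ℕ} {𝒪 : Type*} [Ring 𝒪] {A C X D P : Fin n → 𝒪} (h : KoszulRelations A C X D P)

include h

/-- Dividing by the `i`-th coordinate and contracting homotopes `1` to the idempotent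
`P_i A_i C_i`: the summands `X_j A_j` with `j ≠ i` anticommute with `D_i C_i`. -/
theorem homotopy_single (i : Fin n) :
    (∑ j, X j * A j) * (D i * C i) + (D i * C i) * ∑ j, X j * A j = 1 - P i * A i * C i := by
  rw [Finset.sum_mul, Finset.mul_sum, ← Finset.sum_add_distrib, Finset.sum_eq_single i]
  · have e1 : X i * A i * (D i * C i) = X i * D i * (A i * C i) := by
      rw [mul_assoc, ← mul_assoc (A i), ← (h.D_A i i).eq]; noncomm_ring
    have e2 : D i * C i * (X i * A i) = D i * X i * (C i * A i) := by
      rw [mul_assoc, ← mul_assoc (C i), ← (h.X_C i i).eq]; noncomm_ring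
    rw [e1, e2, h.X_D, h.D_X, sub_mul, one_mul, one_mul, sub_add_eq_add_sub, h.A_C_self, mul_assoc]
  · intro j _ hj
    have e1 : X j * A j * (D i * C i) = D i * X j * (A j * C i) := by
      rw [mul_assoc, ← mul_assoc (A j), ← (h.D_A i j).eq, (h.D_X_of_ne i j hj.symm).eq]
      noncomm_ring
    have e2 : D i * C i * (X j * A j) = D i * X j * (C i * A j) := by
      rw [mul_assoc, ← mul_assoc (C i), ← (h.X_C j i).eq]; noncomm_ring
    rw [e1, e2, ← mul_add, h.A_C j i hj, mul_zero]
  · exact fun hi => absurd (Finset.mem_univ i) hi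

theorem A_mul_e_of_ne {i j : Fin n} (hij : i ≠ j) :
    A j * (P i * A i * C i) = P i * A i * C i * A j := by
  have h1 : A j * A i = -(A i * A j) := eq_neg_of_add_eq_zero_left (h.A_anticomm j i)
  have h2 : A j * C i = -(C i * A j) := eq_neg_of_add_eq_zero_left (h.A_C j i hij.symm)
  rw [← mul_assoc, ← mul_assoc, ← (h.P_A i j).eq, mul_assoc (P i), h1, mul_assoc, neg_mul, mul_assoc,
    h2]
  noncomm_ring

theorem A_mul_e (i : Fin n) : A i * (P i * A i * C i) = 0 := by
  rw [← mul_assoc, ← mul_assoc, ← (h.P_A i i).eq, mul_assoc (P i), h.A_sq, mul_zero, zero_mul]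

theorem P_mul_X (i : Fin n) : P i * X i = 0 := by
  have h1 : P i = 1 - X i * D i := by rw [h.X_D]; abel
  rw [h1, sub_mul, mul_assoc, h.D_X, one_mul, mul_one, sub_self]

/-- The idempotents `P_i A_i C_i` commute with the differential, so that the homotopies for
different `i` can be composed. -/
theorem e_comm (i : Fin n) : (∑ j, X j * A j) * (P i * A i * C i) =
    (P i * A i * C i) * ∑ j, X j * A j := by
  rw [Finset.sum_mul, Finset.mul_sum]
  refine Finset.sum_congr rfl fun j _ => ?_
  by_cases hij : i = j
  · subst hij
    rw [mul_assoc, h.A_mul_e, mul_zero, mul_assoc, ← mul_assoc (C i), ← (h.X_C i i).eq,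
      mul_assoc (P i), ← mul_assoc (A i), ← mul_assoc (A i), ← (h.X_A i i).eq, ← mul_assoc,
      ← mul_assoc, ← mul_assoc, h.P_mul_X]
    simp
  · have hc : Commute (X j) (P i * A i * C i) :=
      ((h.P_X_of_ne i j hij).symm.mul_right (h.X_A j i)).mul_right (h.X_C j i)
    rw [mul_assoc, h.A_mul_e_of_ne hij, ← mul_assoc, hc.eq, mul_assoc]

/-- The homotopies of the individual coordinates combine to a homotopy from the identity to the
product of the projections `P_i A_i C_i`. Both are built from elements of prescribed submonoids of
operators, expressed through the predicates `p` and `q`. -/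
theorem exists_homotopy {p q : 𝒪 → Prop} (p_one : p 1) (p_mul : ∀ a b, p a → p b → p (a * b))
    (q_zero : q 0) (q_add : ∀ a b, q a → q b → q (a + b)) (p_q : ∀ a b, p a → q b → q (a * b))
    (he : ∀ i, p (P i * A i * C i)) (hh : ∀ i, q (D i * C i)) (l : List (Fin n)) :
    p (l.map fun i => P i * A i * C i).prod ∧
    ∃ H, q H ∧ (∑ j, X j * A j) * H + H * (∑ j, X j * A j) =
      1 - (l.map fun i => P i * A i * C i).prod := by
  induction l with
  | nil => exact ⟨p_one, 0, q_zero, by simp⟩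
  | cons i l ih =>
    obtain ⟨hp, H, hH, hH'⟩ := ih
    rw [List.map_cons, List.prod_cons]
    refine ⟨p_mul _ _ (he i) hp, D i * C i + P i * A i * C i * H,
      q_add _ _ (hh i) (p_q _ _ (he i) hH), ?_⟩
    have h1 : (∑ j, X j * A j) * (D i * C i + P i * A i * C i * H) +
        (D i * C i + P i * A i * C i * H) * (∑ j, X j * A j) =
        ((∑ j, X j * A j) * (D i * C i) + (D i * C i) * ∑ j, X j * A j) +
        ((∑ j, X j * A j) * (P i * A i * C i) * H +
          (P i * A i * C i) * (H * ∑ j, X j * A j)) := by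
      noncomm_ring
    rw [h1, h.homotopy_single, h.e_comm, mul_assoc (P i * A i * C i) _ H, ← mul_add, hH']
    noncomm_ring

theorem A_mul_prod (l : List (Fin n)) (i : Fin n) (hi : i ∈ l) :
    A i * (l.map fun i => P i * A i * C i).prod = 0 := by
  induction l with
  | nil => simp at hi
  | cons j l ih =>
    rw [List.map_cons, List.prod_cons]
    by_cases hij : j = i
    · subst hij
      rw [← mul_assoc, h.A_mul_e, zero_mul]
    · rw [← mul_assoc, h.A_mul_e_of_ne hij, mul_assoc, ih (by
        rcases List.mem_cons.1 hi with rfl | h'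
        · exact absurd rfl hij
        · exact h'), mul_zero]

theorem P_mul_prod (l : List (Fin n)) (i : Fin n) (hi : i ∈ l) :
    P i * (l.map fun i => P i * A i * C i).prod = (l.map fun i => P i * A i * C i).prod := by
  induction l with
  | nil => simp at hi
  | cons j l ih =>
    rw [List.map_cons, List.prod_cons]
    by_cases hij : j = i
    · subst hij
      rw [← mul_assoc, ← mul_assoc, ← mul_assoc, h.P_sq]
    · have h1 : P i * (P j * A j * C j) = P j * A j * C j * P i := by
        rw [mul_assoc (P j), ← mul_assoc, (h.P_comm i j).eq, mul_assoc, ← mul_assoc (P i),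
          (h.P_A i j).eq, mul_assoc, (h.P_C i j).eq]
        noncomm_ring
      rw [← mul_assoc, h1, mul_assoc, ih (by
        rcases List.mem_cons.1 hi with rfl | h'
        · exact absurd rfl hij
        · exact h')]

end KoszulRelations

end KoszulRing

/-! ### Perturbation and side conditions -/

section Perturbation

variable {K E B : Type*} [CommRing K] [AddCommGroup E] [Module K E] [AddCommGroup B] [Module K B]

/-- A homotopy between `1` and `ιπ` can be replaced by one which satisfies the side conditions. -/
theorem exists_special_homotopy {S : Superfiltration K E} {S' : Superfiltration K B}
    {ι : E →ₗ[K] B} {π : B →ₗ[K] E} {D η : B →ₗ[K] B} (hι : IsSuperfilteredMap S S' 0 ι)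
    (hπ : IsSuperfilteredMap S' S 0 π) (hD : IsSuperfilteredMap S' S' 1 D)
    (hη : IsSuperfilteredMap S' S' (-1) η) (hDD : ∀ x, D (D x) = 0) (hDι : ∀ a, D (ι a) = 0)
    (hπD : ∀ x, π (D x) = 0) (hπι : ∀ a, π (ι a) = a)
    (h : ∀ x, D (η x) + η (D x) = ι (π x) - x) :
    ∃ η' : B →ₗ[K] B, IsSuperfilteredMap S' S' (-1) η' ∧
      (∀ x, D (η' x) + η' (D x) = ι (π x) - x) ∧ (∀ a, η' (ι a) = 0) ∧ (∀ x, π (η' x) = 0) ∧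
      ∀ x, η' (η' x) = 0 := by
  set Q : B →ₗ[K] B := LinearMap.id - ι ∘ₗ π with hQ
  have hQs : IsSuperfilteredMap S' S' 0 Q :=
    IsSuperfilteredMap.id.sub (by simpa using hι.comp hπ)
  have Qa : ∀ x, Q x = x - ι (π x) := fun x => rfl
  have QD : ∀ x, Q (D x) = D x := fun x => by rw [Qa, hπD, map_zero, sub_zero]
  have DQ : ∀ x, D (Q x) = D x := fun x => by rw [Qa, map_sub, hDι, sub_zero]
  have Qι : ∀ a, Q (ι a) = 0 := fun a => by rw [Qa, hπι, sub_self]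
  have πQ : ∀ x, π (Q x) = 0 := fun x => by rw [Qa, map_sub, hπι, sub_self]
  have QQ : ∀ x, Q (Q x) = Q x := fun x => by rw [Qa (Q x), πQ, map_zero, sub_zero]
  set θ : B →ₗ[K] B := Q ∘ₗ η ∘ₗ Q with hθ
  have θa : ∀ x, θ x = Q (η (Q x)) := fun x => rfl
  have hθs : IsSuperfilteredMap S' S' (-1) θ := by
    simpa using hQs.comp (hη.comp hQs)
  have key : ∀ x, D (θ x) + θ (D x) = -Q x := by
    intro x
    rw [θa, θa, DQ, QD, ← QD (η (Q x)), ← DQ x, ← map_add, h, map_sub, Qι, zero_sub, QQ]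
  have Qθ : ∀ x, Q (θ x) = θ x := fun x => by rw [θa, QQ]
  have θQ : ∀ x, θ (Q x) = θ x := fun x => by rw [θa, θa, QQ]
  have k1 : ∀ x, D (θ (D x)) = -D x := by
    intro x
    have := key (D x)
    rwa [hDD, map_zero, add_zero, QD] at this
  have k2 : ∀ x, D (θ (θ x)) = θ (θ (D x)) := by
    intro x
    have e1 := key (θ x)
    have e2 : θ (D (θ x)) + θ (θ (D x)) = -θ x := by
      rw [← map_add, key, map_neg, θQ]
    rw [Qθ] at e1
    rw [← e2] at e1
    have := add_right_cancel (b := θ (D (θ x))) (a := D (θ (θ x))) (c := θ (θ (D x)))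
      (by rw [e1, add_comm])
    exact this
  refine ⟨-(θ ∘ₗ D ∘ₗ θ), ?_, ?_, ?_, ?_, ?_⟩
  · refine IsSuperfilteredMap.neg ?_
    simpa using hθs.comp (hD.comp hθs)
  · intro x
    change D (-θ (D (θ x))) + -θ (D (θ (D x))) = _
    rw [map_neg, k1, k1, map_neg, neg_neg, neg_neg, key, Qa, neg_sub]
  · intro a
    change -θ (D (θ (ι a))) = 0
    rw [θa (ι a), Qι]
    simp
  · intro x
    change π (-θ (D (θ x))) = 0
    rw [map_neg, θa, πQ, neg_zero]
  · intro x
    change -θ (D (θ (-θ (D (θ x))))) = 0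
    simp only [map_neg, neg_neg]
    rw [k2, hDD]
    simp

/-- A homotopy between `ιπ` and an invertible perturbation of the identity gives a homotopy which
satisfies the side conditions. -/
theorem exists_special_homotopy_of_perturbation {S : Superfiltration K E}
    {S' : Superfiltration K B} {ι : E →ₗ[K] B} {π : B →ₗ[K] E} {D η N : B →ₗ[K] B}
    (hι : IsSuperfilteredMap S S' 0 ι) (hπ : IsSuperfilteredMap S' S 0 π)
    (hD : IsSuperfilteredMap S' S' 1 D) (hη : IsSuperfilteredMap S' S' (-1) η)
    (hDD : ∀ x, D (D x) = 0) (hDι : ∀ a, D (ι a) = 0) (hπD : ∀ x, π (D x) = 0)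
    (hπι : ∀ a, π (ι a) = a) (hNpar : ∀ i, ∀ x ∈ S'.par i, N x ∈ S'.par i)
    (hNfil : ∀ p, ∀ x ∈ S'.fil p, N x ∈ S'.fil (p - 1)) {p q : ℤ} (hp : S'.fil p = ⊥)
    (hq : S'.fil q = ⊤) (h : ∀ x, D (η x) + η (D x) = ι (π x) - (x - N x)) :
    ∃ η' : B →ₗ[K] B, IsSuperfilteredMap S' S' (-1) η' ∧
      (∀ x, D (η' x) + η' (D x) = ι (π x) - x) ∧ (∀ a, η' (ι a) = 0) ∧ (∀ x, π (η' x) = 0) ∧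
      ∀ x, η' (η' x) = 0 := by
  obtain ⟨U, hU, hU1, hU2, -⟩ := exists_inverse_one_sub (S := S') hNpar hNfil hp hq
  have hDN : ∀ x, D (x - N x) = D x - N (D x) := by
    intro x
    have e1 : x - N x = ι (π x) - (D (η x) + η (D x)) := by rw [h]; abel
    have e2 : D x - N (D x) = ι (π (D x)) - (D (η (D x)) + η (D (D x))) := by rw [h]; abel
    rw [e1, e2, map_sub, map_add, hDι, hDD, hπD, hDD, map_zero, map_zero]
    abel
  have hDU : ∀ x, D (U x) = U (D x) := by
    intro x
    conv_rhs => rw [← hU2 x, hDN, hU1]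
  refine exists_special_homotopy (η := U ∘ₗ η ∘ₗ (LinearMap.id - ι ∘ₗ π)) hι hπ hD ?_ hDD hDι hπD
    hπι fun x => ?_
  · have hQ : IsSuperfilteredMap S' S' 0 (LinearMap.id - ι ∘ₗ π) :=
      IsSuperfilteredMap.id.sub (by simpa using hι.comp hπ)
    simpa using hU.comp (hη.comp hQ)
  · change D (U (η (x - ι (π x)))) + U (η (D x - ι (π (D x)))) = _
    have e : D x - ι (π (D x)) = D (x - ι (π x)) := by
      rw [hπD, map_zero, sub_zero, map_sub, hDι, sub_zero]
    rw [hDU, e, ← map_add, h]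
    rw [map_sub π, hπι, sub_self, map_zero, zero_sub, map_neg, hU1, neg_sub]

end Perturbation

/-! ### Operators on the endomorphism algebra of a Koszul matrix factorisation -/

section Operators

variable {K B : Type*} [CommRing K] [Ring B] [Algebra K B] (s : B →ₗ[K] B)

/-- The operator `f ↦ v s(f) - f v`, a supercommutator if `s` is the grading involution. -/
def commOp (v : B) : Module.End K B := LinearMap.mulLeft K v ∘ₗ s - LinearMap.mulRight K v

theorem commOp_apply (v f : B) : commOp (K := K) s v f = v * s f - f * v := rfl

/-- The operator `f ↦ - f c`. -/
def negMulRight (c : B) : Module.End K B := -LinearMap.mulRight K c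

theorem negMulRight_apply (c f : B) : negMulRight (K := K) c f = -(f * c) := rfl

variable {s} (hss : ∀ f, s (s f) = f) (hmul : ∀ f g, s (f * g) = s f * s g)

include hss hmul

theorem commOp_commOp {v v' : B} (hv' : s v' = -v') (f : B) :
    commOp s v (commOp s v' f) =
      -(v * v') * f + v * s f * v' - v' * s f * v + f * (v' * v) := by
  simp only [commOp_apply, map_sub, hmul, hss, hv']
  noncomm_ring

theorem commOp_anticomm {v v' : B} (hv : s v = -v) (hv' : s v' = -v') (h : v * v' + v' * v = 0) :
    commOp s v * commOp s v' + commOp s v' * commOp s v = 0 := by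
  ext f
  rw [LinearMap.add_apply, Module.End.mul_apply, Module.End.mul_apply, LinearMap.zero_apply,
    commOp_commOp hss hmul hv', commOp_commOp hss hmul hv]
  have e : -(v * v') * f + v * s f * v' - v' * s f * v + f * (v' * v) +
      (-(v' * v) * f + v' * s f * v - v * s f * v' + f * (v * v')) =
      -((v * v' + v' * v) * f) + f * (v * v' + v' * v) := by noncomm_ring
  rw [e, h, zero_mul, mul_zero, neg_zero, add_zero]

theorem commOp_sq {v : B} (hv : s v = -v) (h : v * v = 0) : commOp s v * commOp s v = 0 := by
  ext f
  rw [Module.End.mul_apply, LinearMap.zero_apply, commOp_commOp hss hmul hv, h]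
  simp

omit hss in
theorem commOp_negMulRight {v c : B} (hc : s c = -c) (f : B) :
    (commOp s v * negMulRight c + negMulRight c * commOp s v : Module.End K B) f = f * (v * c + c * v) := by
  rw [LinearMap.add_apply, Module.End.mul_apply, Module.End.mul_apply]
  simp only [commOp_apply, negMulRight_apply, map_neg, hmul, hc]
  noncomm_ring

end Operators

section Koszul

variable {K : Type u} [CommRing K] {V : Type v} [AddCommGroup V] [Module K V] {n : ℕ}
  {R : Type*} [CommRing R] [Algebra K R]

theorem rTensor_baseChange_apply (φ : R →ₗ[K] R) (g : Module.End K (ExteriorAlgebra K V))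
    (z : R ⊗[K] ExteriorAlgebra K V) :
    φ.rTensor (ExteriorAlgebra K V) (g.baseChange R z) =
      g.baseChange R (φ.rTensor (ExteriorAlgebra K V) z) := by
  induction z using TensorProduct.induction_on with
  | zero => simp
  | tmul r e => rfl
  | add y z hy hz => rw [map_add, map_add, hy, hz, map_add, map_add]

theorem rTensor_smul_apply {φ ψ : R →ₗ[K] R} {x y : R} (h : ∀ r, φ (x * r) = y * ψ r)
    (z : R ⊗[K] ExteriorAlgebra K V) :
    φ.rTensor (ExteriorAlgebra K V) (x • z) = y • ψ.rTensor (ExteriorAlgebra K V) z := by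
  induction z using TensorProduct.induction_on with
  | zero => simp
  | tmul r e =>
    rw [TensorProduct.smul_tmul', LinearMap.rTensor_tmul, LinearMap.rTensor_tmul,
      TensorProduct.smul_tmul', smul_eq_mul, smul_eq_mul, h]
  | add z z' hz hz' => rw [smul_add, map_add, hz, hz', map_add, smul_add]

theorem rTensor_mem_baseChange (φ : R →ₗ[K] R) {p : Submodule K (ExteriorAlgebra K V)}
    {z : R ⊗[K] ExteriorAlgebra K V} (hz : z ∈ p.baseChange R) :
    φ.rTensor (ExteriorAlgebra K V) z ∈ p.baseChange R := by
  obtain ⟨t, rfl⟩ := hz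
  induction t using TensorProduct.induction_on with
  | zero => simp
  | tmul r e => exact Submodule.tmul_mem_baseChange_of_mem _ e.2
  | add y z hy hz => rw [map_add, map_add]; exact add_mem hy hz

/-- A `K`-linear endomorphism of `R`, acting on the coefficients of the endomorphisms of
`R ⊗ ΛV`. -/
def coeffMap (φ : R →ₗ[K] R) : Module.End K (Module.End R (R ⊗[K] ExteriorAlgebra K V)) where
  toFun f := LinearMap.liftBaseChange R
    (φ.rTensor (ExteriorAlgebra K V) ∘ₗ f.restrictScalars K ∘ₗ
      TensorProduct.mk K R (ExteriorAlgebra K V) 1)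
  map_add' f g := end_ext fun e => by
    simp only [LinearMap.liftBaseChange_one_tmul, LinearMap.add_apply, LinearMap.comp_apply,
      LinearMap.restrictScalars_apply, map_add]
  map_smul' c f := end_ext fun e => by
    simp only [LinearMap.liftBaseChange_one_tmul, LinearMap.smul_apply, LinearMap.comp_apply,
      LinearMap.restrictScalars_apply, map_smul, RingHom.id_apply]

theorem coeffMap_tmul (φ : R →ₗ[K] R) (f : Module.End R (R ⊗[K] ExteriorAlgebra K V))
    (e : ExteriorAlgebra K V) :
    coeffMap φ f (1 ⊗ₜ e) = φ.rTensor (ExteriorAlgebra K V) (f (1 ⊗ₜ e)) := by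
  change LinearMap.liftBaseChange R (φ.rTensor (ExteriorAlgebra K V) ∘ₗ f.restrictScalars K ∘ₗ
    TensorProduct.mk K R (ExteriorAlgebra K V) 1) (1 ⊗ₜ e) = _
  rw [LinearMap.liftBaseChange_one_tmul]
  rfl

theorem coeffMap_mul (φ ψ : R →ₗ[K] R) :
    (coeffMap φ * coeffMap ψ : Module.End K (Module.End R (R ⊗[K] ExteriorAlgebra K V))) =
      coeffMap (φ ∘ₗ ψ) := by
  refine LinearMap.ext fun f => end_ext fun e => ?_
  rw [Module.End.mul_apply, coeffMap_tmul, coeffMap_tmul, coeffMap_tmul, LinearMap.rTensor_comp]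
  rfl

theorem coeffMap_baseChange_mul (φ : R →ₗ[K] R) (g : Module.End K (ExteriorAlgebra K V))
    (f : Module.End R (R ⊗[K] ExteriorAlgebra K V)) :
    coeffMap φ (g.baseChange R * f) = g.baseChange R * coeffMap φ f :=
  end_ext fun e => by
    rw [coeffMap_tmul, Module.End.mul_apply, Module.End.mul_apply, rTensor_baseChange_apply,
      coeffMap_tmul]

theorem coeffMap_mul_baseChange (φ : R →ₗ[K] R) (g : Module.End K (ExteriorAlgebra K V))
    (f : Module.End R (R ⊗[K] ExteriorAlgebra K V)) :
    coeffMap φ (f * g.baseChange R) = coeffMap φ f * g.baseChange R :=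
  end_ext fun e => by
    rw [coeffMap_tmul, Module.End.mul_apply, Module.End.mul_apply, LinearMap.baseChange_tmul,
      coeffMap_tmul]

theorem coeffMap_smul {φ ψ : R →ₗ[K] R} {x y : R} (h : ∀ r, φ (x * r) = y * ψ r)
    (f : Module.End R (R ⊗[K] ExteriorAlgebra K V)) :
    coeffMap φ (x • f) = y • coeffMap ψ f :=
  end_ext fun e => by
    rw [coeffMap_tmul, LinearMap.smul_apply, LinearMap.smul_apply, rTensor_smul_apply h,
      coeffMap_tmul]

theorem coeffMap_id (f : Module.End R (R ⊗[K] ExteriorAlgebra K V)) :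
    coeffMap LinearMap.id f = f :=
  end_ext fun e => by rw [coeffMap_tmul, LinearMap.rTensor_id]; rfl

theorem smul_coeffMap {φ ψ : R →ₗ[K] R} {x : R} (h : ∀ r, x * φ r = r - ψ r)
    (f : Module.End R (R ⊗[K] ExteriorAlgebra K V)) :
    x • coeffMap φ f = f - coeffMap ψ f := by
  have key : ∀ z : R ⊗[K] ExteriorAlgebra K V, x • φ.rTensor (ExteriorAlgebra K V) z +
      ψ.rTensor (ExteriorAlgebra K V) z = z := by
    intro z
    induction z using TensorProduct.induction_on with
    | zero => simp
    | tmul r e =>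
      rw [LinearMap.rTensor_tmul, LinearMap.rTensor_tmul, TensorProduct.smul_tmul', smul_eq_mul, h,
        ← TensorProduct.add_tmul, sub_add_cancel]
    | add y z hy hz =>
      rw [map_add, map_add, smul_add, add_add_add_comm, hy, hz]
  refine eq_sub_of_add_eq (end_ext fun e => ?_)
  rw [LinearMap.add_apply, LinearMap.smul_apply, coeffMap_tmul, coeffMap_tmul, key]

theorem coeffMap_isSuperfilteredMap (φ : R →ₗ[K] R) :
    IsSuperfilteredMap (endSuper K V R) (endSuper K V R) 0 (coeffMap φ) := by
  have key : ∀ (s : Set ℕ) (z : R ⊗[K] ExteriorAlgebra K V),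
      z ∈ Superfiltration.supported (fun m : ℕ => (⋀[K]^m V).baseChange R) s →
      φ.rTensor (ExteriorAlgebra K V) z ∈
        Superfiltration.supported (fun m : ℕ => (⋀[K]^m V).baseChange R) s := by
    intro s z hz
    classical
    rw [← DirectSum.sum_support_decompose (fun m : ℕ => (⋀[K]^m V).baseChange R) z, map_sum]
    refine sum_mem fun m _ => ?_
    by_cases hm : m ∈ s
    · exact Superfiltration.mem_supported_of_mem _ hm (rTensor_mem_baseChange φ (SetLike.coe_mem _))
    · rw [hz m hm, map_zero]
      exact zero_mem _
  constructor
  · intro i f hf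
    rw [Int.cast_zero, add_zero]
    refine mem_endo_par_of_tmul fun m e he => ?_
    rw [coeffMap_tmul]
    exact key _ _ (hf _ _ (tmul_mem_par 1 he))
  · intro p f hf
    rw [add_zero]
    refine mem_endo_fil_of_tmul fun m e he => ?_
    rw [coeffMap_tmul]
    exact key _ _ (hf _ _ (tmul_mem_fil 1 he))

theorem coeffMap_sgn (φ : R →ₗ[K] R) (f : Module.End R (R ⊗[K] ExteriorAlgebra K V)) :
    coeffMap φ ((endSuper K V R).sgn f) = (endSuper K V R).sgn (coeffMap φ f) := by
  rw [(coeffMap_isSuperfilteredMap φ).map_sgn]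
  simp

/-- Multiplication by an element of `R`, as a `K`-linear operator on `End_R(R ⊗ ΛV)`. -/
def smulOp (x : R) : Module.End K (Module.End R (R ⊗[K] ExteriorAlgebra K V)) where
  toFun f := x • f
  map_add' f g := smul_add x f g
  map_smul' c f := smul_comm x c f

theorem smulOp_apply (x : R) (f : Module.End R (R ⊗[K] ExteriorAlgebra K V)) :
    smulOp (K := K) x f = x • f := rfl

/-! ### The signs of wedge and contraction operators -/

theorem endSuper_sgn_sgn (f : Module.End R (R ⊗[K] ExteriorAlgebra K V)) :
    (endSuper K V R).sgn ((endSuper K V R).sgn f) = f := (endSuper K V R).sgn_sgn f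

theorem endSuper_sgn_eq (f : Module.End R (R ⊗[K] ExteriorAlgebra K V)) :
    (endSuper K V R).sgn f = (extSuperBase K V R).endo.sgn f :=
  Superfiltration.restrictScalars_sgn _ _ f

theorem endSuper_sgn_mul (f g : Module.End R (R ⊗[K] ExteriorAlgebra K V)) :
    (endSuper K V R).sgn (f * g) = (endSuper K V R).sgn f * (endSuper K V R).sgn g := by
  rw [endSuper_sgn_eq, endSuper_sgn_eq, endSuper_sgn_eq]
  exact (extSuperBase K V R).endo_sgn_mul f g

theorem endSuper_sgn_of_odd {f : Module.End R (R ⊗[K] ExteriorAlgebra K V)}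
    (hf : f ∈ (extSuperBase K V R).endo.par 1) : (endSuper K V R).sgn f = -f := by
  rw [endSuper_sgn_eq, (extSuperBase K V R).endo.sgn_of_mem hf, uzpow_one]
  exact (Units.neg_smul _ _).trans (congrArg _ (one_smul _ _))

theorem endSuper_sgn_wedge (x : V) : (endSuper K V R).sgn (wedge R (ExteriorAlgebra.ι K x)) =
    -wedge R (ExteriorAlgebra.ι K x) := endSuper_sgn_of_odd (wedge_ι_mem x).1

theorem endSuper_sgn_contract (φ : Module.Dual K V) :
    (endSuper K V R).sgn (contract R φ) = -contract R φ := endSuper_sgn_of_odd (contract_mem φ).1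

theorem endSuper_fil_bot (b : Module.Basis (Fin n) K V) :
    (endSuper K V R).fil (-1 - n) = ⊥ := by
  have := (extSuperBase K V R).endo_fil_eq_bot (ext_fil_base_neg_one (K := K) (V := V) R)
    (ext_fil_base_eq_top R b)
  rw [eq_bot_iff]
  intro x hx
  have h : x ∈ (extSuperBase K V R).endo.fil (-1 - n) := hx
  rw [this] at h
  exact h

theorem endSuper_fil_top (b : Module.Basis (Fin n) K V) :
    (endSuper K V R).fil (n - -1) = ⊤ := by
  have := (extSuperBase K V R).endo_fil_eq_top (ext_fil_base_neg_one (K := K) (V := V) R)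
    (ext_fil_base_eq_top R b)
  rw [eq_top_iff]
  intro x _
  change x ∈ (extSuperBase K V R).endo.fil (n - -1)
  rw [this]
  trivial

/-! ### The Koszul relations -/

/-- Division by coordinates on an augmented algebra, with the restrictions to the coordinate
hyperplanes. -/
structure CoordinateDivision (x : Fin n → R) (ε : R →ₐ[K] K) where
  /-- division by a coordinate -/
  div : Fin n → R →ₗ[K] R
  /-- restriction to a coordinate hyperplane -/
  res : Fin n → R →ₗ[K] R
  mul_div : ∀ i r, x i * div i r = r - res i r
  div_mul : ∀ i r, div i (x i * r) = r
  div_mul_of_ne : ∀ i j, i ≠ j → ∀ r, div i (x j * r) = x j * div i r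
  res_mul_of_ne : ∀ i j, i ≠ j → ∀ r, res i (x j * r) = x j * res i r
  res_res : ∀ i r, res i (res i r) = res i r
  res_comm : ∀ i j r, res i (res j r) = res j (res i r)
  eps_x : ∀ i, ε (x i) = 0
  res_prod : ∀ r, (((List.finRange n).map res : List (Module.End K R)).prod) r =
    algebraMap K R (ε r)

variable (b : Module.Basis (Fin n) K V) {x : Fin n → R} {ε : R →ₐ[K] K}

theorem commute_coeffMap_commOp (φ : R →ₗ[K] R) (a : ExteriorAlgebra K V) :
    Commute (coeffMap φ) (commOp (K := K) (endSuper K V R).sgn (wedge R a)) :=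
  LinearMap.ext fun f => by
    refine (map_sub (coeffMap φ) (wedge R a * (endSuper K V R).sgn f) (f * wedge R a)).trans ?_
    refine (congrArg₂ _ (coeffMap_baseChange_mul φ _ _) (coeffMap_mul_baseChange φ _ _)).trans ?_
    rw [coeffMap_sgn]
    rfl

theorem commute_coeffMap_negMulRight (φ : R →ₗ[K] R) (ψ : Module.Dual K V) :
    Commute (coeffMap φ) (negMulRight (K := K) (contract R ψ)) :=
  LinearMap.ext fun f => by
    refine (map_neg (coeffMap φ) (f * contract R ψ)).trans ?_
    exact congrArg _ (coeffMap_mul_baseChange φ _ _)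

theorem endSuper_sgn_smul (r : R) (f : Module.End R (R ⊗[K] ExteriorAlgebra K V)) :
    (endSuper K V R).sgn (r • f) = r • (endSuper K V R).sgn f := by
  rw [endSuper_sgn_eq, endSuper_sgn_eq, map_smul]

theorem commute_smulOp_commOp (r : R) (a : ExteriorAlgebra K V) :
    Commute (smulOp r) (commOp (K := K) (endSuper K V R).sgn (wedge R a)) :=
  LinearMap.ext fun f => by
    refine (smul_sub r (wedge R a * (endSuper K V R).sgn f) (f * wedge R a)).trans ?_
    refine (congrArg₂ _ (mul_smul_comm r _ _).symm (smul_mul_assoc r _ _).symm).trans ?_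
    rw [← endSuper_sgn_smul]
    rfl

theorem commute_smulOp_negMulRight (r : R) (ψ : Module.Dual K V) :
    Commute (smulOp r) (negMulRight (K := K) (contract R ψ)) :=
  LinearMap.ext fun f => by
    refine (smul_neg r (f * contract R ψ)).trans ?_
    exact congrArg _ (smul_mul_assoc r _ _).symm

theorem commOp_negMulRight_coord (i j : Fin n) (f : Module.End R (R ⊗[K] ExteriorAlgebra K V)) :
    (commOp (K := K) (endSuper K V R).sgn (wedge R (ExteriorAlgebra.ι K (b i))) *
        negMulRight (contract R (b.coord j)) +
      negMulRight (contract R (b.coord j)) *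
        commOp (endSuper K V R).sgn (wedge R (ExteriorAlgebra.ι K (b i))) :
      Module.End K (Module.End R (R ⊗[K] ExteriorAlgebra K V))) f = if i = j then f else 0 := by
  refine (commOp_negMulRight endSuper_sgn_mul (endSuper_sgn_contract _) f).trans ?_
  rw [wedge_contract_add, Module.Basis.coord_apply, Module.Basis.repr_self, Finsupp.single_apply]
  split_ifs
  · rw [map_one, one_smul, mul_one]
  · rw [map_zero, zero_smul, mul_zero]

theorem commOp_wedge_sq (v : V) :
    commOp (K := K) (endSuper K V R).sgn (wedge R (ExteriorAlgebra.ι K v)) *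
      commOp (K := K) (endSuper K V R).sgn (wedge R (ExteriorAlgebra.ι K v)) = 0 :=
  commOp_sq endSuper_sgn_sgn endSuper_sgn_mul (endSuper_sgn_wedge _) (wedge_wedge_self _)

theorem commOp_wedge_anticomm (v v' : V) :
    commOp (K := K) (endSuper K V R).sgn (wedge R (ExteriorAlgebra.ι K v)) *
      commOp (K := K) (endSuper K V R).sgn (wedge R (ExteriorAlgebra.ι K v')) +
    commOp (K := K) (endSuper K V R).sgn (wedge R (ExteriorAlgebra.ι K v')) *
      commOp (K := K) (endSuper K V R).sgn (wedge R (ExteriorAlgebra.ι K v)) = 0 :=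
  commOp_anticomm endSuper_sgn_sgn endSuper_sgn_mul (endSuper_sgn_wedge _) (endSuper_sgn_wedge _)
    (wedge_wedge_add _ _)

theorem smulOp_mul_coeffMap_div (Δ : CoordinateDivision x ε) (i : Fin n) :
    smulOp (x i) * coeffMap (Δ.div i) =
      (1 - coeffMap (Δ.res i) : Module.End K (Module.End R (R ⊗[K] ExteriorAlgebra K V))) := by
  refine LinearMap.ext fun f => ?_
  rw [Module.End.mul_apply, smulOp_apply, smul_coeffMap (Δ.mul_div i)]
  exact (LinearMap.sub_apply (1 : Module.End K _) (coeffMap (Δ.res i)) f).symm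

theorem coeffMap_div_mul_smulOp (Δ : CoordinateDivision x ε) (i : Fin n) :
    coeffMap (Δ.div i) * smulOp (x i) =
      (1 : Module.End K (Module.End R (R ⊗[K] ExteriorAlgebra K V))) :=
  LinearMap.ext fun f => by
    have h : ∀ r, Δ.div i (x i * r) = 1 * LinearMap.id (R := K) r := fun r => by
      rw [Δ.div_mul, one_mul, LinearMap.id_apply]
    rw [Module.End.mul_apply, smulOp_apply, coeffMap_smul h, one_smul, coeffMap_id,
      Module.End.one_apply]

theorem koszulRelations (Δ : CoordinateDivision x ε) :
    KoszulRelations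
      (fun i => commOp (K := K) (endSuper K V R).sgn (wedge R (ExteriorAlgebra.ι K (b i))))
      (fun i => negMulRight (K := K) (contract R (b.coord i))) (fun i => smulOp (x i))
      (fun i => coeffMap (Δ.div i)) (fun i => coeffMap (Δ.res i)) where
  A_sq _ := commOp_wedge_sq _
  A_anticomm _ _ := commOp_wedge_anticomm _ _
  A_C_self i := LinearMap.ext fun f => (commOp_negMulRight_coord b i i f).trans (if_pos rfl)
  A_C i j hij := LinearMap.ext fun f => (commOp_negMulRight_coord b i j f).trans (if_neg hij)
  X_A _ _ := commute_smulOp_commOp _ _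
  X_C _ _ := commute_smulOp_negMulRight _ _
  D_A _ _ := commute_coeffMap_commOp _ _
  P_A _ _ := commute_coeffMap_commOp _ _
  P_C _ _ := commute_coeffMap_negMulRight _ _
  X_D i := smulOp_mul_coeffMap_div Δ i
  D_X i := coeffMap_div_mul_smulOp Δ i
  D_X_of_ne i j hij := LinearMap.ext fun f => coeffMap_smul (Δ.div_mul_of_ne i j hij) f
  P_X_of_ne i j hij := LinearMap.ext fun f => coeffMap_smul (Δ.res_mul_of_ne i j hij) f
  P_sq i := (coeffMap_mul _ _).trans (congrArg coeffMap (LinearMap.ext (Δ.res_res i)))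
  P_comm i j := (coeffMap_mul _ _).trans
    ((congrArg coeffMap (LinearMap.ext (Δ.res_comm i j))).trans (coeffMap_mul _ _).symm)

end Koszul

section Koszul

variable {K : Type u} [CommRing K] {V : Type v} [AddCommGroup V] [Module K V] {n : ℕ}
  {R : Type*} [CommRing R] [Algebra K R]

/-! ### Endomorphisms which supercommute with exterior multiplication -/

theorem wedge_mul_sgn_of_basis (b : Module.Basis (Fin n) K V)
    {f : Module.End R (R ⊗[K] ExteriorAlgebra K V)}
    (h : ∀ i, commOp (K := K) (endSuper K V R).sgn (wedge R (ExteriorAlgebra.ι K (b i))) f = 0)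
    (v : V) : wedge R (ExteriorAlgebra.ι K v) * (endSuper K V R).sgn f =
      f * wedge R (ExteriorAlgebra.ι K v) := by
  have key : LinearMap.mulRight K ((endSuper K V R).sgn f) ∘ₗ wedgeMap R ∘ₗ ExteriorAlgebra.ι K =
      LinearMap.mulLeft K f ∘ₗ wedgeMap R ∘ₗ ExteriorAlgebra.ι K :=
    b.ext fun i => sub_eq_zero.1 (h i)
  exact LinearMap.congr_fun key v

theorem endSuper_sgn_tmul {m : ℕ} {e : ExteriorAlgebra K V} (he : e ∈ ⋀[K]^m V)
    {f : Module.End R (R ⊗[K] ExteriorAlgebra K V)} (hf : f (1 ⊗ₜ e) = 0) :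
    (endSuper K V R).sgn f (1 ⊗ₜ e) = 0 := by
  rw [endSuper_sgn_eq, Superfiltration.endo_sgn, Module.End.mul_apply, Module.End.mul_apply,
    (extSuperBase K V R).sgn_of_mem (tmul_mem_par 1 he), Units.smul_def, map_zsmul, hf, smul_zero,
    map_zero]

/-- An endomorphism which supercommutes with exterior multiplication is determined by its value
at `1`. -/
theorem eq_zero_of_supercommute {f : Module.End R (R ⊗[K] ExteriorAlgebra K V)}
    (h : ∀ v : V, wedge R (ExteriorAlgebra.ι K v) * (endSuper K V R).sgn f =
      f * wedge R (ExteriorAlgebra.ι K v)) (h1 : f (1 ⊗ₜ 1) = 0) : f = 0 := by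
  have key : ∀ m : ℕ, ∀ e ∈ ⋀[K]^m V, f (1 ⊗ₜ e) = 0 := by
    intro m e he
    induction he using Submodule.pow_induction_on_left' with
    | algebraMap r =>
      rw [Algebra.algebraMap_eq_smul_one, TensorProduct.tmul_smul, LinearMap.map_smul_of_tower, h1,
        smul_zero]
    | add x y i hx hy ihx ihy => rw [TensorProduct.tmul_add, map_add, ihx, ihy, add_zero]
    | mem_mul m hm i x hx ih =>
      obtain ⟨v, rfl⟩ := hm
      have e1 := LinearMap.congr_fun (h v) (1 ⊗ₜ x)
      rw [Module.End.mul_apply, Module.End.mul_apply, endSuper_sgn_tmul hx ih, map_zero] at e1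
      exact e1.symm
  refine end_ext fun e => ?_
  have he : e ∈ Superfiltration.supported (fun m : ℕ => ⋀[K]^m V) Set.univ :=
    fun m hm => absurd (Set.mem_univ m) hm
  have := Superfiltration.mem_of_mem_supported (fun m : ℕ => ⋀[K]^m V)
    (P := LinearMap.ker (f.restrictScalars K ∘ₗ TensorProduct.mk K R (ExteriorAlgebra K V) 1))
    (fun m _ e he => key m e he) he
  exact this

theorem ι_mul_comm_of_mem (v : V) {m : ℕ} {a : ExteriorAlgebra K V} (ha : a ∈ ⋀[K]^m V) :
    ExteriorAlgebra.ι K v * (((-1 : ℤˣ) ^ m) • a) = a * ExteriorAlgebra.ι K v := by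
  induction ha using Submodule.pow_induction_on_left' with
  | algebraMap r => rw [pow_zero, one_smul, Algebra.commutes]
  | add x y i hx hy ihx ihy => rw [smul_add, mul_add, ihx, ihy, add_mul]
  | mem_mul m hm i x hx ih =>
    obtain ⟨u, rfl⟩ := hm
    have h : ExteriorAlgebra.ι K v * ExteriorAlgebra.ι K u =
        -(ExteriorAlgebra.ι K u * ExteriorAlgebra.ι K v) :=
      eq_neg_of_add_eq_zero_left (ExteriorAlgebra.ι_add_mul_swap v u)
    rw [mul_assoc, ← ih, pow_succ, Units.smul_def, Units.smul_def, mul_smul_comm, ← mul_assoc, h,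
      mul_smul_comm, mul_smul_comm]
    simp [mul_assoc]

theorem wedge_supercommute (v : V) (a : ExteriorAlgebra K V) :
    wedge R (ExteriorAlgebra.ι K v) * (endSuper K V R).sgn (wedge R a) =
      wedge R a * wedge R (ExteriorAlgebra.ι K v) := by
  have ha : a ∈ Superfiltration.supported (fun m : ℕ => ⋀[K]^m V) Set.univ :=
    fun m hm => absurd (Set.mem_univ m) hm
  have := Superfiltration.mem_of_mem_supported (fun m : ℕ => ⋀[K]^m V)
    (P := LinearMap.eqLocus (LinearMap.mulLeft K (wedge R (ExteriorAlgebra.ι K v)) ∘ₗ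
        (endSuper K V R).sgn ∘ₗ wedgeMap R)
      (LinearMap.mulRight K (wedge R (ExteriorAlgebra.ι K v)) ∘ₗ wedgeMap R))
    (fun m _ e he => ?_) ha
  · exact this
  · change wedge R (ExteriorAlgebra.ι K v) * (endSuper K V R).sgn (wedge R e) =
      wedge R e * wedge R (ExteriorAlgebra.ι K v)
    have h1 : (endSuper K V R).sgn (wedge R e) = wedgeMap R (((-1 : ℤˣ) ^ m) • e) := by
      rw [(endSuper K V R).sgn_of_mem (wedge_mem he).1, uzpow_natCast, map_units_smul]
      rfl
    rw [h1, ← wedge_mul, ← ι_mul_comm_of_mem v he, wedge_mul]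
    rfl

theorem rTensor_prod_apply (l : List (Module.End K R)) {z : R ⊗[K] ExteriorAlgebra K V}
    (h : ∀ φ ∈ l, φ.rTensor (ExteriorAlgebra K V) z = z) :
    LinearMap.rTensor (ExteriorAlgebra K V) l.prod z = z := by
  induction l with
  | nil => exact LinearMap.congr_fun (LinearMap.rTensor_id _ _) z
  | cons φ l ih =>
    rw [List.prod_cons, Module.End.mul_eq_comp, LinearMap.rTensor_comp, LinearMap.comp_apply,
      ih fun ψ hψ => h ψ (List.mem_cons_of_mem _ hψ), h φ List.mem_cons_self]

variable (b : Module.Basis (Fin n) K V) {x y : Fin n → R} {ε : R →ₐ[K] K}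

theorem eq_tmul_redMod (Δ : CoordinateDivision x ε) {z : R ⊗[K] ExteriorAlgebra K V}
    (h : ∀ i, (Δ.res i).rTensor (ExteriorAlgebra K V) z = z) : z = 1 ⊗ₜ redMod ε z := by
  have h1 : LinearMap.rTensor (ExteriorAlgebra K V)
      (((List.finRange n).map Δ.res : List (Module.End K R)).prod) z = z := by
    refine rTensor_prod_apply _ fun φ hφ => ?_
    obtain ⟨i, -, rfl⟩ := List.mem_map.1 hφ
    exact h i
  rw [show (((List.finRange n).map Δ.res : List (Module.End K R)).prod) =
    Algebra.linearMap K R ∘ₗ ε.toLinearMap from LinearMap.ext Δ.res_prod] at h1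
  rw [← h1]
  have key : ∀ z : R ⊗[K] ExteriorAlgebra K V,
      LinearMap.rTensor (ExteriorAlgebra K V) (Algebra.linearMap K R ∘ₗ ε.toLinearMap) z =
        1 ⊗ₜ redMod ε z := by
    intro z
    induction z using TensorProduct.induction_on with
    | zero => simp
    | tmul r e =>
      rw [LinearMap.rTensor_tmul, redMod_tmul, LinearMap.comp_apply, Algebra.linearMap_apply,
        Algebra.algebraMap_eq_smul_one, ← TensorProduct.smul_tmul]
      rfl
    | add y z hy hz => rw [map_add, hy, hz, map_add, TensorProduct.tmul_add]
  rw [key z, redMod_tmul, map_one, one_smul]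

theorem CoordinateDivision.eps_res (Δ : CoordinateDivision x ε) (i : Fin n) (r : R) :
    ε (Δ.res i r) = ε r := by
  have h := congrArg ε (Δ.mul_div i r)
  rw [map_mul, Δ.eps_x, zero_mul, map_sub] at h
  exact (sub_eq_zero.1 h.symm).symm

theorem redMod_rTensor {φ : R →ₗ[K] R} (h : ∀ r, ε (φ r) = ε r)
    (z : R ⊗[K] ExteriorAlgebra K V) :
    redMod ε (φ.rTensor (ExteriorAlgebra K V) z) = redMod ε z := by
  induction z using TensorProduct.induction_on with
  | zero => simp
  | tmul r e => rw [LinearMap.rTensor_tmul, redMod_tmul, redMod_tmul, h]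
  | add y z hy hz => rw [map_add, map_add, hy, hz, map_add]

/-- The projection onto the part of `End_R(R ⊗ ΛV)` which does not involve the `i`-th coordinate. -/
def koszulProjection (Δ : CoordinateDivision x ε) (i : Fin n) :
    Module.End K (Module.End R (R ⊗[K] ExteriorAlgebra K V)) :=
  coeffMap (Δ.res i) *
    commOp (K := K) (endSuper K V R).sgn (wedge R (ExteriorAlgebra.ι K (b i))) *
    negMulRight (contract R (b.coord i))

theorem augReduction_koszulProjection (Δ : CoordinateDivision x ε) (i : Fin n)
    (f : Module.End R (R ⊗[K] ExteriorAlgebra K V)) :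
    augReduction ε (koszulProjection b Δ i f) = augReduction ε f := by
  have h0 : koszulProjection b Δ i f = coeffMap (Δ.res i)
      (commOp (K := K) (endSuper K V R).sgn (wedge R (ExteriorAlgebra.ι K (b i)))
        (negMulRight (K := K) (contract R (b.coord i)) f)) := rfl
  have h1 := commOp_negMulRight_coord b i i f
  rw [if_pos rfl, LinearMap.add_apply, Module.End.mul_apply, Module.End.mul_apply] at h1
  have h2 := LinearMap.congr_fun h1 (1 ⊗ₜ 1)
  rw [LinearMap.add_apply] at h2
  have h3 : negMulRight (K := K) (contract R (b.coord i))
      (commOp (K := K) (endSuper K V R).sgn (wedge R (ExteriorAlgebra.ι K (b i))) f)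
      (1 ⊗ₜ 1) = 0 := by
    rw [negMulRight_apply, LinearMap.neg_apply, Module.End.mul_apply, contract_one_tmul_one,
      map_zero, neg_zero]
  rw [h3, add_zero] at h2
  rw [h0, augReduction_apply, coeffMap_tmul, redMod_rTensor (Δ.eps_res i), h2]
  rfl

/-- The composite of the projections is `f ↦ π(f) ∧ •`: its values supercommute with exterior
multiplications and have constant coefficients, so they are determined by their values at `1`. -/
theorem prod_koszulProjection_apply (Δ : CoordinateDivision x ε)
    (f : Module.End R (R ⊗[K] ExteriorAlgebra K V)) :
    ((List.finRange n).map (koszulProjection b Δ)).prod f = wedge R (augReduction ε f) := by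
  have hA : ∀ i, commOp (K := K) (endSuper K V R).sgn (wedge R (ExteriorAlgebra.ι K (b i)))
      (((List.finRange n).map (koszulProjection b Δ)).prod f) = 0 := fun i =>
    LinearMap.congr_fun ((koszulRelations b Δ).A_mul_prod (List.finRange n) i
      (List.mem_finRange i)) f
  have hP : ∀ i, coeffMap (Δ.res i) (((List.finRange n).map (koszulProjection b Δ)).prod f) =
      ((List.finRange n).map (koszulProjection b Δ)).prod f := fun i =>
    LinearMap.congr_fun ((koszulRelations b Δ).P_mul_prod (List.finRange n) i
      (List.mem_finRange i)) f
  have hπ : augReduction ε (((List.finRange n).map (koszulProjection b Δ)).prod f) =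
      augReduction ε f := by
    generalize List.finRange n = l
    induction l with
    | nil => rfl
    | cons i l ih =>
      rw [List.map_cons, List.prod_cons, Module.End.mul_apply, augReduction_koszulProjection, ih]
  generalize ((List.finRange n).map (koszulProjection b Δ)).prod f = g at hA hP hπ
  have h1 : g (1 ⊗ₜ 1) = 1 ⊗ₜ augReduction ε f := by
    rw [← hπ, augReduction_apply]
    refine eq_tmul_redMod Δ fun i => ?_
    rw [← coeffMap_tmul, hP]
  refine sub_eq_zero.1 (eq_zero_of_supercommute (fun v => ?_) ?_)
  · have e1 := wedge_mul_sgn_of_basis b hA v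
    have e2 := wedge_supercommute (R := R) v (augReduction ε f)
    rw [map_sub (endSuper K V R).sgn]
    refine (mul_sub _ _ _).trans ((congrArg₂ _ e1 e2).trans (sub_mul _ _ _).symm)
  · rw [LinearMap.sub_apply, h1, wedge_tmul, mul_one, sub_self]

end Koszul

theorem IsSuperfilteredMap.mul {K X : Type*} [CommRing K] [AddCommGroup X] [Module K X]
    {S : Superfiltration K X} {r s t : ℤ} {f g : Module.End K X} (hf : IsSuperfilteredMap S S r f)
    (hg : IsSuperfilteredMap S S s g) (h : t = s + r) : IsSuperfilteredMap S S t (f * g) :=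
  h ▸ hf.comp hg

/-- A homotopy for the leading term `-D₀` of a differential `-D₀ - D₁` and for the leading term
`W` of `ι` gives a homotopy for the whole differential which satisfies the side conditions. -/
theorem exists_special_homotopy_of_leading {K E B : Type*} [CommRing K] [AddCommGroup E]
    [Module K E] [AddCommGroup B] [Module K B] {S : Superfiltration K E}
    {S' : Superfiltration K B} {ι W : E →ₗ[K] B} {π : B →ₗ[K] E} {D η : B →ₗ[K] B}
    {D₀ D₁ : Module.End K B} (hι : IsSuperfilteredMap S S' 0 ι) (hW : IsSuperfilteredMap S S' 0 W)
    (hWι : ∀ p, ∀ a ∈ S.fil p, W a - ι a ∈ S'.fil (p - 1)) (hπ : IsSuperfilteredMap S' S 0 π)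
    (hD : IsSuperfilteredMap S' S' 1 D) (hη : IsSuperfilteredMap S' S' (-1) η)
    (hD₁ : IsSuperfilteredMap S' S' (-1) D₁) (hDD : ∀ x, D (D x) = 0) (hDι : ∀ a, D (ι a) = 0)
    (hπD : ∀ x, π (D x) = 0) (hπι : ∀ a, π (ι a) = a) {p q : ℤ} (hp : S'.fil p = ⊥)
    (hq : S'.fil q = ⊤) (hDD₁ : ∀ x, D x = -D₀ x - D₁ x)
    (h : ∀ x, D₀ (η x) + η (D₀ x) = x - W (π x)) :
    ∃ η' : B →ₗ[K] B, IsSuperfilteredMap S' S' (-1) η' ∧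
      (∀ x, D (η' x) + η' (D x) = ι (π x) - x) ∧ (∀ a, η' (ι a) = 0) ∧ (∀ x, π (η' x) = 0) ∧
      ∀ x, η' (η' x) = 0 := by
  have hN₁ : IsSuperfilteredMap S S' 0 (W - ι) := hW.sub hι
  have hN₂ : IsSuperfilteredMap S' S' (-2) (D₁ ∘ₗ η + η ∘ₗ D₁) := (hD₁.comp hη).add (hη.comp hD₁)
  refine exists_special_homotopy_of_perturbation (N := (W - ι) ∘ₗ π - (D₁ ∘ₗ η + η ∘ₗ D₁)) hι hπ hD
    hη hDD hDι hπD hπι (fun i f hf => ?_) (fun p f hf => ?_) hp hq fun f => ?_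
  · have e1 := hN₁.par _ _ (hπ.par i f hf)
    have e2 := hN₂.par i f hf
    rw [Int.cast_zero, add_zero, add_zero] at e1
    rw [show ((-2 : ℤ) : ZMod 2) = 0 by decide, add_zero] at e2
    exact sub_mem e1 e2
  · have e1 := hWι _ _ (hπ.fil p f hf)
    have e2 := hN₂.fil p f hf
    rw [add_zero] at e1
    exact sub_mem e1 (S'.mono (by omega) e2)
  · change D (η f) + η (D f) = ι (π f) - (f - (W (π f) - ι (π f) - (D₁ (η f) + η (D₁ f))))
    rw [hDD₁, hDD₁, map_sub, map_neg]
    rw [show -D₀ (η f) - D₁ (η f) + (-η (D₀ f) - η (D₁ f)) =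
      -(D₀ (η f) + η (D₀ f)) - (D₁ (η f) + η (D₁ f)) by abel, h f]
    abel

section Koszul

variable {K : Type u} [CommRing K] {V : Type v} [AddCommGroup V] [Module K V] {n : ℕ}
  {R : Type*} [CommRing R] [Algebra K R]
  (b : Module.Basis (Fin n) K V) {x y : Fin n → R} {ε : R →ₐ[K] K} {w : R}

/-! ### The homotopy -/

theorem ext_le_of_homogeneous {p : ℤ} {P : Submodule K (ExteriorAlgebra K V)}
    (h : ∀ m : ℕ, (m : ℤ) ≤ p → ⋀[K]^m V ≤ P) {a : ExteriorAlgebra K V}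
    (ha : a ∈ (extSuper K V).fil p) : a ∈ P :=
  Superfiltration.mem_of_mem_supported _ (fun m hm => h m hm) ha

theorem sub_mem_fil_of_lead {B : Type*} [AddCommGroup B] [Module K B] {S' : Superfiltration K B}
    {ι W : ExteriorAlgebra K V →ₗ[K] B}
    (h : ∀ p : ℕ, ∀ a ∈ ⋀[K]^p V, ι a - W a ∈ S'.fil ((p : ℤ) - 1)) (p : ℤ)
    (a : ExteriorAlgebra K V) (ha : a ∈ (extSuper K V).fil p) : W a - ι a ∈ S'.fil (p - 1) := by
  refine ext_le_of_homogeneous (P := (S'.fil (p - 1)).comap (W - ι)) (fun m hm a ha => ?_) ha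
  have e := neg_mem (h m a ha)
  rw [neg_sub] at e
  exact S'.mono (by omega) e

theorem isSuperfilteredMap_commOp {v : Module.End R (R ⊗[K] ExteriorAlgebra K V)} {r : ℤ}
    (hv : v ∈ (extSuperBase K V R).endo.par (r : ZMod 2)) (hv' : v ∈ (extSuperBase K V R).endo.fil r) :
    IsSuperfilteredMap (endSuper K V R) (endSuper K V R) r
      (commOp (K := K) (endSuper K V R).sgn v) where
  par i f hf := by
    refine sub_mem ?_ ?_
    · have := (extSuperBase K V R).mul_mem_endo_par hv ((endSuper K V R).sgn_mem_par hf)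
      rw [add_comm] at this
      exact this
    · exact (extSuperBase K V R).mul_mem_endo_par hf hv
  fil p f hf := by
    refine sub_mem ?_ ?_
    · have := (extSuperBase K V R).mul_mem_endo_fil hv' ((endSuper K V R).sgn_mem_fil hf)
      rw [add_comm] at this
      exact this
    · exact (extSuperBase K V R).mul_mem_endo_fil hf hv'

theorem isSuperfilteredMap_negMulRight {v : Module.End R (R ⊗[K] ExteriorAlgebra K V)} {r : ℤ}
    (hv : v ∈ (extSuperBase K V R).endo.par (r : ZMod 2)) (hv' : v ∈ (extSuperBase K V R).endo.fil r) :
    IsSuperfilteredMap (endSuper K V R) (endSuper K V R) r (negMulRight (K := K) v) where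
  par _ _ hf := neg_mem ((extSuperBase K V R).mul_mem_endo_par hf hv)
  fil _ _ hf := neg_mem ((extSuperBase K V R).mul_mem_endo_fil hf hv')

theorem isSuperfilteredMap_commOp_wedge (v : V) :
    IsSuperfilteredMap (endSuper K V R) (endSuper K V R) 1
      (commOp (K := K) (endSuper K V R).sgn (wedge R (ExteriorAlgebra.ι K v))) :=
  isSuperfilteredMap_commOp (by rw [Int.cast_one]; exact (wedge_ι_mem v).1) (wedge_ι_mem v).2

theorem contract_mem_par (φ : Module.Dual K V) :
    contract R φ ∈ (extSuperBase K V R).endo.par ((-1 : ℤ) : ZMod 2) := by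
  rw [show ((-1 : ℤ) : ZMod 2) = 1 by decide]
  exact (contract_mem φ).1

/-- The Koszul differential splits into its leading term and a part which lowers the filtration. -/
theorem μOne_eq (hw : ∑ i, x i * y i = w) (f : Module.End R (R ⊗[K] ExteriorAlgebra K V)) :
    (koszulMF b hw).μOne f =
      -(∑ i, smulOp (x i) *
        commOp (K := K) (endSuper K V R).sgn (wedge R (ExteriorAlgebra.ι K (b i))) :
          Module.End K (Module.End R (R ⊗[K] ExteriorAlgebra K V))) f -
      (∑ i, smulOp (y i) * commOp (K := K) (endSuper K V R).sgn (contract R (b.coord i)) :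
          Module.End K (Module.End R (R ⊗[K] ExteriorAlgebra K V))) f := by
  rw [FilteredMF.μOne_apply, koszulMF_d, ← endSuper_sgn]
  have gen : ∀ {B : Type _} [Ring B] [Algebra R B] (v c : Fin n → B) (f s : B),
      (-∑ i, (x i • v i + y i • c i)) * s - f * (-∑ i, (x i • v i + y i • c i)) =
        -(∑ i, x i • (v i * s - f * v i)) - ∑ i, y i • (c i * s - f * c i) := by
    intro B _ _ v c f s
    simp only [neg_mul, mul_neg, Finset.sum_mul, Finset.mul_sum, add_mul, mul_add, smul_mul_assoc,
      mul_smul_comm, Finset.sum_add_distrib, smul_sub, Finset.sum_sub_distrib]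
    abel
  refine (gen _ _ _ _).trans ?_
  rw [LinearMap.sum_apply, LinearMap.sum_apply]
  rfl

theorem isSuperfilteredMap_smulOp (r : R) :
    IsSuperfilteredMap (endSuper K V R) (endSuper K V R) 0 (smulOp (K := K) (V := V) r) where
  par i f hf := by
    rw [Int.cast_zero, add_zero]
    exact ((extSuperBase K V R).endo.par i).smul_mem r hf
  fil p f hf := by
    rw [add_zero]
    exact ((extSuperBase K V R).endo.fil p).smul_mem r hf

/-- The leading term of the Koszul differential on `End_R(R ⊗ ΛV)`, up to sign. -/
def leadingDifferential (x : Fin n → R) :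
    Module.End K (Module.End R (R ⊗[K] ExteriorAlgebra K V)) :=
  ∑ i, smulOp (x i) * commOp (K := K) (endSuper K V R).sgn (wedge R (ExteriorAlgebra.ι K (b i)))

/-- The part of the Koszul differential on `End_R(R ⊗ ΛV)` which lowers the filtration, up to
sign. -/
def lowerDifferential (y : Fin n → R) :
    Module.End K (Module.End R (R ⊗[K] ExteriorAlgebra K V)) :=
  ∑ i, smulOp (y i) * commOp (K := K) (endSuper K V R).sgn (contract R (b.coord i))

theorem isSuperfilteredMap_lowerDifferential (y : Fin n → R) :
    IsSuperfilteredMap (endSuper K V R) (endSuper K V R) (-1) (lowerDifferential b y) :=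
  IsSuperfilteredMap.sum _ fun i _ => (isSuperfilteredMap_smulOp (y i)).mul
    (isSuperfilteredMap_commOp (contract_mem_par (b.coord i)) (contract_mem_fil (R := R) (b.coord i)))
    rfl

theorem isSuperfilteredMap_koszulProjection (Δ : CoordinateDivision x ε) (i : Fin n) :
    IsSuperfilteredMap (endSuper K V R) (endSuper K V R) 0 (koszulProjection b Δ i) :=
  ((coeffMap_isSuperfilteredMap (V := V) (Δ.res i)).mul
    (isSuperfilteredMap_commOp_wedge (R := R) (b i)) rfl).mul
    (isSuperfilteredMap_negMulRight (contract_mem_par (b.coord i))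
      (contract_mem_fil (R := R) (b.coord i))) rfl

theorem exists_leading_homotopy (Δ : CoordinateDivision x ε) :
    ∃ η : Module.End K (Module.End R (R ⊗[K] ExteriorAlgebra K V)),
      IsSuperfilteredMap (endSuper K V R) (endSuper K V R) (-1) η ∧
      ∀ f, leadingDifferential b x (η f) + η (leadingDifferential b x f) =
        f - wedge R (augReduction ε f) := by
  obtain ⟨-, η, hη, hη'⟩ := (koszulRelations b Δ).exists_homotopy
    (p := fun T => IsSuperfilteredMap (endSuper K V R) (endSuper K V R) 0 T)
    (q := fun T => IsSuperfilteredMap (endSuper K V R) (endSuper K V R) (-1) T)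
    IsSuperfilteredMap.id (fun a c ha hc => ha.mul hc rfl)
    ⟨fun i f _ => zero_mem _, fun p f _ => zero_mem _⟩
    (fun a c ha hc => ha.add hc) (fun a c ha hc => ha.mul hc rfl)
    (isSuperfilteredMap_koszulProjection b Δ)
    (fun i => (coeffMap_isSuperfilteredMap (V := V) (Δ.div i)).mul
      (isSuperfilteredMap_negMulRight (contract_mem_par (b.coord i))
        (contract_mem_fil (R := R) (b.coord i))) rfl)
    (List.finRange n)
  refine ⟨η, hη, fun f => ?_⟩
  rw [← prod_koszulProjection_apply b Δ f]
  exact LinearMap.congr_fun hη' f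

theorem exists_homotopy (Δ : CoordinateDivision x ε) (hw : ∑ i, x i * y i = w)
    (hy : ∀ i, ε (y i) = 0)
    {incl : ExteriorAlgebra K V →ₗ[K] Module.End R (R ⊗[K] ExteriorAlgebra K V)}
    (incl_cocycle : ∀ a, (koszulMF b hw).differential (incl a) = 0) (incl_one : incl 1 = 1)
    (incl_super : IsSuperfilteredMap (extSuper K V) (endSuper K V R) 0 incl)
    (incl_lead : ∀ p : ℕ, ∀ a ∈ ⋀[K]^p V,
      incl a - wedge R a ∈ (endSuper K V R).fil ((p : ℤ) - 1))
    (reduction_incl : ∀ a, augReduction ε (incl a) = a) :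
    ∃ htpy, IsTransfer b hw ε incl htpy := by
  obtain ⟨η, hη, hη'⟩ := exists_leading_homotopy b Δ
  have μι : ∀ a, (koszulMF b hw).μOne (incl a) = 0 := fun a => by
    rw [← (koszulMF b hw).S.endo.sgn_sgn (incl a), FilteredMF.μOne_sgn, ← endSuper_sgn,
      incl_super.map_sgn, Int.cast_zero, uzpow_zero, one_smul]
    exact incl_cocycle _
  obtain ⟨η', h1, h2, h3, h4, h5⟩ := exists_special_homotopy_of_leading
    (D := (koszulMF b hw).μOne.restrictScalars K) incl_super wedgeMap_isSuperfilteredMap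
    (sub_mem_fil_of_lead incl_lead)
    (augReduction_isSuperfilteredMap ε) (μOne_isSuperfilteredMap b hw) hη
    (isSuperfilteredMap_lowerDifferential b y) (fun f => (koszulMF b hw).μOne_μOne f) μι
    (augReduction_μOne b hw ε Δ.eps_x hy) reduction_incl (endSuper_fil_bot b) (endSuper_fil_top b)
    (μOne_eq b hw) hη'
  exact ⟨η', incl_cocycle, incl_one, incl_super, incl_lead, reduction_incl, h1, h2, h3, h4, h5⟩

end Koszul

section Koszul

variable {K : Type u} [CommRing K] {V : Type v} [AddCommGroup V] [Module K V] {n : ℕ}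
  {R : Type*} [CommRing R] [Algebra K R]
  (b : Module.Basis (Fin n) K V) {x y : Fin n → R} {ε : R →ₐ[K] K} {w : R}

/-! ### The inclusion of the minimal model -/

theorem ExteriorAlgebra_basis_eq_prod (s : Finset (Fin n)) :
    b.ExteriorAlgebra s = ((s.sort (· ≤ ·)).map fun i => ExteriorAlgebra.ι K (b i)).prod := by
  rw [ExteriorAlgebra.basis_apply_ofCard b (rfl : s.card = s.card), ExteriorAlgebra.ιMulti_family,
    ExteriorAlgebra.ιMulti_apply, ← Finset.listMap_orderEmbOfFin_finRange s rfl, List.map_map,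
    List.ofFn_eq_map]
  rfl

/-- Homogeneous subspaces of the exterior algebra are spanned by basis vectors. -/
theorem exteriorPower_le_of_basis {p : ℕ} {P : Submodule K (ExteriorAlgebra K V)}
    (h : ∀ s : Finset (Fin n), s.card = p → b.ExteriorAlgebra s ∈ P) : ⋀[K]^p V ≤ P := by
  intro a ha
  have key : ∀ a : ExteriorAlgebra K V,
      (DirectSum.decompose (fun m : ℕ => ⋀[K]^m V) a p : ExteriorAlgebra K V) ∈ P := by
    intro a
    have ha : a ∈ Submodule.span K (Set.range b.ExteriorAlgebra) := b.ExteriorAlgebra.mem_span a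
    induction ha using Submodule.span_induction with
    | zero => rw [DirectSum.decompose_zero]; exact P.zero_mem
    | add a a' _ _ ha ha' => rw [DirectSum.decompose_add]; exact P.add_mem ha ha'
    | smul c a _ ha => rw [DirectSum.decompose_smul]; exact P.smul_mem c ha
    | mem a ha =>
      obtain ⟨s, rfl⟩ := ha
      have hb := basis_mem_exteriorPower b s
      by_cases hs : s.card = p
      · rw [hs] at hb
        rw [DirectSum.decompose_of_mem_same (fun m : ℕ => ⋀[K]^m V) hb]
        exact h s hs
      · rw [DirectSum.decompose_of_mem_ne (fun m : ℕ => ⋀[K]^m V) hb hs]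
        exact P.zero_mem
  have := key a
  rwa [DirectSum.decompose_of_mem_same (fun m : ℕ => ⋀[K]^m V) ha] at this

/-- The operator `v_i ∧ • + ∑_j c_{ij} v_j^∨ ⌟ •` on `R ⊗ ΛV`. -/
def koszulCocycle (c : Fin n → Fin n → R) (i : Fin n) :
    Module.End R (R ⊗[K] ExteriorAlgebra K V) :=
  wedge R (ExteriorAlgebra.ι K (b i)) + ∑ j, c i j • contract R (b.coord j)

theorem clifford_cocycle {B : Type*} [Ring B] [Algebra R B] {v e : Fin n → B} {l : Fin n → R}
    {i : Fin n} (hv : ∀ k, v k * v i + v i * v k = 0) (he : ∀ j k, e j * e k + e k * e j = 0)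
    (hve : ∀ j k, v j * e k + e k * v j = if j = k then 1 else 0) (hy : y i = -∑ j, l j * x j) :
    (-∑ k, (x k • v k + y k • e k)) * (v i + ∑ j, l j • e j) -
      -(v i + ∑ j, l j • e j) * (-∑ k, (x k • v k + y k • e k)) = 0 := by
  set D := ∑ k, (x k • v k + y k • e k) with hD
  have h1 : D * v i + v i * D = y i • (1 : B) := by
    rw [hD, Finset.sum_mul, Finset.mul_sum, ← Finset.sum_add_distrib, Finset.sum_eq_single i]
    · rw [add_mul, mul_add, smul_mul_assoc, smul_mul_assoc, mul_smul_comm, mul_smul_comm,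
        add_add_add_comm, ← smul_add, ← smul_add, hv, smul_zero, zero_add, add_comm (e i * v i), hve,
        if_pos rfl]
    · intro k _ hk
      rw [add_mul, mul_add, smul_mul_assoc, smul_mul_assoc, mul_smul_comm, mul_smul_comm,
        add_add_add_comm, ← smul_add, ← smul_add, hv, smul_zero, zero_add, add_comm (e k * v i), hve,
        if_neg hk.symm, smul_zero]
    · exact fun h => absurd (Finset.mem_univ i) h
  have h2 : ∀ j, D * e j + e j * D = x j • (1 : B) := by
    intro j
    rw [hD, Finset.sum_mul, Finset.mul_sum, ← Finset.sum_add_distrib, Finset.sum_eq_single j]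
    · rw [add_mul, mul_add, smul_mul_assoc, smul_mul_assoc, mul_smul_comm, mul_smul_comm,
        add_add_add_comm, ← smul_add, ← smul_add, he, smul_zero, add_zero, hve, if_pos rfl]
    · intro k _ hk
      rw [add_mul, mul_add, smul_mul_assoc, smul_mul_assoc, mul_smul_comm, mul_smul_comm,
        add_add_add_comm, ← smul_add, ← smul_add, he, smul_zero, add_zero, hve, if_neg hk, smul_zero]
    · exact fun h => absurd (Finset.mem_univ j) h
  clear_value D
  have h3 : D * (∑ j, l j • e j) + (∑ j, l j • e j) * D = (∑ j, l j * x j) • (1 : B) := by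
    rw [Finset.sum_mul, Finset.mul_sum, ← Finset.sum_add_distrib, Finset.sum_smul]
    refine Finset.sum_congr rfl fun j _ => ?_
    rw [mul_smul_comm, smul_mul_assoc, ← smul_add, h2, smul_smul]
  have h4 : -D * (v i + ∑ j, l j • e j) - -(v i + ∑ j, l j • e j) * -D =
      -((D * v i + v i * D) + (D * (∑ j, l j • e j) + (∑ j, l j • e j) * D)) := by
    noncomm_ring
  rw [h4, h1, h3, hy, neg_smul, neg_add_cancel, neg_zero]

theorem koszulCocycle_par (c : Fin n → Fin n → R) (i : Fin n) :
    koszulCocycle b c i ∈ (extSuperBase K V R).endo.par 1 :=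
  add_mem (wedge_ι_mem _).1 (sum_mem fun _ _ =>
    ((extSuperBase K V R).endo.par 1).smul_mem _ (contract_mem _).1)

theorem sum_contract_mem_fil (c : Fin n → Fin n → R) (i : Fin n) :
    ∑ j, c i j • contract R (b.coord j) ∈ (extSuperBase K V R).endo.fil (-1) :=
  sum_mem fun _ _ => ((extSuperBase K V R).endo.fil (-1)).smul_mem _ (contract_mem_fil _)

theorem koszulCocycle_fil (c : Fin n → Fin n → R) (i : Fin n) :
    koszulCocycle b c i ∈ (extSuperBase K V R).endo.fil 1 :=
  add_mem (wedge_ι_mem _).2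
    ((extSuperBase K V R).endo.mono (by norm_num) (sum_contract_mem_fil b c i))

theorem differential_koszulCocycle (hw : ∑ i, x i * y i = w) {c : Fin n → Fin n → R}
    (hc : ∀ i, y i = -∑ j, c i j * x j) (i : Fin n) :
    (koszulMF b hw).differential (koszulCocycle b c i) = 0 := by
  rw [FilteredMF.differential_apply, ← endSuper_sgn, endSuper_sgn_of_odd (koszulCocycle_par b c i)]
  refine clifford_cocycle (v := fun i => wedge R (ExteriorAlgebra.ι K (b i)))
    (e := fun i => contract R (b.coord i)) (fun k => wedge_wedge_add _ _)
    (fun j k => contract_contract_add _ _) (fun j k => ?_) (hc i)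
  rw [wedge_contract_add, Module.Basis.coord_apply, Module.Basis.repr_self, Finsupp.single_apply]
  split_ifs
  · rw [map_one, one_smul]
  · rw [map_zero, zero_smul]

theorem FilteredMF.differential_list_prod {X : Type*} [AddCommGroup X] [Module R X]
    (M : FilteredMF R w X) {l : List (Module.End R X)} (h : ∀ f ∈ l, M.differential f = 0) :
    M.differential l.prod = 0 := by
  induction l with
  | nil => exact M.differential_one
  | cons f l ih =>
    rw [List.prod_cons, M.differential_mul, h f List.mem_cons_self,
      ih fun g hg => h g (List.mem_cons_of_mem _ hg), zero_mul, mul_zero, add_zero]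

/-- The linear map which sends `v_{i_1} ∧ ⋯ ∧ v_{i_r}`, for `i_1 < ⋯ < i_r`, to the product of the
operators `v_i ∧ • + ∑_j c_{ij} v_j^∨ ⌟ •`, for `i = i_1, …, i_r`. -/
def koszulIncl (c : Fin n → Fin n → R) :
    ExteriorAlgebra K V →ₗ[K] Module.End R (R ⊗[K] ExteriorAlgebra K V) :=
  b.ExteriorAlgebra.constr K fun s => ((s.sort (· ≤ ·)).map (koszulCocycle b c)).prod

theorem koszulIncl_basis (c : Fin n → Fin n → R) (s : Finset (Fin n)) :
    koszulIncl b c (b.ExteriorAlgebra s) = ((s.sort (· ≤ ·)).map (koszulCocycle b c)).prod :=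
  b.ExteriorAlgebra.constr_basis K _ s

theorem koszulIncl_one (c : Fin n → Fin n → R) : koszulIncl b c 1 = 1 := by
  have h := koszulIncl_basis b c ∅
  rw [ExteriorAlgebra_basis_eq_prod] at h
  simpa using h

theorem differential_koszulIncl (hw : ∑ i, x i * y i = w) {c : Fin n → Fin n → R}
    (hc : ∀ i, y i = -∑ j, c i j * x j) (a : ExteriorAlgebra K V) :
    (koszulMF b hw).differential (koszulIncl b c a) = 0 := by
  have key : (koszulMF b hw).differential.restrictScalars K ∘ₗ koszulIncl b c = 0 :=
    b.ExteriorAlgebra.ext fun s => by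
      rw [LinearMap.comp_apply, koszulIncl_basis, LinearMap.zero_apply]
      refine (koszulMF b hw).differential_list_prod fun f hf => ?_
      obtain ⟨i, -, rfl⟩ := List.mem_map.1 hf
      exact differential_koszulCocycle b hw hc i
  exact LinearMap.congr_fun key a

theorem list_prod_koszulCocycle_mem (c : Fin n → Fin n → R) (l : List (Fin n)) :
    (l.map (koszulCocycle b c)).prod ∈ (extSuperBase K V R).endo.par l.length ∧
    (l.map (koszulCocycle b c)).prod ∈ (extSuperBase K V R).endo.fil l.length := by
  induction l with
  | nil => exact ⟨by simpa using (extSuperBase K V R).one_mem_endo_par,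
      by simpa using (extSuperBase K V R).one_mem_endo_fil⟩
  | cons i l ih =>
    rw [List.map_cons, List.prod_cons, List.length_cons, Nat.cast_succ, Nat.cast_succ,
      add_comm _ 1, add_comm _ 1]
    exact ⟨(extSuperBase K V R).mul_mem_endo_par (koszulCocycle_par b c i) ih.1,
      (extSuperBase K V R).mul_mem_endo_fil (koszulCocycle_fil b c i) ih.2⟩

theorem list_prod_koszulCocycle_sub_mem (c : Fin n → Fin n → R) (l : List (Fin n)) :
    (l.map (koszulCocycle b c)).prod -
      wedge R (l.map fun i => ExteriorAlgebra.ι K (b i)).prod ∈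
      (extSuperBase K V R).endo.fil ((l.length : ℤ) - 1) := by
  induction l with
  | nil =>
    rw [List.map_nil, List.map_nil, List.prod_nil, List.prod_nil, wedge_one]
    exact (sub_self (1 : Module.End R (R ⊗[K] ExteriorAlgebra K V))) ▸ zero_mem _
  | cons i l ih =>
    rw [List.map_cons, List.prod_cons, List.map_cons, List.prod_cons, List.length_cons, wedge_mul]
    have gen : ∀ {B : Type _} [Ring B] (v s P Q : B), (v + s) * P - v * Q = s * P + v * (P - Q) := by
      intros; noncomm_ring
    have e1 := (extSuperBase K V R).mul_mem_endo_fil (sum_contract_mem_fil b c i)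
      (list_prod_koszulCocycle_mem b c l).2
    have e2 := (extSuperBase K V R).mul_mem_endo_fil (wedge_ι_mem (R := R) (b i)).2 ih
    have e3 := gen (wedge R (ExteriorAlgebra.ι K (b i))) (∑ j, c i j • contract R (b.coord j))
      (l.map (koszulCocycle b c)).prod (wedge R (l.map fun i => ExteriorAlgebra.ι K (b i)).prod)
    have e4 : (koszulCocycle b c i * (l.map (koszulCocycle b c)).prod -
        wedge R (ExteriorAlgebra.ι K (b i)) *
          wedge R (l.map fun i => ExteriorAlgebra.ι K (b i)).prod) = _ := e3
    rw [e4]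
    exact add_mem ((extSuperBase K V R).endo.mono (by push_cast; omega) e1)
      ((extSuperBase K V R).endo.mono (by push_cast; omega) e2)

theorem koszulIncl_isSuperfilteredMap (c : Fin n → Fin n → R) :
    IsSuperfilteredMap (extSuper K V) (endSuper K V R) 0 (koszulIncl b c) := by
  refine Superfiltration.isSuperfilteredMap_ofGrading _ fun m a ha => ?_
  refine exteriorPower_le_of_basis b (P := ((endSuper K V R).par _ ⊓
    (endSuper K V R).fil _).comap (koszulIncl b c)) (fun s hs => ?_) ha
  rw [Submodule.mem_comap, koszulIncl_basis, Int.cast_zero, add_zero, add_zero]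
  have := list_prod_koszulCocycle_mem b c (s.sort (· ≤ ·))
  rw [Finset.length_sort, hs] at this
  exact this

theorem map_sub_mem_of_basis {B : Type*} [AddCommGroup B] [Module K B] {P : Submodule K B} {p : ℕ}
    (T W : ExteriorAlgebra K V →ₗ[K] B) (h : ∀ s : Finset (Fin n), s.card = p →
      T (b.ExteriorAlgebra s) - W (b.ExteriorAlgebra s) ∈ P) {a : ExteriorAlgebra K V}
    (ha : a ∈ ⋀[K]^p V) : T a - W a ∈ P :=
  exteriorPower_le_of_basis b (P := P.comap (T - W)) h ha

theorem koszulIncl_lead (c : Fin n → Fin n → R) (p : ℕ) (a : ExteriorAlgebra K V)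
    (ha : a ∈ ⋀[K]^p V) :
    koszulIncl b c a - wedge R a ∈ (endSuper K V R).fil ((p : ℤ) - 1) := by
  refine map_sub_mem_of_basis b (P := (endSuper K V R).fil ((p : ℤ) - 1)) (koszulIncl b c)
    (wedgeMap R) (fun s hs => ?_) ha
  rw [koszulIncl_basis]
  have := list_prod_koszulCocycle_sub_mem b c (s.sort (· ≤ ·))
  rw [Finset.length_sort, hs, ← ExteriorAlgebra_basis_eq_prod] at this
  exact this

theorem contractLeft_list_prod {j : Fin n} {l : List (Fin n)} (h : j ∉ l) :
    CliffordAlgebra.contractLeft (Q := (0 : QuadraticForm K V)) (b.coord j)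
      (l.map fun i => ExteriorAlgebra.ι K (b i)).prod = 0 := by
  induction l with
  | nil => exact CliffordAlgebra.contractLeft_one _ _
  | cons i l ih =>
    rw [List.map_cons, List.prod_cons]
    refine (CliffordAlgebra.contractLeft_ι_mul _ _ _).trans ?_
    have hij : i ≠ j := fun hij => h (hij ▸ List.mem_cons_self)
    rw [ih fun hj => h (List.mem_cons_of_mem _ hj), mul_zero, sub_zero, Module.Basis.coord_apply,
      Module.Basis.repr_self, Finsupp.single_eq_of_ne hij.symm, zero_smul]

/-- If `c_{ij}` vanishes at the origin for `i < j`, then the contraction terms do not contribute to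
the value at `1` of an ordered product, because no index `j > i` is affected. -/
theorem augReduction_list_prod {c : Fin n → Fin n → R} (hc : ∀ i j, i < j → ε (c i j) = 0)
    (l : List (Fin n)) (hl : l.Pairwise (· < ·)) :
    augReduction ε (l.map (koszulCocycle b c)).prod =
      (l.map fun i => ExteriorAlgebra.ι K (b i)).prod := by
  induction l with
  | nil => exact augReduction_one ε
  | cons i l ih =>
    obtain ⟨h1, h2⟩ := List.pairwise_cons.1 hl
    have e : augReduction ε (koszulCocycle b c i * (l.map (koszulCocycle b c)).prod) =
        ExteriorAlgebra.ι K (b i) * augReduction ε (l.map (koszulCocycle b c)).prod +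
          ∑ j, ε (c i j) • CliffordAlgebra.contractLeft (Q := (0 : QuadraticForm K V)) (b.coord j)
            (augReduction ε (l.map (koszulCocycle b c)).prod) := by
      rw [augReduction_apply, augReduction_apply, Module.End.mul_apply, koszulCocycle,
        LinearMap.add_apply, map_add, redMod_wedge, LinearMap.sum_apply, map_sum]
      congr 1
      refine Finset.sum_congr rfl fun j _ => ?_
      rw [LinearMap.smul_apply, redMod_smul, redMod_contract]
    rw [List.map_cons, List.prod_cons, e, ih h2, List.map_cons, List.prod_cons,
      Finset.sum_eq_zero, add_zero]
    intro j _
    by_cases hj : j ∈ l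
    · rw [hc i j (h1 j hj), zero_smul]
    · rw [contractLeft_list_prod b hj, smul_zero]

theorem augReduction_koszulIncl {c : Fin n → Fin n → R} (hc : ∀ i j, i < j → ε (c i j) = 0)
    (a : ExteriorAlgebra K V) : augReduction ε (koszulIncl b c a) = a := by
  have key : augReduction ε ∘ₗ koszulIncl b c = LinearMap.id :=
    b.ExteriorAlgebra.ext fun s => by
      rw [LinearMap.comp_apply, koszulIncl_basis,
        augReduction_list_prod b hc _ (Finset.sortedLT_sort s).pairwise, LinearMap.id_apply,
        ExteriorAlgebra_basis_eq_prod]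
  exact LinearMap.congr_fun key a

end Koszul

section Existence

/-! ### Existence of transfer data -/

/-- If `T` agrees to leading order with a section `W` of `π`, then `π T` is unipotent, and `T`
composed with the inverse of `π T` is a section of `π`. -/
theorem exists_normalised_section {K E B : Type*} [CommRing K] [AddCommGroup E] [Module K E]
    [AddCommGroup B] [Module K B] {S : Superfiltration K E} {S' : Superfiltration K B}
    {T W : E →ₗ[K] B} {π : B →ₗ[K] E} (hT : IsSuperfilteredMap S S' 0 T)
    (hπ : IsSuperfilteredMap S' S 0 π) (hTW : ∀ p, ∀ a ∈ S.fil p, W a - T a ∈ S'.fil (p - 1))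
    (hπW : ∀ a, π (W a) = a) {p q : ℤ} (hp : S.fil p = ⊥) (hq : S.fil q = ⊤) :
    ∃ U : E →ₗ[K] E, IsSuperfilteredMap S S' 0 (T ∘ₗ U) ∧ (∀ a, π (T (U a)) = a) ∧
      (∀ p, ∀ a ∈ S.fil p, T (U a) - W a ∈ S'.fil (p - 1)) ∧
      ∀ a, π (T a) = a → U a = a := by
  have hπT : IsSuperfilteredMap S S 0 (π ∘ₗ T) := hπ.comp hT
  obtain ⟨U, hU, h1, h2, h3⟩ := exists_inverse_one_sub (S := S) (N := LinearMap.id - π ∘ₗ T)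
    (fun i a ha => by
      have := hπT.par i a ha
      rw [Int.cast_zero, add_zero] at this
      exact sub_mem ha this)
    (fun p a ha => by
      have := hπ.fil _ _ (hTW p a ha)
      rw [map_sub, hπW, add_zero] at this
      exact this) hp hq
  refine ⟨U, hT.comp hU, fun a => ?_, fun p a ha => ?_, fun a ha => ?_⟩
  · have := h2 a
    rwa [LinearMap.sub_apply, LinearMap.id_apply, LinearMap.comp_apply, sub_sub_cancel] at this
  · rw [← sub_add_sub_cancel _ (T a), ← map_sub]
    refine add_mem ?_ (by simpa only [neg_sub] using neg_mem (hTW p a ha))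
    have := hT.fil _ _ (h3 p a ha)
    rwa [add_zero] at this
  · have := h1 a
    rwa [LinearMap.sub_apply, LinearMap.id_apply, LinearMap.comp_apply, ha, sub_self,
      sub_zero] at this

variable {K : Type u} [CommRing K] {V : Type v} [AddCommGroup V] [Module K V] {n : ℕ}

theorem coeff_list_prod_restrictX (l : List (Fin n)) (r : FormalFunctions K n) (m : Fin n →₀ ℕ) :
    MvPowerSeries.coeff m ((l.map restrictX : List (Module.End K (FormalFunctions K n))).prod r) =
      if ∀ i ∈ l, m i = 0 then MvPowerSeries.coeff m r else 0 := by
  induction l with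
  | nil => simp
  | cons i l ih =>
    rw [List.map_cons, List.prod_cons, Module.End.mul_apply, coeff_restrictX, ih, ← ite_and]
    simp

/-- Division of formal functions by the coordinates. -/
def coordinateDivision (K : Type u) [CommRing K] (n : ℕ) :
    CoordinateDivision (MvPowerSeries.X : Fin n → FormalFunctions K n) (augmentation K n) where
  div := divX
  res := restrictX
  mul_div := X_mul_divX
  div_mul := divX_X_mul
  div_mul_of_ne _ _ h r := divX_X_mul_of_ne h r
  res_mul_of_ne i j h r := by
    rw [← sub_sub_cancel (MvPowerSeries.X j * r) (restrictX i (MvPowerSeries.X j * r)),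
      ← X_mul_divX, divX_X_mul_of_ne h, mul_left_comm, X_mul_divX, mul_sub, sub_sub_cancel]
  res_res := restrictX_restrictX
  res_comm := restrictX_comm
  eps_x := augmentation_X
  res_prod r := by
    ext m
    rw [coeff_list_prod_restrictX, MvPowerSeries.algebraMap_apply]
    classical
    rw [Algebra.algebraMap_self, RingHom.id_apply, MvPowerSeries.coeff_C]
    by_cases h : m = 0
    · subst h
      rw [if_pos (by simp), if_pos rfl]
      rfl
    · rw [if_neg h, if_neg]
      exact fun h' => h (Finsupp.ext fun i => h' i (List.mem_finRange i))

variable (b : Module.Basis (Fin n) K V) {ŵ : Fin n → FormalFunctions K n}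
  {w : FormalFunctions K n} (hw : ∑ i, MvPowerSeries.X i * ŵ i = w)

theorem exists_transferData_of_triangular {c : Fin n → Fin n → FormalFunctions K n}
    (hc : ∀ i, ŵ i = -∑ j, c i j * MvPowerSeries.X j)
    (hc' : ∀ i j, i < j → c i j ∈ maxIdeal K n) (hŵ : ∀ i, ŵ i ∈ maxIdeal K n) :
    ∃ T : TransferData b ŵ hw, ∀ s : Finset (Fin n),
      T.incl ((s.sort (· ≤ ·)).map (fun i => ExteriorAlgebra.ι K (b i))).prod =
        ((s.sort (· ≤ ·)).map (correctedCocycle b c)).prod := by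
  obtain ⟨η, hη⟩ := exists_homotopy b (coordinateDivision K n) hw
    (fun i => augmentation_of_mem (hŵ i)) (differential_koszulIncl b hw hc) (koszulIncl_one b c)
    (koszulIncl_isSuperfilteredMap b c) (koszulIncl_lead b c)
    (augReduction_koszulIncl b fun i j h => augmentation_of_mem (hc' i j h))
  refine ⟨TransferData.ofIsTransfer hη, fun s => ?_⟩
  rw [← ExteriorAlgebra_basis_eq_prod]
  exact koszulIncl_basis b c s

/-- For an arbitrary choice of the coefficients `c`, the composition of `ι` with the projection is
the identity only to leading order, and is corrected for by inverting it. -/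
theorem nonempty_transferData (hŵ : ∀ i, ŵ i ∈ maxIdeal K n) :
    Nonempty (TransferData b ŵ hw) := by
  have hex : ∀ i, ∃ c : Fin n → FormalFunctions K n, ŵ i = -∑ j, c j * MvPowerSeries.X j := by
    intro i
    obtain ⟨c, -, hc⟩ := exists_sum_X_mul (N := 0)
      (show ŵ i ∈ ordIdeal K n (0 + 1) by rw [zero_add, ordIdeal_one]; exact hŵ i)
    exact ⟨fun j => -c j, by
      rw [hc, ← Finset.sum_neg_distrib]
      exact Finset.sum_congr rfl fun j _ => by rw [neg_mul, neg_neg, mul_comm]⟩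
  choose c hc using hex
  obtain ⟨U, hU, h1, h2, h3⟩ := exists_normalised_section (koszulIncl_isSuperfilteredMap b c)
    (augReduction_isSuperfilteredMap (augmentation K n))
    (W := wedgeMap (FormalFunctions K n)) (sub_mem_fil_of_lead (koszulIncl_lead b c))
    (augReduction_wedge _) (ext_fil_neg_one) (ext_fil_eq_top b)
  obtain ⟨η, hη⟩ := exists_homotopy (incl := koszulIncl b c ∘ₗ U) b (coordinateDivision K n) hw
    (fun i => augmentation_of_mem (hŵ i)) (fun a => differential_koszulIncl b hw hc (U a))
    ((congrArg _ (h3 1 (by rw [koszulIncl_one]; exact augReduction_one _))).trans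
      (koszulIncl_one b c)) hU
    (fun p a ha => h2 p a (ext_fil ha)) h1
  exact ⟨TransferData.ofIsTransfer hη⟩

end Existence

/-! ### Sums of homogeneous terms -/

section Monomials

variable {K : Type u} [CommRing K] {n : ℕ}

/-- The monomial `x_{s_1} ⋯ x_{s_k}`. -/
def coordMonomial (K : Type u) [CommRing K] {n k : ℕ} (s : Fin k → Fin n) : FormalFunctions K n :=
  ∏ j, MvPowerSeries.X (s j)

theorem coordMonomial_eq {k : ℕ} (s : Fin k → Fin n) :
    coordMonomial K s = MvPowerSeries.monomial (∑ j, Finsupp.single (s j) 1) 1 := by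
  rw [coordMonomial]
  induction k with
  | zero => rw [Finset.univ_eq_empty, Finset.prod_empty, Finset.sum_empty]; rfl
  | succ k ih =>
    rw [Fin.prod_univ_succ, Fin.sum_univ_succ, ih fun j => s j.succ, MvPowerSeries.X,
      MvPowerSeries.monomial_mul_monomial, one_mul]

theorem degree_sum_single {k : ℕ} (s : Fin k → Fin n) :
    (∑ j, Finsupp.single (s j) 1 : Fin n →₀ ℕ).degree = k := by
  rw [map_sum]
  simp

theorem coordMonomial_mem {k : ℕ} (s : Fin k → Fin n) : coordMonomial K s ∈ ordIdeal K n k := by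
  rw [coordMonomial_eq]
  exact monomial_mem_ordIdeal _ (degree_sum_single s).ge _

theorem coordMonomial_comp_perm {k : ℕ} (s : Fin k → Fin n) (e : Equiv.Perm (Fin k)) :
    coordMonomial K (s ∘ e) = coordMonomial K s :=
  Equiv.prod_comp e fun j => (MvPowerSeries.X (s j) : FormalFunctions K n)

theorem smul_mem_ordIdeal {N : ℕ} (c : K) {f : FormalFunctions K n} (hf : f ∈ ordIdeal K n N) :
    c • f ∈ ordIdeal K n N := fun m hm => by
  rw [MvPowerSeries.coeff_smul, hf m hm, mul_zero]

/-- The sum of a sequence of formal functions `Q k`, `k ≥ l`, such that `Q k` vanishes to order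
`k`. -/
def assemble (l : ℕ) (Q : ℕ → FormalFunctions K n) : FormalFunctions K n :=
  fun m => ∑ k ∈ Finset.Icc l m.degree, MvPowerSeries.coeff m (Q k)

theorem coeff_assemble (l : ℕ) (Q : ℕ → FormalFunctions K n) (m : Fin n →₀ ℕ) :
    MvPowerSeries.coeff m (assemble l Q) =
      ∑ k ∈ Finset.Icc l m.degree, MvPowerSeries.coeff m (Q k) := rfl

theorem assemble_sub_mem {Q : ℕ → FormalFunctions K n} (hQ : ∀ k, Q k ∈ ordIdeal K n k)
    (l N : ℕ) : assemble l Q - ∑ k ∈ Finset.Icc l N, Q k ∈ ordIdeal K n (N + 1) := by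
  intro m hm
  rw [map_sub, map_sum, coeff_assemble, sub_eq_zero]
  refine Finset.sum_subset (Finset.Icc_subset_Icc_right (by omega)) fun k hk hk' => hQ k m ?_
  rw [Finset.mem_Icc] at hk hk'
  omega

theorem assemble_mem (Q : ℕ → FormalFunctions K n) (N : ℕ) :
    assemble N Q ∈ ordIdeal K n N := by
  intro m hm
  rw [coeff_assemble, Finset.Icc_eq_empty (by omega), Finset.sum_empty]

theorem sum_eq_zero_of_swap {X : Type*} [AddCommGroup X] {k : ℕ} {i j : Fin k}
    (g : (Fin k → Fin n) → X) (h1 : ∀ s, g s + g (s ∘ Equiv.swap i j) = 0)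
    (h2 : ∀ s, s i = s j → g s = 0) : ∑ s, g s = 0 := by
  refine Finset.sum_involution (fun s _ => s ∘ Equiv.swap i j) (fun s _ => h1 s)
    (fun s _ hs he => hs (h2 s ?_)) (fun s _ => Finset.mem_univ _) (fun s _ => ?_)
  · have := congrFun he i
    rw [Function.comp_apply, Equiv.swap_apply_left] at this
    exact this.symm
  · funext q
    simp

end Monomials

section Potential

variable {K : Type u} [CommRing K] {V : Type v} [AddCommGroup V] [Module K V] {n : ℕ}

/-- The sequence `v_{s_1}, …, v_{s_k}, 0, 0, …`. -/
def basisSeq (b : Module.Basis (Fin n) K V) {k : ℕ} (s : Fin k → Fin n) : ℕ → V :=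
  extendZero fun j => b (s j)

theorem basisSeq_coe (b : Module.Basis (Fin n) K V) {k : ℕ} (s : Fin k → Fin n) (j : Fin k) :
    basisSeq b s j = b (s j) := extendZero_coe _ j

theorem basisSeq_swap (b : Module.Basis (Fin n) K V) {k : ℕ} (s : Fin k → Fin n) {i j : Fin k}
    {q : ℕ} (hi : q ≠ i) (hj : q ≠ j) : basisSeq b (s ∘ Equiv.swap i j) q = basisSeq b s q := by
  by_cases hq : q < k
  · rw [basisSeq, basisSeq, extendZero_of_lt _ hq, extendZero_of_lt _ hq, Function.comp_apply,
      Equiv.swap_apply_of_ne_of_ne (fun h => hi (congrArg Fin.val h))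
        (fun h => hj (congrArg Fin.val h))]
  · rw [basisSeq, basisSeq, extendZero, extendZero, dif_neg hq, dif_neg hq]

theorem ι_mul_ι_swap (x y : V) : ExteriorAlgebra.ι K x * ExteriorAlgebra.ι K y =
    -(ExteriorAlgebra.ι K y * ExteriorAlgebra.ι K x) :=
  eq_neg_of_add_eq_zero_left (ExteriorAlgebra.ι_add_mul_swap x y)

theorem algebraMapInv_ι (x : V) :
    ExteriorAlgebra.algebraMapInv (ExteriorAlgebra.ι K x) = (0 : K) := by
  simp [ExteriorAlgebra.algebraMapInv]

theorem ι_mem_par (x : V) : ExteriorAlgebra.ι K x ∈ (extSuper K V).par 1 := by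
  simpa using ext_par (ι_mem_exteriorPower (K := K) x)

theorem ι_mem_fil (x : V) : ExteriorAlgebra.ι K x ∈ (extSuper K V).fil 1 := by
  simpa using ext_fil (ι_mem_exteriorPower (K := K) x)

theorem Superfiltration.mem_fil_of_step {X : Type*} [AddCommGroup X] [Module K X]
    (S : Superfiltration K X) {p : ℤ} {x : X} (h : x ∈ S.fil (p + 1))
    (h' : x ∈ S.par (p : ZMod 2)) : x ∈ S.fil p := by
  have : x ∈ S.fil (p + 1) ⊓ S.par (p : ZMod 2) := ⟨h, h'⟩
  rw [S.step] at this
  exact this.1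

namespace Deformation

variable (A : Deformation K V)

/-- On odd generators, the operations of a deformation take values in the ground ring, up to the
exterior product. -/
theorem app_ι {j : ℕ} (hj : 2 ≤ j) (u : ℕ → V) :
    A.μ.app j (fun q => ExteriorAlgebra.ι K (u q)) =
      algebraMap K _ (ExteriorAlgebra.algebraMapInv
        (A.μ.app j fun q => ExteriorAlgebra.ι K (u q))) -
      if j = 2 then ExteriorAlgebra.ι K (u 1) * ExteriorAlgebra.ι K (u 0) else 0 := by
  set x := A.μ.app j fun q => ExteriorAlgebra.ι K (u q) with hx
  set y : ExteriorAlgebra K V :=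
    if j = 2 then ExteriorAlgebra.ι K (u 1) * ExteriorAlgebra.ι K (u 0) else 0 with hy
  have hxp : x ∈ (extSuper K V).par 0 := by
    have := A.isAInf.superfiltered.par j (by omega) (fun _ => 1) _ fun i => ι_mem_par (u i)
    simpa [show (1 + 1 : ZMod 2) = 0 by decide] using this
  have hyp : y ∈ (extSuper K V).par 0 := by
    rw [hy]
    split_ifs
    · have := ext_par (mul_mem_exteriorPower (ι_mem_exteriorPower (K := K) (u 1))
        (ι_mem_exteriorPower (u 0)))
      rwa [show ((1 + 1 : ℕ) : ZMod 2) = 0 by decide] at this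
    · exact zero_mem _
  have hxy : x + y ∈ (extSuper K V).fil 1 := by
    by_cases h2 : j = 2
    · subst h2
      have := A.leading_two 1 1 _ (ι_mem_exteriorPower (u 0)) _ (ι_mem_exteriorPower (u 1))
      rw [pow_one, Units.neg_smul, one_smul, sub_neg_eq_add] at this
      rw [hy, if_pos rfl, hx, Ops.app]
      convert! this using 3
      funext q
      fin_cases q <;> rfl
    · rw [hy, if_neg h2, add_zero, hx]
      have := A.leading_higher j (by omega) (fun _ => 1)
        (fun q => ExteriorAlgebra.ι K (u q)) fun q => ι_mem_exteriorPower (u q)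
      simpa [Ops.app] using this
  have h0 : x + y ∈ (extSuper K V).fil 0 :=
    (extSuper K V).mem_fil_of_step (by simpa using hxy) (by simpa using add_mem hxp hyp)
  have hy0 : ExteriorAlgebra.algebraMapInv y = (0 : K) := by
    rw [hy]
    split_ifs
    · rw [map_mul, algebraMapInv_ι, zero_mul]
    · exact map_zero _
  have := mem_range_algebraMap_of_fil_zero h0
  rw [map_add, hy0, add_zero] at this
  rw [← this, add_sub_cancel_right]

theorem app_zero (a : ℕ → ExteriorAlgebra K V) : A.μ.app 0 a = 0 := by
  rw [Ops.app, A.isAInf.curvature]; rfl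

theorem app_one (a : ℕ → ExteriorAlgebra K V) : A.μ.app 1 a = 0 := by
  rw [Ops.app, A.minimal]; rfl

/-- The coefficient of `1` in `μ^k(v_{s_k}, …, v_{s_1})`. -/
def discCoeff (b : Module.Basis (Fin n) K V) {k : ℕ} (s : Fin k → Fin n) : K :=
  ExteriorAlgebra.algebraMapInv (A.μ k fun j => ExteriorAlgebra.ι K (b (s j)))

theorem app_basisSeq (b : Module.Basis (Fin n) K V) {k : ℕ} (s : Fin k → Fin n) :
    A.μ.app k (fun q => ExteriorAlgebra.ι K (basisSeq b s q)) =
      A.μ k fun j => ExteriorAlgebra.ι K (b (s j)) := by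
  rw [Ops.app]
  congr 1
  funext j
  rw [basisSeq_coe]

theorem discCoeff_of_lt (b : Module.Basis (Fin n) K V) {k : ℕ} (hk : k < 2) (s : Fin k → Fin n) :
    A.discCoeff b s = 0 := by
  rw [discCoeff, ← app_basisSeq]
  interval_cases k
  · rw [app_zero, map_zero]
  · rw [app_one, map_zero]

/-- The homogeneous component `μ^k(𝐯, …, 𝐯)` of the disc potential. -/
def discTerm (b : Module.Basis (Fin n) K V) (k : ℕ) : FormalFunctions K n :=
  ∑ s : Fin k → Fin n, A.discCoeff b s • coordMonomial K s

theorem discTerm_mem (b : Module.Basis (Fin n) K V) (k : ℕ) :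
    A.discTerm b k ∈ ordIdeal K n k :=
  sum_mem fun s _ => smul_mem_ordIdeal _ (coordMonomial_mem s)

theorem discTerm_of_lt (b : Module.Basis (Fin n) K V) {k : ℕ} (hk : k < 2) :
    A.discTerm b k = 0 :=
  Finset.sum_eq_zero fun s _ => by rw [A.discCoeff_of_lt b hk, zero_smul]

theorem map_diagonalTerm (b : Module.Basis (Fin n) K V) (k : ℕ) :
    MvPowerSeries.map (ExteriorAlgebra.algebraMapInv (R := K) (M := V)).toRingHom
      (A.diagonalTerm b k) = A.discTerm b k := by
  rw [diagonalTerm, discTerm, map_sum]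
  refine Finset.sum_congr rfl fun s _ => ?_
  rw [MvPowerSeries.map_monomial, coordMonomial_eq, ← map_smul, smul_eq_mul, mul_one]
  rfl

theorem coeff_potentialE (b : Module.Basis (Fin n) K V) (m : Fin n →₀ ℕ) :
    MvPowerSeries.coeff m (A.potentialE b) =
      ∑ k ∈ Finset.Icc 2 m.degree, MvPowerSeries.coeff m (A.diagonalTerm b k) := rfl

theorem discPotential_eq (b : Module.Basis (Fin n) K V) :
    A.discPotential b = assemble 2 (A.discTerm b) := by
  ext m
  rw [coeff_assemble, discPotential, MvPowerSeries.coeff_map, coeff_potentialE, map_sum]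
  refine Finset.sum_congr rfl fun k _ => ?_
  rw [← map_diagonalTerm, MvPowerSeries.coeff_map]

theorem discPotential_mem (b : Module.Basis (Fin n) K V) :
    A.discPotential b ∈ maxIdeal K n ^ 2 := by
  rw [← ordIdeal_eq_pow, discPotential_eq]
  exact assemble_mem (A.discTerm b) 2

theorem discPotential_sub_mem (b : Module.Basis (Fin n) K V) (N : ℕ) :
    A.discPotential b - ∑ k ∈ Finset.Icc 1 N, A.discTerm b k ∈ ordIdeal K n (N + 1) := by
  have h := assemble_sub_mem (A.discTerm_mem b) 2 N
  rw [← discPotential_eq] at h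
  convert h using 2
  refine (Finset.sum_subset (Finset.Icc_subset_Icc_left (by norm_num)) fun k hk hk' => ?_).symm
  rw [Finset.mem_Icc] at hk hk'
  exact A.discTerm_of_lt b (by omega)

/-- The values `μ^k(𝐯, …, 𝐯)` have coefficients in the ground ring: the exterior products in the
leading term of `μ^2` cancel by antisymmetry. -/
theorem diagonalTerm_eq (b : Module.Basis (Fin n) K V) {k : ℕ} (hk : 2 ≤ k) :
    A.diagonalTerm b k =
      MvPowerSeries.map (algebraMap K (ExteriorAlgebra K V)) (A.discTerm b k) := by
  have hl : ∀ s : Fin k → Fin n,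
      MvPowerSeries.map (algebraMap K (ExteriorAlgebra K V))
        (A.discCoeff b s • coordMonomial K s) =
      MvPowerSeries.monomial (∑ j, Finsupp.single (s j) 1)
        (algebraMap K (ExteriorAlgebra K V) (A.discCoeff b s)) := by
    intro s
    rw [coordMonomial_eq, ← map_smul, smul_eq_mul, mul_one, MvPowerSeries.map_monomial]
  rw [diagonalTerm, discTerm, map_sum, ← sub_eq_zero, ← Finset.sum_sub_distrib]
  have hterm : ∀ s : Fin k → Fin n,
      MvPowerSeries.monomial (∑ j, Finsupp.single (s j) 1)
        (A.μ k fun j => ExteriorAlgebra.ι K (b (s j))) -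
      MvPowerSeries.map (algebraMap K (ExteriorAlgebra K V))
        (A.discCoeff b s • coordMonomial K s) =
      MvPowerSeries.monomial (∑ j, Finsupp.single (s j) 1)
        (-if k = 2 then ExteriorAlgebra.ι K (basisSeq b s 1) * ExteriorAlgebra.ι K (basisSeq b s 0)
          else 0) := by
    intro s
    have h := A.app_ι hk (basisSeq b s)
    rw [app_basisSeq] at h
    rw [hl, ← map_sub, discCoeff]
    congr 1
    rw [sub_eq_iff_eq_add, neg_add_eq_sub]
    exact h
  rw [Finset.sum_congr rfl fun s _ => hterm s]
  by_cases h2 : k = 2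
  · subst h2
    refine sum_eq_zero_of_swap (i := 0) (j := 1) _ (fun s => ?_) fun s hs => ?_
    · have e0 : basisSeq b (s ∘ Equiv.swap 0 1) 0 = basisSeq b s 1 := rfl
      have e1 : basisSeq b (s ∘ Equiv.swap 0 1) 1 = basisSeq b s 0 := rfl
      rw [if_pos rfl, if_pos rfl, e0, e1, ι_mul_ι_swap (basisSeq b s 0), neg_neg,
        show ∑ j, Finsupp.single ((s ∘ Equiv.swap 0 1) j) 1 = ∑ j, Finsupp.single (s j) 1 from
          Equiv.sum_comp (Equiv.swap (0 : Fin 2) 1) fun j => Finsupp.single (s j) 1, ← map_add,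
        neg_add_cancel, map_zero]
    · have e : basisSeq b s 1 = basisSeq b s 0 := (congrArg b hs).symm
      rw [if_pos rfl, e, ExteriorAlgebra.ι_sq_zero, neg_zero, map_zero]
  · refine Finset.sum_eq_zero fun s _ => ?_
    rw [if_neg h2, neg_zero, map_zero]

theorem potentialE_eq (b : Module.Basis (Fin n) K V) :
    A.potentialE b = MvPowerSeries.map (algebraMap K (ExteriorAlgebra K V)) (A.discPotential b) := by
  ext m
  rw [coeff_potentialE, MvPowerSeries.coeff_map, discPotential_eq, coeff_assemble, map_sum]
  refine Finset.sum_congr rfl fun k hk => ?_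
  rw [A.diagonalTerm_eq b (Finset.mem_Icc.1 hk).1, MvPowerSeries.coeff_map]

end Deformation

end Potential

section Insertion

variable {K : Type u} [CommRing K] {V : Type v} [AddCommGroup V] [Module K V] {n : ℕ}
  {B : Type*} [AddCommGroup B] [Module K B]

/-! ### The bounding cochain `𝐯` -/

theorem Ops.exists_linear_replaceBlock {E : Type*} [AddCommGroup E] [Module K E] (Φ : Ops K E B)
    {l i : ℕ} (hi : i < l) (j : ℕ) (a : ℕ → E) :
    ∃ L : E →ₗ[K] B, ∀ x, Φ.app l (replaceBlock i j a x) = L x := by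
  classical
  refine ⟨(Φ l).toLinearMap (fun q => replaceBlock i j a 0 q) ⟨i, hi⟩, fun x => ?_⟩
  rw [MultilinearMap.toLinearMap_apply, Ops.app]
  congr 1
  funext q
  by_cases hq : q = ⟨i, hi⟩
  · subst hq
    simp [replaceBlock]
  · have : (q : ℕ) ≠ i := fun h => hq (Fin.ext h)
    rw [Function.update_of_ne hq]
    simp [replaceBlock, this]

variable {X : Type*} [AddCommGroup X] [Module K X] (b : Module.Basis (Fin n) K V)

/-- In a symmetrised sum, the exterior products of consecutive generators cancel. -/
theorem sum_replaceBlock_wedge (Φ : Ops K (ExteriorAlgebra K V) B) {k i : ℕ} (hi : i + 1 < k)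
    {l : ℕ} (hl : i < l) (θ : (Fin k → Fin n) → B →ₗ[K] X)
    (hθ : ∀ (s : Fin k → Fin n) (e : Equiv.Perm (Fin k)), θ (s ∘ e) = θ s) :
    ∑ s : Fin k → Fin n, θ s (Φ.app l
      (replaceBlock i 2 (fun q => ExteriorAlgebra.ι K (basisSeq b s q))
        (ExteriorAlgebra.ι K (basisSeq b s (i + 1)) * ExteriorAlgebra.ι K (basisSeq b s i)))) =
      0 := by
  have hb : ∀ s : Fin k → Fin n, basisSeq b s i = b (s ⟨i, by omega⟩) := fun s =>
    extendZero_of_lt _ _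
  have hb' : ∀ s : Fin k → Fin n, basisSeq b s (i + 1) = b (s ⟨i + 1, hi⟩) := fun s =>
    extendZero_of_lt _ _
  refine sum_eq_zero_of_swap (i := ⟨i, by omega⟩) (j := ⟨i + 1, hi⟩) _ (fun s => ?_)
    fun s hs => ?_
  · obtain ⟨L, hL⟩ := Φ.exists_linear_replaceBlock hl 2
      fun q => ExteriorAlgebra.ι K (basisSeq b s q)
    have e : ∀ x, replaceBlock i 2 (fun q => ExteriorAlgebra.ι K
        (basisSeq b (s ∘ Equiv.swap ⟨i, by omega⟩ ⟨i + 1, hi⟩) q)) x =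
        replaceBlock i 2 (fun q => ExteriorAlgebra.ι K (basisSeq b s q)) x := by
      intro x
      funext q
      rw [replaceBlock, replaceBlock]
      split_ifs with h1 h2
      · rw [basisSeq_swap b s (by simp; omega) (by simp; omega)]
      · rfl
      · rw [basisSeq_swap b s (by simp; omega) (by simp; omega)]
    rw [hθ, e, hL, hL, hb, hb', hb, hb', Function.comp_apply, Function.comp_apply,
      Equiv.swap_apply_left, Equiv.swap_apply_right, ι_mul_ι_swap (b (s ⟨i, _⟩)), map_neg, map_neg,
      add_neg_cancel]
  · obtain ⟨L, hL⟩ := Φ.exists_linear_replaceBlock hl 2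
      fun q => ExteriorAlgebra.ι K (basisSeq b s q)
    rw [hL, hb, hb', hs, ExteriorAlgebra.ι_sq_zero, map_zero, map_zero]

/-- The element `𝐯` is a weak bounding cochain: in a symmetrised sum over basis vectors, the
operations of a deformation contribute multiples of the unit, which are annihilated by all
components of a strictly unital homomorphism but the first. -/
theorem Deformation.sum_insertionSum (A : Deformation K V) {Φ : Ops K (ExteriorAlgebra K V) B}
    {e : B} (h1 : Φ 1 ![1] = e) (h2 : ∀ k : ℕ, 2 ≤ k → ∀ a : Fin k → ExteriorAlgebra K V,
      (∃ i, a i = 1) → Φ k a = 0) {k : ℕ} (θ : (Fin k → Fin n) → B →ₗ[K] X)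
    (hθ : ∀ (s : Fin k → Fin n) (e : Equiv.Perm (Fin k)), θ (s ∘ e) = θ s) :
    ∑ s : Fin k → Fin n, θ s (insertionSum A.μ Φ k (fun _ => 1)
      fun q => ExteriorAlgebra.ι K (basisSeq b s q)) =
      ∑ s : Fin k → Fin n, A.discCoeff b s • θ s e := by
  have hterm : ∀ j ≤ k, ∀ i ≤ k - j, ∑ s : Fin k → Fin n, θ s (Φ.app (k - j + 1)
      (replaceBlock i j (fun q => ExteriorAlgebra.ι K (basisSeq b s q))
        (A.μ.app j fun q => ExteriorAlgebra.ι K (basisSeq b s (i + q))))) =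
      if j = k then ∑ s : Fin k → Fin n, A.discCoeff b s • θ s e else 0 := by
    intro j hj i hi
    by_cases hj2 : j < 2
    · have : (if j = k then ∑ s : Fin k → Fin n, A.discCoeff b s • θ s e else 0) = 0 := by
        split_ifs with h
        · exact Finset.sum_eq_zero fun s _ => by rw [A.discCoeff_of_lt b (by omega), zero_smul]
        · rfl
      rw [this]
      refine Finset.sum_eq_zero fun s _ => ?_
      obtain ⟨L, hL⟩ := Φ.exists_linear_replaceBlock (show i < k - j + 1 by omega) j
        fun q => ExteriorAlgebra.ι K (basisSeq b s q)
      have h0 : A.μ.app j (fun q => ExteriorAlgebra.ι K (basisSeq b s (i + q))) = 0 := by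
        interval_cases j
        · exact A.app_zero _
        · exact A.app_one _
      rw [hL, h0, map_zero, map_zero]
    · have hsplit : ∀ s : Fin k → Fin n, θ s (Φ.app (k - j + 1)
          (replaceBlock i j (fun q => ExteriorAlgebra.ι K (basisSeq b s q))
            (A.μ.app j fun q => ExteriorAlgebra.ι K (basisSeq b s (i + q))))) =
          (if j = k then A.discCoeff b s • θ s e else 0) -
          if j = 2 then θ s (Φ.app (k - j + 1)
            (replaceBlock i 2 (fun q => ExteriorAlgebra.ι K (basisSeq b s q))
              (ExteriorAlgebra.ι K (basisSeq b s (i + 1)) *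
                ExteriorAlgebra.ι K (basisSeq b s i)))) else 0 := by
        intro s
        obtain ⟨L, hL⟩ := Φ.exists_linear_replaceBlock (show i < k - j + 1 by omega) j
          fun q => ExteriorAlgebra.ι K (basisSeq b s q)
        rw [hL, A.app_ι (by omega) fun q => basisSeq b s (i + q), map_sub, map_sub,
          Algebra.algebraMap_eq_smul_one, map_smul, map_smul]
        congr 1
        · split_ifs with hjk
          · subst hjk
            obtain rfl : i = 0 := by omega
            have hL1 : L 1 = e := by
              rw [← hL, ← h1, Ops.app]
              have hk : j - j + 1 = 1 := by omega
              generalize j - j + 1 = l at hk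
              subst hk
              congr 1
              funext q
              obtain rfl : q = 0 := Subsingleton.elim _ _
              rfl
            rw [hL1]
            simp only [zero_add]
            rw [A.app_basisSeq]
            rfl
          · have hL1 : L 1 = 0 := by
              rw [← hL, Ops.app]
              refine h2 _ (by omega) _ ⟨⟨i, by omega⟩, ?_⟩
              simp [replaceBlock]
            rw [hL1, map_zero, smul_zero]
        · split_ifs with h
          · subst h
            rw [hL]
            rfl
          · rw [map_zero, map_zero]
      rw [Finset.sum_congr rfl fun s _ => hsplit s, Finset.sum_sub_distrib]
      have hz : ∑ s : Fin k → Fin n, (if j = 2 then θ s (Φ.app (k - j + 1)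
            (replaceBlock i 2 (fun q => ExteriorAlgebra.ι K (basisSeq b s q))
              (ExteriorAlgebra.ι K (basisSeq b s (i + 1)) *
                ExteriorAlgebra.ι K (basisSeq b s i)))) else 0) = 0 := by
        split_ifs with h
        · exact sum_replaceBlock_wedge b Φ (by omega) (by omega) θ hθ
        · exact Finset.sum_const_zero
      rw [hz, sub_zero]
      split_ifs with h
      · rfl
      · exact Finset.sum_const_zero
  have hswap : ∑ s : Fin k → Fin n, θ s (insertionSum A.μ Φ k (fun _ => 1)
      fun q => ExteriorAlgebra.ι K (basisSeq b s q)) =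
      ∑ j ∈ Finset.range (k + 1), ∑ i ∈ Finset.range (k - j + 1), ∑ s : Fin k → Fin n,
        θ s (Φ.app (k - j + 1)
          (replaceBlock i j (fun q => ExteriorAlgebra.ι K (basisSeq b s q))
            (A.μ.app j fun q => ExteriorAlgebra.ι K (basisSeq b s (i + q))))) := by
    simp only [insertionSum, sub_self, Finset.sum_const_zero, uzpow_zero, one_smul, map_sum]
    rw [Finset.sum_comm]
    exact Finset.sum_congr rfl fun j _ => Finset.sum_comm
  rw [hswap]
  rw [Finset.sum_congr rfl fun j hj => Finset.sum_congr rfl fun i hi =>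
    hterm j (Nat.lt_succ_iff.1 (Finset.mem_range.1 hj)) i (Nat.lt_succ_iff.1 (Finset.mem_range.1 hi)),
    Finset.sum_eq_single k]
  · rw [Nat.sub_self, if_pos rfl]
    exact Finset.sum_range_one _
  · intro j _ hj
    simp [hj]
  · intro h
    exact absurd (Finset.mem_range.2 (Nat.lt_succ_self k)) h

end Insertion

/-! ### The disc potential of the minimal model -/

section Quadratic

variable {K : Type u} [CommRing K] {V : Type v} [AddCommGroup V] [Module K V] {n : ℕ}
  (b : Module.Basis (Fin n) K V) {B : Type*} [Ring B] [Algebra (FormalFunctions K n) B]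

/-- The sum of the values of `F` on the sequences `v_{s_1}, …, v_{s_k}`, weighted by monomials. -/
def weightedSum (F : ℕ → (ℕ → V) → B) (k : ℕ) : B :=
  ∑ s : Fin k → Fin n, coordMonomial K s • F k (basisSeq b s)

theorem weightedSum_mul {F : ℕ → (ℕ → V) → B} (hF : IsLocal F) {l k : ℕ} (hl : l ≤ k) :
    ∑ s : Fin k → Fin n, coordMonomial K s •
      (F (k - l) (fun q => basisSeq b s (q + l)) * F l (basisSeq b s)) =
      weightedSum b F (k - l) * weightedSum b F l := by
  obtain ⟨m, rfl⟩ := Nat.exists_eq_add_of_le hl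
  rw [Nat.add_sub_cancel_left, weightedSum, weightedSum, Finset.sum_mul_sum, Finset.sum_comm,
    ← Finset.sum_product', ← (Fin.appendEquiv (α := Fin n) l m).sum_comp]
  refine Finset.sum_congr rfl fun p _ => ?_
  obtain ⟨s, t⟩ := p
  change coordMonomial K (Fin.append s t) • _ = _
  have h1 : coordMonomial K (Fin.append s t) = coordMonomial K t * coordMonomial K s := by
    rw [coordMonomial, Fin.prod_univ_add, mul_comm]
    simp only [Fin.append_left, Fin.append_right]
    rfl
  have h2 : F m (fun q => basisSeq b (Fin.append s t) (q + l)) = F m (basisSeq b t) := by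
    refine hF m _ _ fun q hq => ?_
    have e : basisSeq b (Fin.append s t) (q + l) = b (Fin.append s t (Fin.natAdd l ⟨q, hq⟩)) := by
      rw [← basisSeq_coe]
      simp [add_comm]
    rw [e, Fin.append_right]
    exact (basisSeq_coe b t ⟨q, hq⟩).symm
  have h3 : F l (basisSeq b (Fin.append s t)) = F l (basisSeq b s) := by
    refine hF l _ _ fun q hq => ?_
    have e : basisSeq b (Fin.append s t) q = b (Fin.append s t (Fin.castAdd m ⟨q, hq⟩)) := by
      rw [← basisSeq_coe]
      rfl
    rw [e, Fin.append_left]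
    exact (basisSeq_coe b s ⟨q, hq⟩).symm
  rw [smul_mul_smul_comm, ← h1, ← h2, ← h3]
  rfl

theorem weightedSum_mul_mem (F : ℕ → (ℕ → V) → B) {k l N : ℕ} (h : N ≤ k + l) :
    weightedSum b F k * weightedSum b F l ∈
      (ordIdeal K n N • ⊤ : Submodule (FormalFunctions K n) B) := by
  rw [weightedSum, weightedSum, Finset.sum_mul_sum]
  refine sum_mem fun s _ => sum_mem fun t _ => ?_
  rw [smul_mul_smul_comm]
  exact Submodule.smul_mem_smul
    (ordIdeal_anti h (mul_mem_ordIdeal (coordMonomial_mem s) (coordMonomial_mem t)))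
    Submodule.mem_top

theorem sum_triangle {X : Type*} [AddCommMonoid X] (g : ℕ → ℕ → X) (N : ℕ) :
    ∑ k ∈ Finset.Icc 1 N, ∑ l ∈ Finset.Ico 1 k, g (k - l) l =
      ∑ p ∈ (Finset.Icc 1 N ×ˢ Finset.Icc 1 N).filter (fun p => p.1 + p.2 ≤ N), g p.1 p.2 := by
  rw [Finset.sum_sigma']
  refine Finset.sum_nbij' (fun p => (p.1 - p.2, p.2)) (fun p => ⟨p.1 + p.2, p.2⟩) ?_ ?_ ?_ ?_ ?_
  · rintro ⟨k, l⟩ h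
    simp only [Finset.mem_sigma, Finset.mem_Icc, Finset.mem_Ico, Finset.mem_filter,
      Finset.mem_product] at h ⊢
    omega
  · rintro ⟨k, l⟩ h
    simp only [Finset.mem_sigma, Finset.mem_Icc, Finset.mem_Ico, Finset.mem_filter,
      Finset.mem_product] at h ⊢
    omega
  · rintro ⟨k, l⟩ h
    simp only [Finset.mem_sigma, Finset.mem_Icc, Finset.mem_Ico] at h ⊢
    rw [Nat.sub_add_cancel (by omega)]
  · rintro ⟨k, l⟩ _
    simp
  · rintro ⟨k, l⟩ _
    rfl

/-- If the components of `d + M` solve the Maurer–Cartan equation with curvature `w - P` term by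
term, then partial sums solve it up to higher order terms. -/
theorem exists_partialSum_sq {F : ℕ → (ℕ → V) → B} (hF : IsLocal F) {d : B}
    {w : FormalFunctions K n} {P : ℕ → FormalFunctions K n} (hd : d * d = w • (1 : B))
    (h : ∀ k, 1 ≤ k → P k • (1 : B) = ∑ s : Fin k → Fin n, coordMonomial K s •
      (-(d * F k (basisSeq b s) + F k (basisSeq b s) * d) - ∑ l ∈ Finset.Ico 1 k,
        F (k - l) (fun q => basisSeq b s (q + l)) * F l (basisSeq b s))) (N : ℕ) :
    (w - ∑ k ∈ Finset.Icc 1 N, P k) • (1 : B) -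
      (d + ∑ k ∈ Finset.Icc 1 N, weightedSum b F k) * (d + ∑ k ∈ Finset.Icc 1 N, weightedSum b F k) ∈
      (ordIdeal K n (N + 1) • ⊤ : Submodule (FormalFunctions K n) B) := by
  set M := weightedSum b F with hM
  have hP : ∀ k ∈ Finset.Icc 1 N, P k • (1 : B) =
      -(d * M k + M k * d) - ∑ l ∈ Finset.Ico 1 k, M (k - l) * M l := by
    intro k hk
    have e : ∀ l ∈ Finset.Ico 1 k, M (k - l) * M l = ∑ s : Fin k → Fin n, coordMonomial K s •
        (F (k - l) (fun q => basisSeq b s (q + l)) * F l (basisSeq b s)) := fun l hl =>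
      (weightedSum_mul b hF (Finset.mem_Ico.1 hl).2.le).symm
    rw [h k (Finset.mem_Icc.1 hk).1, Finset.sum_congr rfl e, Finset.sum_comm, hM, weightedSum,
      Finset.mul_sum, Finset.sum_mul, ← Finset.sum_add_distrib, ← Finset.sum_neg_distrib,
      ← Finset.sum_sub_distrib]
    refine Finset.sum_congr rfl fun s _ => ?_
    rw [smul_sub, smul_neg, smul_add, mul_smul_comm, smul_mul_assoc, Finset.smul_sum]
  have hsum : (∑ k ∈ Finset.Icc 1 N, P k) • (1 : B) =
      -(d * (∑ k ∈ Finset.Icc 1 N, M k) + (∑ k ∈ Finset.Icc 1 N, M k) * d) -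
        ∑ p ∈ (Finset.Icc 1 N ×ˢ Finset.Icc 1 N).filter (fun p => p.1 + p.2 ≤ N),
          M p.1 * M p.2 := by
    rw [Finset.sum_smul, Finset.sum_congr rfl hP, Finset.sum_sub_distrib,
      sum_triangle fun k l => M k * M l, Finset.sum_neg_distrib, Finset.sum_add_distrib,
      Finset.mul_sum, Finset.sum_mul]
  have hsq : (∑ k ∈ Finset.Icc 1 N, M k) * (∑ k ∈ Finset.Icc 1 N, M k) =
      ∑ p ∈ (Finset.Icc 1 N ×ˢ Finset.Icc 1 N).filter (fun p => p.1 + p.2 ≤ N), M p.1 * M p.2 +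
      ∑ p ∈ (Finset.Icc 1 N ×ˢ Finset.Icc 1 N).filter (fun p => ¬p.1 + p.2 ≤ N),
        M p.1 * M p.2 := by
    rw [Finset.sum_filter_add_sum_filter_not, Finset.sum_mul_sum, ← Finset.sum_product']
  have e : (w - ∑ k ∈ Finset.Icc 1 N, P k) • (1 : B) -
      (d + ∑ k ∈ Finset.Icc 1 N, M k) * (d + ∑ k ∈ Finset.Icc 1 N, M k) =
      -∑ p ∈ (Finset.Icc 1 N ×ˢ Finset.Icc 1 N).filter (fun p => ¬p.1 + p.2 ≤ N),
        M p.1 * M p.2 := by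
    rw [sub_smul, hsum, add_mul, mul_add, mul_add, hsq, hd]
    abel
  rw [e]
  refine neg_mem (sum_mem fun p hp => weightedSum_mul_mem b F ?_)
  have := (Finset.mem_filter.1 hp).2
  omega

theorem apply_mem_of_mem_smul_top {R B : Type*} [CommRing R] [AddCommGroup B] [Module R B]
    {J : Ideal R} (f : B →ₗ[R] R) {x : B} (hx : x ∈ (J • ⊤ : Submodule R B)) : f x ∈ J := by
  refine Submodule.smul_induction_on hx (fun r hr y _ => ?_) fun y z hy hz => ?_
  · rw [map_smul, smul_eq_mul]
    exact J.mul_mem_right _ hr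
  · rw [map_add]
    exact add_mem hy hz

end Quadratic

section MinimalModel

variable {K : Type u} [CommRing K] {V : Type v} [AddCommGroup V] [Module K V] {n : ℕ}
  (b : Module.Basis (Fin n) K V)

/-- The restriction of multilinear operations to sequences of generators. -/
def onGenerators {B : Type*} [AddCommGroup B] [Module K B] (I : Ops K (ExteriorAlgebra K V) B)
    (k : ℕ) (u : ℕ → V) : B :=
  I.app k fun q => ExteriorAlgebra.ι K (u q)

theorem isLocal_onGenerators {B : Type*} [AddCommGroup B] [Module K B]
    (I : Ops K (ExteriorAlgebra K V) B) : IsLocal (onGenerators I) := by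
  intro k u u' h
  rw [onGenerators, onGenerators, Ops.app, Ops.app]
  congr 1
  funext q
  rw [h q q.2]

section Hom

variable {X : Type*} [AddCommGroup X]
  [Module (FormalFunctions K n) X] [Module K X] [IsScalarTower K (FormalFunctions K n) X]
  {w : FormalFunctions K n} (M : FilteredMF (FormalFunctions K n) w X)
  {I : Ops K (ExteriorAlgebra K V) (Module.End (FormalFunctions K n) X)}

theorem sgn_onGenerators
    (hI : IsSuperfilteredOps (extSuper K V) (M.endSuperfiltration K) 0 I) {k : ℕ} (hk : 1 ≤ k)
    (u : ℕ → V) : M.S.endo.sgn (onGenerators I k u) = -onGenerators I k u := by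
  have := hI.par k hk (fun _ => 1) _ fun i => ι_mem_par (u i)
  simp only [sub_self, Finset.sum_const_zero, zero_add, Int.cast_zero] at this
  rw [onGenerators, M.S.endo.sgn_of_mem (i := 1) this, uzpow_one, Units.neg_smul, one_smul]

theorem sum_composition_onGenerators
    (hI : IsSuperfilteredOps (extSuper K V) (M.endSuperfiltration K) 0 I) {k : ℕ} (hk : 1 ≤ k)
    (u : ℕ → V) :
    ∑ c : Composition k, M.endOps K c.length (fun r => I.app (c.blocksFun r)
      (fun q => ExteriorAlgebra.ι K (u (c.sizeUpTo r + q)))) =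
      -(M.d * onGenerators I k u + onGenerators I k u * M.d) - ∑ l ∈ Finset.Ico 1 k,
        onGenerators I (k - l) (fun q => u (q + l)) * onGenerators I l u := by
  rw [Contraction.sum_composition_dg hk (M.endOps K) (M.endOps_eq_zero K)
    fun l m => I.app l fun q => ExteriorAlgebra.ι K (u (m + q)), sub_eq_add_neg,
    ← Finset.sum_neg_distrib]
  simp only [zero_add]
  refine congrArg₂ _ ?_ (Finset.sum_congr rfl fun l hl => ?_)
  · rw [FilteredMF.endOps_one, FilteredMF.μOne_apply]
    have := sgn_onGenerators M hI hk u
    rw [onGenerators] at this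
    rw [this, mul_neg, neg_add, sub_eq_add_neg]
    rfl
  · have := sgn_onGenerators M hI (Finset.mem_Ico.1 hl).1 u
    rw [onGenerators] at this
    rw [FilteredMF.endOps_two, FilteredMF.μTwo_apply, this, mul_neg]
    simp only [add_comm l]
    rfl

theorem Deformation.discTerm_smul_one (A : Deformation K V)
    (hI : IsSuperfilteredAInfHom (extSuper K V) (M.endSuperfiltration K) 1 1 A.μ (M.endOps K) I)
    {k : ℕ} (hk : 1 ≤ k) :
    A.discTerm b k • (1 : Module.End (FormalFunctions K n) X) =
      ∑ s : Fin k → Fin n, coordMonomial K s •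
      (-(M.d * onGenerators I k (basisSeq b s) + onGenerators I k (basisSeq b s) * M.d) -
        ∑ l ∈ Finset.Ico 1 k, onGenerators I (k - l) (fun q => basisSeq b s (q + l)) *
          onGenerators I l (basisSeq b s)) := by
  have h := A.sum_insertionSum b hI.unit_one hI.unit_higher (k := k)
    (fun s => (LinearMap.lsmul (FormalFunctions K n) (Module.End (FormalFunctions K n) X)
      (coordMonomial K s)).restrictScalars K)
    (fun s e => by rw [coordMonomial_comp_perm])
  rw [Deformation.discTerm, Finset.sum_smul]
  simp only [smul_assoc]
  refine h.symm.trans (Finset.sum_congr rfl fun s _ => ?_)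
  rw [hI.relation k _ _ fun i => ι_mem_par (basisSeq b s i),
    ← sum_composition_onGenerators M hI.superfiltered hk]
  rfl

/-- If a homomorphism to the endomorphism algebra of a matrix factorisation of `w` deforms the
differential to one that annihilates a basis element, then the disc potential is `w`: the square of
the deformed differential is multiplication by the difference. -/
theorem Deformation.discPotential_eq_of_hom (A : Deformation K V)
    (hI : IsSuperfilteredAInfHom (extSuper K V) (M.endSuperfiltration K) 1 1 A.μ (M.endOps K) I)
    {x₀ : X} {τ : X →ₗ[FormalFunctions K n] FormalFunctions K n} (hτ : τ x₀ = 1)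
    (h1 : M.d x₀ + ∑ i, (MvPowerSeries.X i : FormalFunctions K n) •
      onGenerators I 1 (fun _ => b i) x₀ = 0)
    (h2 : ∀ k, 2 ≤ k → ∀ u : ℕ → V, onGenerators I k u x₀ = 0) :
    A.discPotential b = w := by
  rw [← sub_eq_zero]
  refine eq_zero_of_mem_ordIdeal fun N => ?_
  set D := M.d + ∑ k ∈ Finset.Icc 1 (N + 1), weightedSum b (onGenerators I) k with hD
  have hD0 : D x₀ = 0 := by
    have hk : ∀ k ∈ Finset.Ioc 1 (N + 1), weightedSum b (onGenerators I) k x₀ = 0 := by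
      intro k hk
      rw [weightedSum, LinearMap.sum_apply]
      refine Finset.sum_eq_zero fun s _ => ?_
      rw [LinearMap.smul_apply, h2 k (Finset.mem_Ioc.1 hk).1, smul_zero]
    have e1 : weightedSum b (onGenerators I) 1 x₀ =
        ∑ i, (MvPowerSeries.X i : FormalFunctions K n) • onGenerators I 1 (fun _ => b i) x₀ := by
      rw [weightedSum, LinearMap.sum_apply, ← (Equiv.funUnique (Fin 1) (Fin n)).symm.sum_comp]
      refine Finset.sum_congr rfl fun i _ => ?_
      rw [LinearMap.smul_apply, coordMonomial, Fin.prod_univ_one]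
      congr 2
      refine isLocal_onGenerators I 1 _ _ fun q hq => ?_
      obtain rfl : q = 0 := by omega
      rfl
    rw [hD, LinearMap.add_apply, LinearMap.sum_apply, ← Finset.add_sum_Ioc_eq_sum_Icc (by omega),
      e1, Finset.sum_eq_zero hk, add_zero, h1]
  have hmem := exists_partialSum_sq b (isLocal_onGenerators I) M.d_sq
    (fun k hk => A.discTerm_smul_one b M hI hk) (N + 1)
  rw [← hD] at hmem
  have hev := apply_mem_of_mem_smul_top (τ ∘ₗ LinearMap.applyₗ x₀) hmem
  have hDD : (τ ∘ₗ LinearMap.applyₗ x₀) (D * D) = 0 := by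
    rw [LinearMap.comp_apply, LinearMap.applyₗ_apply_apply, Module.End.mul_apply, hD0, map_zero,
      map_zero]
  have h1' : (τ ∘ₗ LinearMap.applyₗ x₀) (1 : Module.End (FormalFunctions K n) X) = 1 := hτ
  rw [map_sub, map_smul, hDD, h1', sub_zero, smul_eq_mul, mul_one] at hev
  have := sub_mem (A.discPotential_sub_mem b (N + 1)) hev
  rw [sub_sub_sub_cancel_right] at this
  exact ordIdeal_anti (by omega) this

end Hom

/-- The deformed differential `d + ∑ x_i ι(v_i)` of the Koszul matrix factorisation lowers the
filtration: the exterior products cancel. -/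
theorem IsTransfer.koszulOp_add_mem {R : Type*} [CommRing R] [Algebra K R] {x y : Fin n → R}
    {w : R} {hw : ∑ i, x i * y i = w} {ε : R →ₐ[K] K}
    {incl : ExteriorAlgebra K V →ₗ[K] Module.End R (R ⊗[K] ExteriorAlgebra K V)}
    {htpy : Module.End R (R ⊗[K] ExteriorAlgebra K V) →ₗ[K]
      Module.End R (R ⊗[K] ExteriorAlgebra K V)} (T : IsTransfer b hw ε incl htpy) :
    koszulOp b x y + ∑ i, x i • incl (ExteriorAlgebra.ι K (b i)) ∈
      (extSuperBase K V R).endo.fil (-1) := by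
  have gen : ∀ {B : Type _} [AddCommGroup B] [Module R B] (f e g : Fin n → B),
      -(∑ i, (x i • f i + y i • e i)) + ∑ i, x i • g i =
        ∑ i, (x i • (g i - f i) - y i • e i) := by
    intro B _ _ f e g
    rw [← Finset.sum_neg_distrib, ← Finset.sum_add_distrib]
    refine Finset.sum_congr rfl fun i _ => ?_
    rw [smul_sub]
    abel
  have e := gen (fun i => wedge R (ExteriorAlgebra.ι K (b i))) (fun i => contract R (b.coord i))
    fun i => incl (ExteriorAlgebra.ι K (b i))
  refine (show koszulOp b x y + ∑ i, x i • incl (ExteriorAlgebra.ι K (b i)) = _ from e) ▸ ?_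
  refine sum_mem fun i _ => sub_mem (((extSuperBase K V R).endo.fil (-1)).smul_mem _ ?_)
    (((extSuperBase K V R).endo.fil (-1)).smul_mem _ (contract_mem_fil _))
  have h1 := T.incl_lead 1 _ (ι_mem_exteriorPower (b i))
  have h2 := T.incl_super.par 1 _ (ι_mem_par (b i))
  rw [Int.cast_zero, add_zero] at h2
  refine (extSuperBase K V R).endo.mem_fil_of_step (p := -1) ?_ ?_
  · simpa using! h1
  · exact sub_mem h2 (wedge_ι_mem (b i)).1

theorem IsTransfer.inclOps_ι_mem {R : Type*} [CommRing R] [Algebra K R] {x y : Fin n → R}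
    {w : R} {hw : ∑ i, x i * y i = w} {ε : R →ₐ[K] K}
    {incl : ExteriorAlgebra K V →ₗ[K] Module.End R (R ⊗[K] ExteriorAlgebra K V)}
    {htpy : Module.End R (R ⊗[K] ExteriorAlgebra K V) →ₗ[K]
      Module.End R (R ⊗[K] ExteriorAlgebra K V)} (T : IsTransfer b hw ε incl htpy)
    (hx : ∀ i, ε (x i) = 0) (hy : ∀ i, ε (y i) = 0) {k : ℕ} (hk : 2 ≤ k) (u : ℕ → V) :
    (T.contraction hx hy).inclOps.app k (fun q => ExteriorAlgebra.ι K (u q)) ∈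
      (extSuperBase K V R).endo.fil (-1) := by
  rw [Contraction.inclOps_app]
  have h1 := ((T.contraction hx hy).inclOp_lead hk (p := fun _ => 1)
    (fun i => ι_mem_fil (K := K) (u i)) fun i => by
      have := T.htpy_incl_mul_incl_mem (ι_mem_exteriorPower (u i)) (ι_mem_exteriorPower (u (i + 1)))
      exact this).1
  have h2 := (T.contraction hx hy).inclOp_par k (by omega) (fun _ => 1) _
    fun i => ι_mem_par (K := K) (u i)
  refine (extSuperBase K V R).endo.mem_fil_of_step (p := -1) ?_ ?_
  · simpa using! h1
  · simpa using! h2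

theorem apply_one_tmul_one_of_mem {R : Type*} [CommRing R] [Algebra K R]
    {f : Module.End R (R ⊗[K] ExteriorAlgebra K V)} (hf : f ∈ (extSuperBase K V R).endo.fil (-1)) :
    f (1 ⊗ₜ 1) = 0 := by
  have := hf 0 _ one_tmul_one_mem_fil
  rwa [zero_add, ext_fil_base_neg_one, Submodule.mem_bot] at this

theorem TransferData.discPotential_deformation {ŵ : Fin n → FormalFunctions K n}
    {w : FormalFunctions K n} {hw : ∑ i, MvPowerSeries.X i * ŵ i = w} (T : TransferData b ŵ hw)
    (hŵ : ∀ i, ŵ i ∈ maxIdeal K n) : (T.deformation hŵ).discPotential b = w := by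
  refine (T.deformation hŵ).discPotential_eq_of_hom b (stab b ŵ hw) (T.isSuperfilteredAInfHom hŵ)
    (x₀ := 1 ⊗ₜ 1) (τ := (TensorProduct.AlgebraTensorModule.rid K (FormalFunctions K n)
      (FormalFunctions K n)).toLinearMap ∘ₗ
      (ExteriorAlgebra.algebraMapInv (R := K) (M := V)).toLinearMap.baseChange
        (FormalFunctions K n)) ?_ ?_ fun k hk u => ?_
  · simp
  · have h := apply_one_tmul_one_of_mem (T.isTransfer.koszulOp_add_mem b)
    rw [LinearMap.add_apply, LinearMap.sum_apply] at h
    refine Eq.trans (congrArg _ (Finset.sum_congr rfl fun i _ => ?_)) h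
    rw [LinearMap.smul_apply]
    refine congrArg (fun f : EndAlg K V n => MvPowerSeries.X i • f (1 ⊗ₜ 1)) ?_
    exact ((T.contraction hŵ).inclOps_app 1 fun _ => ExteriorAlgebra.ι K (b i)).trans
      ((T.contraction hŵ).inclOp_one _)
  · exact apply_one_tmul_one_of_mem (T.isTransfer.inclOps_ι_mem b _ _ hk u)

end MinimalModel

/-! ### Homomorphisms and changes of variables -/

section Compositions

/-- Sums over the compositions of `1, …, N`, as sums over tuples of block sizes. -/
theorem sum_composition_eq_sum_tuple {X : Type*} [AddCommMonoid X] (N : ℕ)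
    (g : (Σ l, Fin l → ℕ) → X) (hg : ∀ e, N < ∑ r, e.2 r → g e = 0) :
    ∑ k ∈ Finset.Icc 1 N, ∑ c : Composition k, g ⟨c.length, c.blocksFun⟩ =
      ∑ l ∈ Finset.Icc 1 N, ∑ β ∈ Fintype.piFinset fun _ : Fin l => Finset.Icc 1 N, g ⟨l, β⟩ := by
  rw [Finset.sum_sigma', Finset.sum_sigma',
    ← Finset.sum_filter_of_ne (p := fun e => ∑ r, e.2 r ≤ N)
      fun e _ he => not_lt.1 fun h => he (hg e h)]
  refine Finset.sum_nbij (fun x => ⟨x.2.length, x.2.blocksFun⟩) ?_ ?_ ?_ fun _ _ => rfl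
  · rintro ⟨k, c⟩ h
    simp only [Finset.mem_sigma, Finset.mem_Icc, Finset.mem_univ, and_true] at h
    simp only [Finset.mem_filter, Finset.mem_sigma, Finset.mem_Icc, Fintype.mem_piFinset]
    refine ⟨⟨⟨c.length_pos_of_pos h.1, c.length_le.trans h.2⟩, fun r => ?_⟩, ?_⟩
    · exact ⟨c.one_le_blocksFun r, (c.blocksFun_le r).trans h.2⟩
    · rw [c.sum_blocksFun]
      exact h.2
  · rintro ⟨k, c⟩ _ ⟨k', c'⟩ _ h
    rw [Composition.sigma_eq_iff_blocks_eq]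
    have := congrArg (fun e : Σ l, Fin l → ℕ => List.ofFn e.2) h
    simpa only [Composition.ofFn_blocksFun] using this
  · rintro ⟨l, β⟩ h
    simp only [Finset.coe_filter, Finset.mem_sigma, Finset.mem_Icc, Fintype.mem_piFinset,
      Set.mem_ofPred_eq] at h
    refine ⟨⟨∑ r, β r, ⟨List.ofFn β, fun {i} hi => ?_, List.sum_ofFn⟩⟩, ?_, ?_⟩
    · obtain ⟨j, rfl⟩ := (List.mem_ofFn' β i).1 hi
      exact (h.1.2 j).1
    · simp only [Finset.coe_sigma, Set.mem_sigma_iff, Finset.coe_Icc, Set.mem_Icc, Finset.coe_univ,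
        Set.mem_univ, and_true]
      refine ⟨?_, h.2⟩
      exact (h.1.2 ⟨0, h.1.1.1⟩).1.trans
        (Finset.single_le_sum (f := β) (fun _ _ => Nat.zero_le _) (Finset.mem_univ _))
    · exact List.equivSigmaTuple.apply_symm_apply ⟨l, β⟩

end Compositions

section ChangeOfVariables

variable {K : Type u} [CommRing K] {V : Type v} [AddCommGroup V] [Module K V] {n : ℕ}
  (b : Module.Basis (Fin n) K V)

theorem prod_mem_ordIdeal {l : ℕ} (β : Fin l → ℕ) {f : Fin l → FormalFunctions K n}
    (hf : ∀ r, f r ∈ ordIdeal K n (β r)) : ∏ r, f r ∈ ordIdeal K n (∑ r, β r) := by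
  induction l with
  | zero => intro m hm; simp at hm
  | succ l ih =>
    rw [Fin.prod_univ_succ, Fin.sum_univ_succ]
    exact mul_mem_ordIdeal (hf 0) (ih _ fun r => hf r.succ)

theorem exists_ι_of_mem {a : ExteriorAlgebra K V} (h : a ∈ (extSuper K V).fil 1)
    (h' : a ∈ (extSuper K V).par 1) : ∃ x : V, ExteriorAlgebra.ι K x = a := by
  have := Superfiltration.mem_of_fil_one_of_par_one _ h h'
  rwa [ExteriorAlgebra.exteriorPower, pow_one] at this

theorem eq_zero_of_odd_of_fil_zero {a : ExteriorAlgebra K V} (h : a ∈ (extSuper K V).fil 0)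
    (h' : a ∈ (extSuper K V).par 1) : a = 0 := by
  have := (extSuper K V).mem_fil_of_step (p := -1) (by simpa using h) (by simpa using! h')
  rwa [ext_fil_neg_one, Submodule.mem_bot] at this

variable {S : Superfiltration K (ExteriorAlgebra K V)}
  (Φ : Ops K (ExteriorAlgebra K V) (ExteriorAlgebra K V))

/-- The coordinate number `i` of `Φ^k` on generators. -/
def homCoeff (k : ℕ) (u : ℕ → V) (i : Fin n) : K :=
  b.coord i (ExteriorAlgebra.ιInv (onGenerators Φ k u))

/-- The homogeneous component `Φ^k(𝐯, …, 𝐯)` of the coordinate number `i` of the change of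
variables induced by `Φ`. -/
def homTerm (k : ℕ) (i : Fin n) : FormalFunctions K n :=
  ∑ s : Fin k → Fin n, homCoeff b Φ k (basisSeq b s) i • coordMonomial K s

theorem homTerm_mem (k : ℕ) (i : Fin n) : homTerm b Φ k i ∈ ordIdeal K n k :=
  sum_mem fun s _ => smul_mem_ordIdeal _ (coordMonomial_mem s)

/-- The formal change of variables `𝐯 ↦ ∑_k Φ^k(𝐯, …, 𝐯)` induced by `Φ`. -/
def changeOfVariables (i : Fin n) : FormalFunctions K n := assemble 1 fun k => homTerm b Φ k i

theorem changeOfVariables_sub_mem (i : Fin n) (N : ℕ) :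
    changeOfVariables b Φ i - ∑ k ∈ Finset.Icc 1 N, homTerm b Φ k i ∈ ordIdeal K n (N + 1) :=
  assemble_sub_mem (fun k => homTerm_mem b Φ k i) 1 N

theorem changeOfVariables_mem (i : Fin n) : changeOfVariables b Φ i ∈ maxIdeal K n := by
  rw [← ordIdeal_one]
  exact assemble_mem _ 1

theorem homTerm_one (i : Fin n) :
    homTerm b Φ 1 i = ∑ j, homCoeff b Φ 1 (fun _ => b j) i • MvPowerSeries.X j := by
  rw [homTerm, ← (Equiv.funUnique (Fin 1) (Fin n)).symm.sum_comp]
  refine Finset.sum_congr rfl fun j _ => ?_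
  rw [coordMonomial, Fin.prod_univ_one]
  congr 1
  rw [homCoeff, homCoeff]
  congr 2
  refine isLocal_onGenerators Φ 1 _ _ fun q hq => ?_
  obtain rfl : q = 0 := by omega
  rfl

variable {Φ}

theorem onGenerators_par (hΦ : IsSuperfilteredOps (extSuper K V) (extSuper K V) 0 Φ) {k : ℕ}
    (hk : 1 ≤ k) (u : ℕ → V) : onGenerators Φ k u ∈ (extSuper K V).par 1 := by
  simpa [onGenerators] using hΦ.par k hk (fun _ => 1) _ fun i => ι_mem_par (u i)

theorem onGenerators_eq (hΦ : IsSuperfilteredOps (extSuper K V) (extSuper K V) 0 Φ) {k : ℕ}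
    (hk : 1 ≤ k) (u : ℕ → V) :
    onGenerators Φ k u = ∑ i, homCoeff b Φ k u i • ExteriorAlgebra.ι K (b i) := by
  have hf : onGenerators Φ k u ∈ (extSuper K V).fil 1 := by
    simpa [onGenerators] using hΦ.fil k hk (fun _ => 1) _ fun i => ι_mem_fil (u i)
  obtain ⟨x, hx⟩ := exists_ι_of_mem hf (onGenerators_par hΦ hk u)
  simp only [homCoeff, ← hx, ExteriorAlgebra.ι_leftInverse x, ← map_smul, ← map_sum,
    Module.Basis.coord_apply, b.sum_repr]

theorem sum_blocks {k : ℕ} (c : Composition k) (t : Fin c.length → Fin n) :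
    ∑ s : Fin k → Fin n, (∏ r, homCoeff b Φ (c.blocksFun r)
      (fun q => basisSeq b s (c.sizeUpTo r + q)) (t r)) • coordMonomial K s =
      ∏ r, homTerm b Φ (c.blocksFun r) (t r) := by
  simp only [homTerm]
  rw [Finset.prod_univ_sum, Fintype.piFinset_univ,
    ← ((Equiv.arrowCongr c.blocksFinEquiv (Equiv.refl (Fin n))).symm.trans
      (Equiv.piCurry fun (_ : Fin c.length) _ => Fin n)).sum_comp]
  refine Finset.sum_congr rfl fun s _ => ?_
  have hm : coordMonomial K s = ∏ r, coordMonomial K fun q => s (c.embedding r q) := by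
    rw [coordMonomial, ← c.blocksFinEquiv.prod_comp, Fintype.prod_sigma]
    rfl
  have hb : ∀ r, homCoeff b Φ (c.blocksFun r) (fun q => basisSeq b s (c.sizeUpTo r + q)) (t r) =
      homCoeff b Φ (c.blocksFun r) (basisSeq b fun q => s (c.embedding r q)) (t r) := by
    intro r
    rw [homCoeff, homCoeff]
    congr 2
    refine isLocal_onGenerators Φ _ _ _ fun q hq => ?_
    rw [← c.coe_embedding r ⟨q, hq⟩, basisSeq_coe]
    exact (basisSeq_coe b (fun q => s (c.embedding r q)) ⟨q, hq⟩).symm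
  simp only [hb]
  rw [hm, ← Finset.prod_smul]
  rfl

variable {A₁ A₂ : Deformation K V}

theorem algebraMapInv_composition (hΦ : IsSuperfilteredOps (extSuper K V) (extSuper K V) 0 Φ)
    {k : ℕ} (c : Composition k) (u : ℕ → V) :
    ExteriorAlgebra.algebraMapInv (A₂.μ c.length fun r => Φ.app (c.blocksFun r)
      fun q => ExteriorAlgebra.ι K (u (c.sizeUpTo r + q))) =
      ∑ t : Fin c.length → Fin n, (∏ r, homCoeff b Φ (c.blocksFun r)
        (fun q => u (c.sizeUpTo r + q)) (t r)) • A₂.discCoeff b t := by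
  have h : (fun r => Φ.app (c.blocksFun r)
      fun q => ExteriorAlgebra.ι K (u (c.sizeUpTo r + q))) = fun r : Fin c.length =>
      ∑ i, homCoeff b Φ (c.blocksFun r) (fun q => u (c.sizeUpTo r + q)) i •
        ExteriorAlgebra.ι K (b i) :=
    funext fun r => onGenerators_eq b hΦ (c.one_le_blocksFun r) fun q => u (c.sizeUpTo r + q)
  rw [h, MultilinearMap.map_sum, map_sum]
  refine Finset.sum_congr rfl fun t _ => ?_
  rw [MultilinearMap.map_smul_univ, map_smul]
  rfl

/-- The homomorphism relations on generators, weighted by monomials and projected to scalars. -/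
theorem discTerm_eq_sum_composition
    (hΦ : IsSuperfilteredAInfHom (extSuper K V) (extSuper K V) 1 1 A₁.μ A₂.μ Φ) (k : ℕ) :
    A₁.discTerm b k = ∑ c : Composition k, ∑ t : Fin c.length → Fin n,
      A₂.discCoeff b t • ∏ r, homTerm b Φ (c.blocksFun r) (t r) := by
  have h := A₁.sum_insertionSum b hΦ.unit_one hΦ.unit_higher (k := k)
    (fun s => (LinearMap.toSpanSingleton K (FormalFunctions K n) (coordMonomial K s)).comp
      (ExteriorAlgebra.algebraMapInv (R := K) (M := V)).toLinearMap)
    (fun s e => by rw [coordMonomial_comp_perm])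
  simp only [LinearMap.comp_apply, AlgHom.toLinearMap_apply, map_one,
    LinearMap.toSpanSingleton_apply, one_smul] at h
  rw [Deformation.discTerm, ← h]
  have e : ∀ s : Fin k → Fin n, ExteriorAlgebra.algebraMapInv (insertionSum A₁.μ Φ k (fun _ => 1)
      fun q => ExteriorAlgebra.ι K (basisSeq b s q)) • coordMonomial K s =
      ∑ c : Composition k, ∑ t : Fin c.length → Fin n, A₂.discCoeff b t •
        (∏ r, homCoeff b Φ (c.blocksFun r)
          (fun q => basisSeq b s (c.sizeUpTo r + q)) (t r)) • coordMonomial K s := by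
    intro s
    rw [hΦ.relation k _ _ fun i => ι_mem_par (basisSeq b s i), map_sum, Finset.sum_smul]
    refine Finset.sum_congr rfl fun c _ => ?_
    rw [algebraMapInv_composition b hΦ.superfiltered, Finset.sum_smul]
    refine Finset.sum_congr rfl fun t _ => ?_
    rw [smul_assoc, smul_comm]
  rw [Finset.sum_congr rfl fun s _ => e s, Finset.sum_comm]
  refine Finset.sum_congr rfl fun c _ => ?_
  rw [Finset.sum_comm]
  refine Finset.sum_congr rfl fun t _ => ?_
  rw [← sum_blocks, Finset.smul_sum]

/-- The contribution to a composition of series of the terms with `l` factors, which have orders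
`β_1, …, β_l`. -/
def tupleTerm (Φ : Ops K (ExteriorAlgebra K V) (ExteriorAlgebra K V)) (A : Deformation K V)
    (e : Σ l, Fin l → ℕ) : FormalFunctions K n :=
  ∑ t : Fin e.1 → Fin n, A.discCoeff b t • ∏ r, homTerm b Φ (e.2 r) (t r)

theorem tupleTerm_mem (Φ : Ops K (ExteriorAlgebra K V) (ExteriorAlgebra K V))
    (A : Deformation K V) (e : Σ l, Fin l → ℕ) :
    tupleTerm b Φ A e ∈ ordIdeal K n (∑ r, e.2 r) :=
  sum_mem fun _ _ => smul_mem_ordIdeal _ (prod_mem_ordIdeal e.2 fun _ => homTerm_mem b Φ _ _)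

theorem map_subst_discTerm {Q : Type*} [CommRing Q] [Algebra K Q] (q : FormalFunctions K n →ₐ[K] Q)
    {f : Fin n → FormalFunctions K n} (hf : ∀ i, f i ∈ maxIdeal K n) {N : ℕ}
    (hq : ∀ i, q (f i) = q (∑ k ∈ Finset.Icc 1 N, homTerm b Φ k i)) (A : Deformation K V) (l : ℕ) :
    q (MvPowerSeries.subst f (A.discTerm b l)) =
      ∑ β ∈ Fintype.piFinset fun _ : Fin l => Finset.Icc 1 N, q (tupleTerm b Φ A ⟨l, β⟩) := by
  have hs := hasSubst_of_mem hf
  have hX : ∀ i, MvPowerSeries.substAlgHom (R := K) hs (MvPowerSeries.X i) = f i := fun i => by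
    rw [MvPowerSeries.coe_substAlgHom, MvPowerSeries.subst_X hs]
  have ht : ∀ β : Fin l → ℕ, q (tupleTerm b Φ A ⟨l, β⟩) = ∑ t : Fin l → Fin n,
      A.discCoeff b t • ∏ r, q (homTerm b Φ (β r) (t r)) := fun β => by
    rw [tupleTerm, map_sum]
    exact Finset.sum_congr rfl fun t _ => by rw [map_smul, map_prod]
  rw [← MvPowerSeries.coe_substAlgHom (R := K) hs, Deformation.discTerm, map_sum, map_sum,
    Finset.sum_congr rfl fun β _ => ht β, Finset.sum_comm]
  refine Finset.sum_congr rfl fun t _ => ?_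
  rw [map_smul, map_smul, coordMonomial, map_prod, map_prod, ← Finset.smul_sum]
  congr 1
  refine Eq.trans (Finset.prod_congr rfl fun r _ => ?_) (Finset.prod_univ_sum
    (fun _ => Finset.Icc 1 N) fun r k => q (homTerm b Φ k (t r)))
  rw [hX, hq, map_sum]

/-- A homomorphism of deformations induces a change of variables which relates the disc
potentials. -/
theorem discPotential_eq_subst
    (hΦ : IsSuperfilteredAInfHom (extSuper K V) (extSuper K V) 1 1 A₁.μ A₂.μ Φ) :
    A₁.discPotential b = MvPowerSeries.subst (changeOfVariables b Φ) (A₂.discPotential b) := by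
  have hfm : ∀ i, changeOfVariables b Φ i ∈ maxIdeal K n := changeOfVariables_mem b Φ
  have hs := hasSubst_of_mem hfm
  rw [← sub_eq_zero]
  refine eq_zero_of_mem_ordIdeal fun N => ordIdeal_anti (Nat.le_succ N) ?_
  rw [← Ideal.Quotient.eq]
  have hq0 : ∀ {x y}, x - y ∈ ordIdeal K n (N + 1) →
      Ideal.Quotient.mkₐ K (ordIdeal K n (N + 1)) x =
        Ideal.Quotient.mkₐ K (ordIdeal K n (N + 1)) y := fun h => Ideal.Quotient.eq.2 h
  generalize hq : Ideal.Quotient.mkₐ K (ordIdeal K n (N + 1)) = q at hq0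
  have h0 : ∀ e : Σ l, Fin l → ℕ, N < ∑ r, e.2 r → q (tupleTerm b Φ A₂ e) = 0 := fun e he => by
    rw [← hq]
    exact Ideal.Quotient.eq_zero_iff_mem.2 (ordIdeal_anti he (tupleTerm_mem b Φ A₂ e))
  have h3 := subst_mem_ordIdeal hfm (A₂.discPotential_sub_mem b N)
  rw [← MvPowerSeries.coe_substAlgHom hs, map_sub] at h3
  have hL := hq0 (A₁.discPotential_sub_mem b N)
  have hR := hq0 h3
  rw [map_sum] at hL
  rw [map_sum, map_sum, MvPowerSeries.coe_substAlgHom] at hR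
  have hl : ∀ k ∈ Finset.Icc 1 N, q (A₁.discTerm b k) =
      ∑ c : Composition k, q (tupleTerm b Φ A₂ ⟨c.length, c.blocksFun⟩) := fun k _ => by
    rw [discTerm_eq_sum_composition b hΦ, map_sum]
    rfl
  have hr : ∀ l ∈ Finset.Icc 1 N, q (MvPowerSeries.subst (changeOfVariables b Φ)
      (A₂.discTerm b l)) = ∑ β ∈ Fintype.piFinset fun _ : Fin l => Finset.Icc 1 N,
        q (tupleTerm b Φ A₂ ⟨l, β⟩) := fun l _ =>
    map_subst_discTerm b q hfm (fun i => hq0 (changeOfVariables_sub_mem b Φ i N)) A₂ l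
  rw [Finset.sum_congr rfl hl, sum_composition_eq_sum_tuple N _ h0, ← Finset.sum_congr rfl hr] at hL
  rw [← hq] at hL hR
  exact hL.trans hR.symm

end ChangeOfVariables

/-! ### Equivalent deformations have equivalent disc potentials -/

section Equivalence

variable {K : Type u} [CommRing K] {V : Type v} [AddCommGroup V] [Module K V] {n : ℕ}
  (b : Module.Basis (Fin n) K V)

/-- A surjective superfiltered endomorphism of the exterior algebra restricts to a surjective
endomorphism of the generators. It induces a surjective, hence injective, endomorphism of the
finitely generated module `E / F¹E`, so preimages of elements of `F¹E` lie in `F¹E`. -/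
theorem exists_ι_preimage [Module.Finite K (ExteriorAlgebra K V)]
    {L : ExteriorAlgebra K V →ₗ[K] ExteriorAlgebra K V}
    (hL : IsSuperfilteredMap (extSuper K V) (extSuper K V) 0 L) (hs : Function.Surjective L)
    (y : V) : ∃ x : V, L (ExteriorAlgebra.ι K x) = ExteriorAlgebra.ι K y := by
  have hfil : (extSuper K V).fil 1 ≤ ((extSuper K V).fil 1).comap L := fun x hx => by
    have := hL.fil 1 x hx
    rwa [add_zero] at this
  have hinj : Function.Injective (((extSuper K V).fil 1).mapQ _ L hfil) := by
    refine OrzechProperty.injective_of_surjective_endomorphism _ fun z => ?_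
    obtain ⟨z, rfl⟩ := Submodule.mkQ_surjective _ z
    obtain ⟨x, rfl⟩ := hs z
    exact ⟨Submodule.mkQ _ x, rfl⟩
  have hpre : ∀ z, L z ∈ (extSuper K V).fil 1 → z ∈ (extSuper K V).fil 1 := fun z hz => by
    rw [← Submodule.Quotient.mk_eq_zero]
    refine hinj ?_
    rw [map_zero]
    exact (Submodule.Quotient.mk_eq_zero _).2 hz
  obtain ⟨z, hz⟩ := hs (ExteriorAlgebra.ι K y)
  have h0 := hL.par 0 _ ((extSuper K V).proj_mem 0 z)
  have h1 := hL.par 1 _ ((extSuper K V).proj_mem 1 z)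
  rw [Int.cast_zero, add_zero] at h0 h1
  have hz1 : L ((extSuper K V).proj 1 z) = ExteriorAlgebra.ι K y := by
    have e := congrArg ((extSuper K V).proj 1) hz
    rw [← (extSuper K V).proj_add_proj z, map_add, map_add, (extSuper K V).proj_of_mem h1,
      (extSuper K V).proj_of_mem (ι_mem_par y), (extSuper K V).proj_of_mem_add (i := 1)
        (by rwa [show (1 + 1 : ZMod 2) = 0 by decide]), zero_add] at e
    exact e
  obtain ⟨x, hx⟩ := exists_ι_of_mem (hpre _ (by rw [hz1]; exact ι_mem_fil y))
    ((extSuper K V).proj_mem 1 z)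
  exact ⟨x, by rw [hx, hz1]⟩

/-- The linear part of the change of variables has a right inverse, and is hence invertible. -/
theorem exists_homCoeff_inverse {Φ : Ops K (ExteriorAlgebra K V) (ExteriorAlgebra K V)}
    (hΦ : IsSuperfilteredOps (extSuper K V) (extSuper K V) 0 Φ)
    (hs : Function.Surjective fun a => Φ 1 ![a]) :
    ∃ B : Matrix (Fin n) (Fin n) K,
      (Matrix.of fun i j => homCoeff b Φ 1 (fun _ => b j) i) * B = 1 := by
  set L : ExteriorAlgebra K V →ₗ[K] ExteriorAlgebra K V :=
    (MultilinearMap.ofSubsingleton K (ExteriorAlgebra K V) (ExteriorAlgebra K V) (0 : Fin 1)).symm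
      (Φ 1) with hL
  have hLa : ∀ a, Φ.app 1 (fun _ => a) = L a := fun a => rfl
  have hLs : IsSuperfilteredMap (extSuper K V) (extSuper K V) 0 L :=
    { par := fun i a ha => by simpa [hLa] using hΦ.par 1 le_rfl (fun _ => i) _ fun _ => ha
      fil := fun p a ha => by simpa [hLa] using hΦ.fil 1 le_rfl (fun _ => p) _ fun _ => ha }
  have hLsurj : Function.Surjective L := fun y => by
    obtain ⟨x, hx⟩ := hs y
    refine ⟨x, Eq.trans ?_ hx⟩
    rw [← hLa]
    refine congrArg (Φ 1) (funext fun q => ?_)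
    obtain rfl : q = 0 := Subsingleton.elim _ _
    rfl
  have : Module.Finite K (ExteriorAlgebra K V) := Module.Finite.of_basis b.ExteriorAlgebra
  choose g hg using exists_ι_preimage hLs hLsurj
  set T : V →ₗ[K] V := ExteriorAlgebra.ιInv ∘ₗ L ∘ₗ ExteriorAlgebra.ι K with hT
  have hTg : T ∘ₗ b.constr K (fun j => g (b j)) = LinearMap.id := b.ext fun j => by
    rw [LinearMap.comp_apply, b.constr_basis, hT, LinearMap.comp_apply, LinearMap.comp_apply, hg,
      ExteriorAlgebra.ι_leftInverse (b j), LinearMap.id_apply]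
  refine ⟨LinearMap.toMatrix b b (b.constr K fun j => g (b j)), ?_⟩
  have hA : (Matrix.of fun i j => homCoeff b Φ 1 (fun _ => b j) i) = LinearMap.toMatrix b b T := by
    ext i j
    rw [LinearMap.toMatrix_apply]
    rfl
  rw [hA, ← LinearMap.toMatrix_comp, hTg, LinearMap.toMatrix_id]

/-- The terms of degree at most `d` in the change of variables are those of the identity: the
leading term of `Φ` is trivial up to `d`, and odd elements of `F⁰E` vanish. -/
theorem sum_homTerm_eq_X {d : ℕ∞} {Φ : Ops K (ExteriorAlgebra K V) (ExteriorAlgebra K V)}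
    (hΦ : IsSuperfilteredOps (extSuper K V) (extSuper K V) 0 Φ)
    (h1 : 1 ≤ d → ∀ p : ℕ, ∀ a ∈ ⋀[K]^p V, Φ 1 ![a] - a ∈ (extSuper K V).fil ((p : ℤ) - 1))
    (h2 : ∀ k : ℕ, 2 ≤ k → (k : ℕ∞) ≤ d → ∀ (p : Fin k → ℕ) (a : Fin k → ExteriorAlgebra K V),
      (∀ i, a i ∈ ⋀[K]^(p i) V) →
      Φ k a ∈ (extSuper K V).fil ((∑ i, ((p i : ℤ) - 1)) + 1 - 1)) {k : ℕ} (hk : 1 ≤ k)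
    (hkd : (k : ℕ∞) ≤ d) (i : Fin n) :
    ∑ l ∈ Finset.Icc 1 k, homTerm b Φ l i = MvPowerSeries.X i := by
  have hz : ∀ l ∈ Finset.Ioc 1 k, homTerm b Φ l i = 0 := by
    intro l hl
    rw [Finset.mem_Ioc] at hl
    refine Finset.sum_eq_zero fun s _ => ?_
    have h := h2 l hl.1 (le_trans (by exact_mod_cast hl.2) hkd) (fun _ => 1)
      (fun q => ExteriorAlgebra.ι K (basisSeq b s q)) fun q => ι_mem_exteriorPower _
    have h0 : onGenerators Φ l (basisSeq b s) = 0 :=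
      eq_zero_of_odd_of_fil_zero (by simpa [onGenerators, Ops.app] using h)
        (onGenerators_par hΦ hl.1.le _)
    rw [homCoeff, h0, map_zero, map_zero, zero_smul]
  have hlin : ∀ j, onGenerators Φ 1 (fun _ => b j) = ExteriorAlgebra.ι K (b j) := by
    intro j
    have h := h1 (le_trans (by exact_mod_cast hk) hkd) 1 _ (ι_mem_exteriorPower (b j))
    have e : onGenerators Φ 1 (fun _ => b j) = Φ 1 ![ExteriorAlgebra.ι K (b j)] := by
      refine congrArg (Φ 1) (funext fun q => ?_)
      obtain rfl : q = 0 := Subsingleton.elim _ _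
      rfl
    rw [← sub_eq_zero]
    refine eq_zero_of_odd_of_fil_zero ?_
      (sub_mem (onGenerators_par hΦ le_rfl _) (ι_mem_par (b j)))
    rw [e]
    simpa using h
  rw [← Finset.add_sum_Ioc_eq_sum_Icc hk, Finset.sum_eq_zero hz, add_zero, homTerm_one,
    Finset.sum_eq_single i]
  · rw [homCoeff, hlin, ExteriorAlgebra.ι_leftInverse (b i), Module.Basis.coord_apply,
      b.repr_self, Finsupp.single_eq_same, one_smul]
  · intro j _ hj
    rw [homCoeff, hlin, ExteriorAlgebra.ι_leftInverse (b j), Module.Basis.coord_apply,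
      b.repr_self, Finsupp.single_eq_of_ne hj.symm, zero_smul]
  · exact fun h => absurd (Finset.mem_univ i) h

theorem Deformation.Equivalent.potentialEquivalent {d : ℕ∞} {A₁ A₂ : Deformation K V}
    (h : Deformation.Equivalent d A₁ A₂) :
    PotentialEquivalent d (A₁.discPotential b) (A₂.discPotential b) := by
  obtain ⟨Φ, hΦ, hbij, h1, h2⟩ := h
  obtain ⟨B, hB⟩ := exists_homCoeff_inverse b hΦ.superfiltered hbij.2
  obtain ⟨g, hg, hgf, hfg⟩ := exists_formal_inverse (f := changeOfVariables b Φ) _ B hB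
    fun i => by
      have := changeOfVariables_sub_mem b Φ i 1
      rw [Finset.Icc_self, Finset.sum_singleton, homTerm_one] at this
      exact this
  refine ⟨changeOfVariables b Φ, g, changeOfVariables_mem b Φ, hg, hgf, hfg,
    discPotential_eq_subst b hΦ, fun k hk i => ?_⟩
  rw [← ordIdeal_eq_pow]
  rcases Nat.eq_zero_or_pos k with rfl | hk0
  · refine sub_mem ?_ (X_mem_ordIdeal i)
    rw [zero_add, ordIdeal_one]
    exact changeOfVariables_mem b Φ i
  · have := changeOfVariables_sub_mem b Φ i k
    rwa [sum_homTerm_eq_X b hΦ.superfiltered h1 h2 hk0 hk] at this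

theorem exists_deformation_of_mem {w : FormalFunctions K n} (hw : w ∈ maxIdeal K n ^ 2) :
    ∃ A : Deformation K V, A.discPotential b = w := by
  obtain ⟨ŵ, -, hŵ, hsum, -⟩ := exists_stabilisation_choice hw
  obtain ⟨T⟩ := nonempty_transferData b hsum hŵ
  exact ⟨T.deformation hŵ, T.discPotential_deformation b hŵ⟩

end Equivalence

end MFPot

end

theorem mainTheorem3 {K : Type u} [CommRing K] {V : Type v} [AddCommGroup V] [Module K V] {n : ℕ}
    (b : Module.Basis (Fin n) K V) :
    -- the disc potential of a deformation is a well-defined element of `𝔪²`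
    (∀ A : MFPot.Deformation K V,
      A.potentialE b = MvPowerSeries.map (algebraMap K (ExteriorAlgebra K V)) (A.discPotential b) ∧
      A.discPotential b ∈ MFPot.maxIdeal K n ^ 2) ∧
    (∀ w ∈ MFPot.maxIdeal K n ^ 2,
      -- the choices in the construction of the stabilisation of `K` can be made
      (∃ (ŵ : Fin n → MFPot.FormalFunctions K n) (c : Fin n → Fin n → MFPot.FormalFunctions K n),
        (∀ i, ŵ i ∈ MFPot.maxIdeal K n) ∧ ∑ i, MvPowerSeries.X i * ŵ i = w ∧
        (∀ i, ŵ i = -∑ j, c i j * MvPowerSeries.X j) ∧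
        ∀ i j, i < j → c i j ∈ MFPot.maxIdeal K n) ∧
      -- for every choice:
      ∀ (ŵ : Fin n → MFPot.FormalFunctions K n), (∀ i, ŵ i ∈ MFPot.maxIdeal K n) →
        ∀ hw : ∑ i, MvPowerSeries.X i * ŵ i = w,
        -- the endomorphism algebra is a superfiltered `A∞`-algebra
        MFPot.IsSuperfilteredAInf (MFPot.endS b ŵ hw) (1 : MFPot.EndAlg K V n)
          (MFPot.endμ b ŵ hw) ∧
        -- data for homotopy transfer exist, in particular for the map `ι` which sends
        -- `v_{i_1} ∧ ⋯ ∧ v_{i_r}` to `f_{i_1} ∘ ⋯ ∘ f_{i_r}`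
        Nonempty (MFPot.TransferData b ŵ hw) ∧
        (∀ c : Fin n → Fin n → MFPot.FormalFunctions K n,
          (∀ i, ŵ i = -∑ j, c i j * MvPowerSeries.X j) →
          (∀ i j, i < j → c i j ∈ MFPot.maxIdeal K n) →
          ∃ T : MFPot.TransferData b ŵ hw, ∀ s : Finset (Fin n),
            T.incl ((s.sort (· ≤ ·)).map (fun i => ExteriorAlgebra.ι K (b i))).prod =
              ((s.sort (· ≤ ·)).map (MFPot.correctedCocycle b c)).prod) ∧
        -- homotopy transfer gives a superfiltered `A∞`-deformation of `E`, which is a minimal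
        -- model of the endomorphism algebra and whose disc potential is `w`
        ∀ T : MFPot.TransferData b ŵ hw, ∃ A : MFPot.Deformation K V,
          (∀ k, 2 ≤ k → ∀ a : ℕ → ExteriorAlgebra K V, A.μ.app k a = T.minOp k a) ∧
          (∃ I : MFPot.Ops K (ExteriorAlgebra K V) (MFPot.EndAlg K V n),
            (∀ k, 1 ≤ k → ∀ a : ℕ → ExteriorAlgebra K V, I.app k a = T.inclOp k a) ∧
            MFPot.IsSuperfilteredAInfHom (MFPot.extSuper K V)
              (MFPot.endS b ŵ hw) 1 (1 : MFPot.EndAlg K V n)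
              A.μ (MFPot.endμ b ŵ hw) I) ∧
          A.discPotential b = w) ∧
    -- the map on equivalence classes induced by the disc potential is surjective
    (∀ d : ℕ∞, ∃ F : Quot (MFPot.Deformation.Equivalent (K := K) (V := V) d) →
        Quot (fun P Q : {P : MFPot.FormalFunctions K n // P ∈ MFPot.maxIdeal K n ^ 2} =>
          MFPot.PotentialEquivalent d P.1 Q.1),
      (∀ A : MFPot.Deformation K V, ∃ hA : A.discPotential b ∈ MFPot.maxIdeal K n ^ 2,
        F (Quot.mk _ A) = Quot.mk _ ⟨A.discPotential b, hA⟩) ∧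
      Function.Surjective F) := by
  refine ⟨fun A => ⟨A.potentialE_eq b, A.discPotential_mem b⟩, fun w hw =>
    ⟨MFPot.exists_stabilisation_choice hw, fun ŵ hŵ hsum => ⟨?_, ?_, ?_, fun T => ?_⟩⟩,
    fun d => ?_⟩
  · exact (MFPot.stab b ŵ hsum).isSuperfilteredAInf_endOps K
  · exact MFPot.nonempty_transferData b hsum hŵ
  · exact fun c hc hc' => MFPot.exists_transferData_of_triangular b hsum hc hc' hŵ
  · exact ⟨T.deformation hŵ, fun k _ a => T.deformation_app hŵ k a,
      ⟨(T.contraction hŵ).inclOps, fun k _ a => T.inclOps_app hŵ k a,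
        T.isSuperfilteredAInfHom hŵ⟩, T.discPotential_deformation b hŵ⟩
  · refine ⟨Quot.map (fun A => ⟨A.discPotential b, A.discPotential_mem b⟩)
      fun A₁ A₂ h => h.potentialEquivalent b, fun A => ⟨A.discPotential_mem b, rfl⟩, ?_⟩
    rintro ⟨⟨w, hw⟩⟩
    obtain ⟨A, rfl⟩ := MFPot.exists_deformation_of_mem b hw
    exact ⟨Quot.mk _ A, rfl⟩
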